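/- **Setting.** Fix an ultraviolet parameter $\Lambda>0$ and a smooth cut-off $\chi:[0,\infty)\to[0,1]$ with $\chi(r)=1$ for $r<\tfrac12$ and $\chi(r)=0$ for $r>1$. Fix measurable polarization vectors $\mathbf e_1(k),\mathbf e_2(k)\in\mathbb R^3$ which, together with $k/|k|$, form an orthonormal basis of $\mathbb R^3$ for a.e. $k\in\mathbb R^3$. For $\alpha>0$ and $y>0$ define the coupling functions (each with three spatial components $j=1,2,3$ and two polarization components $\gamma=1,2$) $$\lambda_{\infty,\gamma}(k)=\frac{\chi(|k|/\Lambda)}{\sqrt2\,\pi|k|^{1/2}}\,\mathbf e_\gamma(k),\qquad k\in\mathbb R^3,$$ $$\lambda_{y,\gamma}(k)=\frac{2\chi(|k|/\Lambda)}{\sqrt2\,\pi|k|^{1/2}}\bigl(\mathbf e^{(1)}_\gamma(k)\cos(k_1y),\,-\mathbf e^{(2)}_\gamma(k)\sin(k_1y),\,-\mathbf e^{(3)}_\gamma(k)\sin(k_1y)\bigr),\qquad k_1>0,$$ with $\|\lambda\|^2=\sum_{j,\gamma}\int|\lambda^{(j)}_\gamma(k)|^2\,dk$ over $\mathbb R^3$,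 respectively over $\mathbb R^3_+=\{k_1>0\}$. On $L^2(\mathbb R^3)$ let $h_\alpha=-\Delta-\alpha/|x|$ with domain $H^2(\mathbb R^3)$, $e_\alpha=-\alpha^2/4$, $u_\alpha(x)=\frac{\alpha^{3/2}}{\sqrt{8\pi}}e^{-\alpha|x|/2}$, $P=i\nabla$. On the one-photon states $L^2(\mathbb R^3;dx)\otimes L^2(dk;\mathbb C^2)$, with $k\in\mathbb R^3$ (superscript $\infty$) or $k\in\mathbb R^3_+$ (superscript $y$), let $H_f$ be multiplication by $|k|$, and set $$\Phi_\#^{\infty}=2\alpha^{1/2}(h_\alpha-e_\alpha+H_f)^{-1}\sum_{j=1}^3P_ju_\alpha\otimes\lambda_\infty^{(j)},\qquad \Phi_\#^{y}=2\alpha^{1/2}(h_\alpha-e_\alpha+H_f)^{-1}\sum_{j=1}^3P_ju_\alpha\otimes\lambda_y^{(j)},$$ and $\|\Phi\|_\#^2=\langle\Phi\,|\,h_\alpha-e_\alpha+H_f\,|\,\Phi\rangle$. For $L>1$ put $y=L\alpha^{-1}$, $$\mathscr E=\alpha\bigl(\|\lambda_y\|^2-\|\lambda_\infty\|^2\bigr)+\|\Phi_\#^\infty\|_\#^2-\|\Phi_\#^y\|_\#^2,\qquad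 \aleph_{\alpha,L}=\frac1{6\pi}\sum_{j=1}^3\Bigl\langle x_ju_1\,\Big|\,\alpha L\arctan\Bigl(\frac1{\alpha L(h_1-e_1)}\Bigr)\Big|\,x_ju_1\Bigr\rangle,$$ where the operator in $\aleph_{\alpha,L}$ is defined by the functional calculus (with $\arctan(1/0)=\pi/2$). **Proposition.** There exist $\alpha_0\in(0,1)$ and $C>0$ such that for all $0<\alpha\le\alpha_0$ and all $L>1$ the operators $h_\alpha-e_\alpha+H_f$ are injective and their ranges contain the vectors to which the inverses are applied above (so that $\Phi_\#^\infty$ and $\Phi_\#^y$ are well defined), and $$\Bigl|\mathscr E-\Bigl(\frac{\alpha^2}{L^3}-\aleph_{\alpha,L}\frac{\alpha}{L^4}\Bigr)\Bigr|\le C\Bigl(\frac{\alpha^3}{L^2}\log(\alpha^{-1})+\alpha^4\log(\alpha^{-1})\Bigr).$$ -/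

import Mathlib

open MeasureTheory Filter Topology
open scoped ENNReal SchwartzMap Laplacian ContDiff

noncomputable section

namespace CasimirPolder

/-! ## Generalities on unbounded operators -/

section Operators

variable {E : Type*} [NormedAddCommGroup E] [InnerProductSpace ℂ E]

/-- The operator `T + c`, on the domain of `T`. -/
def shift (T : E →ₗ.[ℂ] E) (c : ℝ) : E →ₗ.[ℂ] E :=
  ((c : ℂ) • (LinearMap.id : E →ₗ[ℂ] E)) +ᵥ T

/-- The vector `T⁻¹ v`, for an injective operator `T` and a vector `v` in its range
(by convention `0` if `v` is not in the range). -/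
def invApply (T : E →ₗ.[ℂ] E) (v : E) : E :=
  open scoped Classical in if h : v ∈ T.inverse.domain then T.inverse ⟨v, h⟩ else 0

/-- The quadratic form `⟨v | T | v⟩` of a symmetric operator `T` at a vector `v` of its domain
(by convention `0` off the domain). -/
def quadForm (T : E →ₗ.[ℂ] E) (v : E) : ℝ :=
  open scoped Classical in if h : v ∈ T.domain then (inner ℂ v (T ⟨v, h⟩)).re else 0

/-- `B` is the everywhere defined bounded inverse of `T`. -/
def IsBoundedInverse (T : E →ₗ.[ℂ] E) (B : E →L[ℂ] E) : Prop :=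
  ∀ v w : E, B v = w ↔ (w, v) ∈ T.graph

/-- The bounded inverse of `T` (by convention `0` if there is none). -/
def boundedInverse (T : E →ₗ.[ℂ] E) : E →L[ℂ] E :=
  open scoped Classical in
    if h : ∃ B : E →L[ℂ] E, IsBoundedInverse T B then h.choose else 0

/-- Functional calculus: the bounded operator `g(T)`, for a self-adjoint operator `T ≥ 0` and a
continuous function `g` on `[0, ∞)` that vanishes at infinity. It is obtained from the continuous
functional calculus of the bounded self-adjoint operator `B = (T + 1)⁻¹`, whose spectrum lies in
`[0, 1]`: the spectral value `t ≥ 0` of `T` corresponds to `b = 1 / (t + 1)`, that is to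
`t = 1 / b - 1`, and `b = 0` corresponds to `t = ∞`, where `g` vanishes. -/
def funCalc [CompleteSpace E] (T : E →ₗ.[ℂ] E) (g : ℝ → ℝ) : E →L[ℂ] E :=
  cfc (fun b : ℝ => if b = 0 then 0 else g (b⁻¹ - 1)) (boundedInverse (shift T 1))

end Operators

/-! ## The hydrogen atom -/

/-- Configuration space and momentum space; the coordinates are `x 0`, `x 1`, `x 2`. -/
abbrev R3 : Type := EuclideanSpace ℝ (Fin 3)

/-- The state space `L²(ℝ³)` of the electron. -/
abbrev ElectronSpace : Type := Lp ℂ 2 (volume : Measure R3)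

/-- The `L²` class of a square integrable function (by convention `0` for other functions). -/
def toL2 (f : R3 → ℂ) : ElectronSpace :=
  open scoped Classical in if h : MemLp f 2 volume then h.toLp f else 0

/-- The graph of `-Δ` on the Sobolev space `H²(ℝ³)`, with `Δ` in the sense of distributions. -/
def kineticGraph : Submodule ℂ (ElectronSpace × ElectronSpace) where
  carrier := {p | TemperedDistribution.MemSobolev 2 2 (p.1 : 𝓢'(R3, ℂ)) ∧
    (p.2 : 𝓢'(R3, ℂ)) = -Δ (p.1 : 𝓢'(R3, ℂ))}
  add_mem' := by
    rintro ⟨a, b⟩ ⟨c, d⟩ ⟨h1, h2⟩ ⟨h3, h4⟩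
    have e (f g : ElectronSpace) : ((f + g : ElectronSpace) : 𝓢'(R3, ℂ)) = f + g :=
      map_add (Lp.toTemperedDistributionCLM ℂ (volume : Measure R3) 2) f g
    have h5 := map_add (LineDeriv.laplacianCLM ℂ R3 𝓢'(R3, ℂ)) (a : 𝓢'(R3, ℂ)) c
    simp only [TemperedDistribution.laplacianCLM_apply] at h5
    simp only at h2 h4
    refine ⟨?_, ?_⟩
    · simp only [Prod.mk_add_mk, e]
      exact h1.add h3
    · simp only [Prod.mk_add_mk, e, h2, h4, h5]
      abel
  zero_mem' := by
    have e : ((0 : ElectronSpace) : 𝓢'(R3, ℂ)) = 0 :=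
      map_zero (Lp.toTemperedDistributionCLM ℂ (volume : Measure R3) 2)
    have h5 := map_zero (LineDeriv.laplacianCLM ℂ R3 𝓢'(R3, ℂ))
    simp only [TemperedDistribution.laplacianCLM_apply] at h5
    refine ⟨?_, ?_⟩
    · simp only [Prod.fst_zero, e]
      exact TemperedDistribution.memSobolev_fun_zero R3 ℂ 2 2
    · simp only [Prod.fst_zero, Prod.snd_zero, e, h5, neg_zero]
  smul_mem' := by
    rintro r ⟨a, b⟩ ⟨h1, h2⟩
    have e (f : ElectronSpace) : ((r • f : ElectronSpace) : 𝓢'(R3, ℂ)) = r • (f : 𝓢'(R3, ℂ)) :=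
      map_smul (Lp.toTemperedDistributionCLM ℂ (volume : Measure R3) 2) r f
    have h5 := map_smul (LineDeriv.laplacianCLM ℂ R3 𝓢'(R3, ℂ)) r (a : 𝓢'(R3, ℂ))
    simp only [TemperedDistribution.laplacianCLM_apply] at h5
    simp only at h2
    refine ⟨?_, ?_⟩
    · simp only [Prod.smul_mk, e]
      exact h1.smul r
    · simp only [Prod.smul_mk, e, h2, h5, smul_neg]

theorem kineticGraph_functional (x : ElectronSpace × ElectronSpace) (hx : x ∈ kineticGraph)
    (h0 : x.1 = 0) : x.2 = 0 := by
  have h2 := hx.2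
  have e : ((0 : ElectronSpace) : 𝓢'(R3, ℂ)) = 0 :=
    map_zero (Lp.toTemperedDistributionCLM ℂ (volume : Measure R3) 2)
  have h5 := map_zero (LineDeriv.laplacianCLM ℂ R3 𝓢'(R3, ℂ))
  simp only [TemperedDistribution.laplacianCLM_apply] at h5
  rw [h0, e, h5, neg_zero] at h2
  have hker := Lp.ker_toTemperedDistributionCLM_eq_bot (F := ℂ) (μ := (volume : Measure R3))
    (p := 2)
  rw [LinearMap.ker_eq_bot'] at hker
  exact hker _ h2

/-- The kinetic energy `-Δ` of the electron, with domain `H²(ℝ³)`. -/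
def kinetic : ElectronSpace →ₗ.[ℂ] ElectronSpace := kineticGraph.toLinearPMap

theorem kinetic_graph : kinetic.graph = kineticGraph :=
  kineticGraph.toLinearPMap_graph_eq kineticGraph_functional

/-- The graph of the operator of multiplication by a function `V`. -/
def multGraph (V : R3 → ℂ) : Submodule ℂ (ElectronSpace × ElectronSpace) where
  carrier := {p | ∀ᵐ x, p.2 x = V x * p.1 x}
  add_mem' := by
    rintro ⟨a, b⟩ ⟨c, d⟩ h1 h2
    filter_upwards [h1, h2, Lp.coeFn_add a c, Lp.coeFn_add b d] with x h1 h2 h3 h4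
    simp only [Prod.mk_add_mk, h3, h4, Pi.add_apply] at *
    rw [h1, h2]; ring
  zero_mem' := by
    filter_upwards [Lp.coeFn_zero ℂ 2 (volume : Measure R3)] with x h
    simp
  smul_mem' := by
    rintro r ⟨a, b⟩ h1
    filter_upwards [h1, Lp.coeFn_smul r a, Lp.coeFn_smul r b] with x h1 h2 h3
    simp only [Prod.smul_mk, h2, h3, Pi.smul_apply, smul_eq_mul] at *
    rw [h1]; ring

theorem multGraph_functional (V : R3 → ℂ) (x : ElectronSpace × ElectronSpace)
    (hx : x ∈ multGraph V) (h0 : x.1 = 0) : x.2 = 0 := by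
  rw [Lp.eq_zero_iff_ae_eq_zero]
  have hx' : ∀ᵐ t, x.2 t = V t * x.1 t := hx
  rw [h0] at hx'
  filter_upwards [hx', Lp.coeFn_zero ℂ 2 (volume : Measure R3)] with t h1 h2
  simp [h1]

/-- Multiplication by `V`, with its maximal domain `{f ∈ L² | V f ∈ L²}`. -/
def mult (V : R3 → ℂ) : ElectronSpace →ₗ.[ℂ] ElectronSpace := (multGraph V).toLinearPMap

theorem mult_graph (V : R3 → ℂ) : (mult V).graph = multGraph V :=
  (multGraph V).toLinearPMap_graph_eq (multGraph_functional V)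

/-- The hydrogen Hamiltonian `h_α = -Δ - α/|x|`. The domain of the operator sum is
`H²(ℝ³) ∩ {f | f/|x| ∈ L²}`, which is `H²(ℝ³)` by Hardy's inequality. -/
def hydrogen (α : ℝ) : ElectronSpace →ₗ.[ℂ] ElectronSpace :=
  kinetic + mult (fun x => ((-(α / ‖x‖) : ℝ) : ℂ))

/-- The ground state energy `e_α = -α²/4`. -/
def groundEnergy (α : ℝ) : ℝ := -(α ^ 2 / 4)

/-- The excitation operator `h_α - e_α ≥ 0`. -/
def excitation (α : ℝ) : ElectronSpace →ₗ.[ℂ] ElectronSpace :=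
  shift (hydrogen α) (-groundEnergy α)

/-- The normalized ground state `u_α(x) = α^{3/2} (8π)^{-1/2} e^{-α|x|/2}`. -/
def groundState (α : ℝ) (x : R3) : ℝ :=
  α ^ (3 / 2 : ℝ) / √(8 * Real.pi) * Real.exp (-(α * ‖x‖ / 2))

/-- The component `P_j u_α = i ∂_j u_α` of `P u_α`, as an element of `L²(ℝ³)`. (`u_α` is Lipschitz
and smooth off the origin, so the pointwise derivative is the weak one.) -/
def momentumGround (α : ℝ) (j : Fin 3) : ElectronSpace :=
  toL2 fun x => Complex.I *
    ((lineDeriv ℝ (groundState α) x (EuclideanSpace.single j (1 : ℝ)) : ℝ) : ℂ)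

/-- The vector `x_j u_1` of `L²(ℝ³)`. -/
def dipoleGround (j : Fin 3) : ElectronSpace :=
  toL2 fun x => ((x j * groundState 1 x : ℝ) : ℂ)

/-- The function `t ↦ arctan (1 / (s t))` on `[0, ∞)`, with its limit `π/2` as value at `t = 0`. -/
def arctanRecip (s t : ℝ) : ℝ :=
  if t = 0 then Real.pi / 2 else Real.arctan (1 / (s * t))

/-- `ℵ_{α,L} = (6π)⁻¹ ∑_j ⟨x_j u_1 | α L arctan (1 / (α L (h_1 - e_1))) | x_j u_1⟩`. -/
def aleph (α L : ℝ) : ℝ :=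
  1 / (6 * Real.pi) * ∑ j : Fin 3,
    (inner ℂ (dipoleGround j)
      (((α * L : ℝ) : ℂ) • funCalc (excitation 1) (arctanRecip (α * L)) (dipoleGround j))).re

/-! ## Photons -/

/-- One-photon states with momentum distributed in the support of `μ`:
square integrable functions of the momentum `k`, with two polarization components. -/
abbrev PhotonSpace (μ : Measure R3) : Type := Lp (EuclideanSpace ℂ (Fin 2)) 2 μ

/-- The photon momenta of the free model: `dk` on `ℝ³`. -/
abbrev fullMeasure : Measure R3 := volume

/-- The photon momenta in presence of the wall: `dk` on the half space `k₁ > 0`. -/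
abbrev halfMeasure : Measure R3 := volume.restrict {k : R3 | 0 < k 0}

/-- A smooth ultraviolet cut-off profile. On `[0, ∞)` it is a `[0,1]`-valued smooth function equal
to `1` on `[0, 1/2)` and to `0` on `(1, ∞)`; it is extended by `1` to negative arguments. -/
structure Cutoff where
  χ : ℝ → ℝ
  smooth : ContDiff ℝ ∞ χ
  eq_one : ∀ r, r < 1 / 2 → χ r = 1
  eq_zero : ∀ r, 1 < r → χ r = 0
  mem_Icc : ∀ r, χ r ∈ Set.Icc (0 : ℝ) 1

/-- A measurable choice of two polarization vectors, which form together with `k / |k|` an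
orthonormal basis of `ℝ³` for almost every momentum `k`. -/
structure Polarization where
  e : Fin 2 → R3 → R3
  measurable : ∀ γ, Measurable (e γ)
  orthonormal : ∀ᵐ k : R3, Orthonormal ℝ ![(‖k‖⁻¹ : ℝ) • k, e 0 k, e 1 k]

/-- The scalar factor `χ(|k|/Λ) / (√2 π |k|^{1/2})` of the coupling functions. -/
def couplingFactor (c : Cutoff) (Λ : ℝ) (k : R3) : ℝ :=
  c.χ (‖k‖ / Λ) / (√2 * Real.pi * √‖k‖)

theorem measurable_couplingFactor (c : Cutoff) (Λ : ℝ) : Measurable (couplingFactor c Λ) := by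
  have := c.smooth.continuous.measurable
  unfold couplingFactor
  fun_prop

theorem memLp_couplingFactor (c : Cutoff) {Λ : ℝ} (hΛ : 0 < Λ) :
    MemLp (couplingFactor c Λ) 2 (volume : Measure R3) := by
  rw [memLp_two_iff_integrable_sq (measurable_couplingFactor c Λ).aestronglyMeasurable]
  have h := integrable_fun_norm_addHaar (volume : Measure R3)
    (f := fun r : ℝ => (c.χ (r / Λ) / (√2 * Real.pi * √r)) ^ 2)
  refine h.2 ?_
  have hd : Module.finrank ℝ R3 - 1 = 2 := by simp
  rw [hd]
  have hcont := c.smooth.continuous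
  have hb : IntegrableOn (fun r : ℝ => (c.χ (r / Λ)) ^ 2 * r / (2 * Real.pi ^ 2))
      (Set.Icc 0 Λ) := by
    apply Continuous.integrableOn_Icc
    fun_prop
  have hb2 : IntegrableOn (fun r : ℝ => (c.χ (r / Λ)) ^ 2 * r / (2 * Real.pi ^ 2))
      (Set.Ioi 0) := by
    refine hb.of_forall_sdiff_eq_zero measurableSet_Ioi ?_
    intro r hr
    have h1 : Λ < r := by
      by_contra hle
      exact hr.2 ⟨le_of_lt hr.1, not_lt.1 hle⟩
    have : 1 < r / Λ := by rwa [lt_div_iff₀ hΛ, one_mul]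
    simp [c.eq_zero _ this]
  refine hb2.congr_fun ?_ measurableSet_Ioi
  intro r hr
  have hr' : (0 : ℝ) < r := hr
  have h2 : √r ^ 2 = r := Real.sq_sqrt hr'.le
  have h3 : (√2 : ℝ) ^ 2 = 2 := Real.sq_sqrt (by norm_num)
  simp only [smul_eq_mul, div_pow, mul_pow, h2, h3]
  field_simp

/-- The coupling function in spatial direction `j` with an additional scalar profile `w`:
its component of polarization `γ` is `χ(|k|/Λ) / (√2 π |k|^{1/2}) w(k) e_γ^{(j)}(k)`. -/
def couplingFun (c : Cutoff) (Λ : ℝ) (p : Polarization) (w : R3 → ℝ) (j : Fin 3) (k : R3) :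
    EuclideanSpace ℂ (Fin 2) :=
  WithLp.toLp 2 fun γ => ((couplingFactor c Λ k * w k * p.e γ k j : ℝ) : ℂ)

theorem memLp_couplingFun (c : Cutoff) {Λ : ℝ} (hΛ : 0 < Λ) (p : Polarization) {w : R3 → ℝ}
    (hw : Measurable w) {b : ℝ} (hb : ∀ k, |w k| ≤ b) (j : Fin 3) :
    MemLp (couplingFun c Λ p w j) 2 (volume : Measure R3) := by
  have hm : Measurable (couplingFun c Λ p w j) := by
    have h1 := measurable_couplingFactor c Λ
    have h2 := p.measurable
    unfold couplingFun
    refine (WithLp.measurable_toLp 2 _).comp (measurable_pi_lambda _ fun γ => ?_)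
    have h3 : Measurable fun k => p.e γ k j := by
      have := h2 γ
      fun_prop
    fun_prop
  refine (memLp_couplingFactor c hΛ).of_le_mul (c := √2 * b) hm.aestronglyMeasurable ?_
  filter_upwards [p.orthonormal] with k hk
  have h0 : ∀ γ, |p.e γ k j| ≤ 1 := by
    intro γ
    have hn : ‖p.e γ k‖ = 1 := by
      fin_cases γ
      · simpa using hk.1 1
      · simpa using hk.1 2
    calc |p.e γ k j| = ‖p.e γ k j‖ := rfl
      _ ≤ ‖p.e γ k‖ := PiLp.norm_apply_le _ _
      _ = 1 := hn
  have hb0 : 0 ≤ b := (abs_nonneg _).trans (hb k)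
  have hs : ∀ γ, ‖((couplingFactor c Λ k * w k * p.e γ k j : ℝ) : ℂ)‖ ^ 2 ≤
      (|couplingFactor c Λ k| * b) ^ 2 := by
    intro γ
    rw [Complex.norm_real, Real.norm_eq_abs, abs_mul, abs_mul]
    refine pow_le_pow_left₀ (by positivity) ?_ 2
    calc |couplingFactor c Λ k| * |w k| * |p.e γ k j| ≤ |couplingFactor c Λ k| * b * 1 := by
          gcongr
          · exact hb k
          · exact h0 γ
      _ = _ := mul_one _
  rw [EuclideanSpace.norm_eq]
  refine Real.sqrt_le_iff.2 ⟨by positivity, ?_⟩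
  have h3 : (√2 : ℝ) ^ 2 = 2 := Real.sq_sqrt (by norm_num)
  calc ∑ γ, ‖(couplingFun c Λ p w j k) γ‖ ^ 2
      ≤ ∑ _γ : Fin 2, (|couplingFactor c Λ k| * b) ^ 2 := Finset.sum_le_sum fun γ _ => hs γ
    _ = (√2 * b * ‖couplingFactor c Λ k‖) ^ 2 := by
        simp only [Finset.sum_const, Finset.card_univ, Fintype.card_fin, Real.norm_eq_abs,
          mul_pow, h3]
        ring

/-- The coupling function `λ_∞` of the free model: a vector with three spatial components, each of
them a one-photon state, so that `‖λ_∞‖² = ∑_{j,γ} ∫ |λ_{∞,γ}^{(j)}(k)|² dk`. -/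
def lambdaInf (c : Cutoff) {Λ : ℝ} (hΛ : 0 < Λ) (p : Polarization) :
    PiLp 2 (fun _ : Fin 3 => PhotonSpace fullMeasure) :=
  WithLp.toLp 2 fun j =>
    (memLp_couplingFun c hΛ p (w := fun _ => 1) (by fun_prop) (b := 1) (by simp) j).toLp _

/-- The profile of the `j`-th spatial component of `λ_y`:
`2 cos (k₁ y)` in the first direction, `-2 sin (k₁ y)` in the other two. -/
def wallProfile (y : ℝ) (j : Fin 3) (k : R3) : ℝ :=
  2 * if j = 0 then Real.cos (k 0 * y) else -Real.sin (k 0 * y)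

theorem measurable_wallProfile (y : ℝ) (j : Fin 3) : Measurable (wallProfile y j) := by
  unfold wallProfile
  split_ifs <;> fun_prop

theorem abs_wallProfile_le (y : ℝ) (j : Fin 3) (k : R3) : |wallProfile y j k| ≤ 2 := by
  unfold wallProfile
  rw [abs_mul, abs_two]
  split_ifs
  · linarith [Real.abs_cos_le_one (k 0 * y)]
  · rw [abs_neg]
    linarith [Real.abs_sin_le_one (k 0 * y)]

/-- The coupling function `λ_y` in presence of the wall at distance `y`, on the momenta `k₁ > 0`. -/
def lambdaWall (c : Cutoff) {Λ : ℝ} (hΛ : 0 < Λ) (p : Polarization) (y : ℝ) :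
    PiLp 2 (fun _ : Fin 3 => PhotonSpace halfMeasure) :=
  WithLp.toLp 2 fun j =>
    ((memLp_couplingFun c hΛ p (measurable_wallProfile y j) (abs_wallProfile_le y j) j).mono_measure
      Measure.restrict_le_self).toLp _

/-! ## One electron and one photon -/

/-- The state space `L²(ℝ³; dx) ⊗ L²(μ; ℂ²)` of the electron and one photon, realized as the square
integrable functions of the photon momentum with values in pairs of electron states. -/
abbrev PairSpace (μ : Measure R3) : Type := Lp (PiLp 2 (fun _ : Fin 2 => ElectronSpace)) 2 μ

/-- The map `v ↦ (v_γ f)_γ` for an electron state `f`. -/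
def tensorFiber (f : ElectronSpace) :
    EuclideanSpace ℂ (Fin 2) →L[ℂ] PiLp 2 (fun _ : Fin 2 => ElectronSpace) :=
  (PiLp.continuousLinearEquiv 2 ℂ (fun _ : Fin 2 => ElectronSpace)).symm.toContinuousLinearMap.comp
    (ContinuousLinearMap.pi fun γ =>
      (ContinuousLinearMap.toSpanSingleton ℂ f).comp (EuclideanSpace.proj γ))

/-- The elementary tensor `f ⊗ g`, with `(f ⊗ g)(k)_γ = g_γ(k) f`. -/
def tensor {μ : Measure R3} (f : ElectronSpace) (g : PhotonSpace μ) : PairSpace μ :=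
  (tensorFiber f).compLp g

/-- The graph of `h_α - e_α + H_f`: the field energy `H_f` of a photon of momentum `k` is `|k|`, and
`h_α` acts on the electron. -/
def pairGraph (α : ℝ) (μ : Measure R3) : Submodule ℂ (PairSpace μ × PairSpace μ) where
  carrier := {q | ∀ᵐ k ∂μ, ∀ γ : Fin 2, (q.1 k γ, q.2 k γ) ∈ (shift (excitation α) ‖k‖).graph}
  add_mem' := by
    rintro ⟨a, b⟩ ⟨c, d⟩ h1 h2
    filter_upwards [h1, h2, Lp.coeFn_add a c, Lp.coeFn_add b d] with k h1 h2 h3 h4 γ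
    have h5 := add_mem (h1 γ) (h2 γ)
    simp only [Prod.mk_add_mk] at h5 ⊢
    rw [h3, h4]
    exact h5
  zero_mem' := by
    filter_upwards [Lp.coeFn_zero (PiLp 2 (fun _ : Fin 2 => ElectronSpace)) 2 μ] with k h γ
    simp only [Prod.fst_zero, Prod.snd_zero]
    rw [h]
    exact zero_mem (shift (excitation α) ‖k‖).graph
  smul_mem' := by
    rintro r ⟨a, b⟩ h1
    filter_upwards [h1, Lp.coeFn_smul r a, Lp.coeFn_smul r b] with k h1 h2 h3 γ
    have h5 := Submodule.smul_mem _ r (h1 γ)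
    simp only [Prod.smul_mk] at h5 ⊢
    rw [h2, h3]
    exact h5

theorem pairGraph_functional (α : ℝ) (μ : Measure R3) (q : PairSpace μ × PairSpace μ)
    (hq : q ∈ pairGraph α μ) (h0 : q.1 = 0) : q.2 = 0 := by
  rw [Lp.eq_zero_iff_ae_eq_zero]
  have hq' : ∀ᵐ k ∂μ, ∀ γ : Fin 2,
      (q.1 k γ, q.2 k γ) ∈ (shift (excitation α) ‖k‖).graph := hq
  rw [h0] at hq'
  filter_upwards [hq', Lp.coeFn_zero (PiLp 2 (fun _ : Fin 2 => ElectronSpace)) 2 μ] with k h1 h2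
  ext1 γ
  have h3 := h1 γ
  rw [h2] at h3
  exact LinearPMap.graph_fst_eq_zero_snd _ h3 rfl

/-- The operator `h_α - e_α + H_f` on states of the electron and one photon; the domain consists of
the `Φ` with `Φ(k)_γ` in the domain of `h_α` for almost every `k` and
`k ↦ (h_α - e_α + |k|) Φ(k)` square integrable. -/
def pairOp (α : ℝ) (μ : Measure R3) : PairSpace μ →ₗ.[ℂ] PairSpace μ :=
  (pairGraph α μ).toLinearPMap

theorem pairOp_graph (α : ℝ) (μ : Measure R3) : (pairOp α μ).graph = pairGraph α μ :=
  (pairGraph α μ).toLinearPMap_graph_eq (pairGraph_functional α μ)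

/-- The vector `2 α^{1/2} P u_α ⊗ A⁺ Ω = 2 α^{1/2} ∑_j P_j u_α ⊗ λ^{(j)}`, where `A⁺ = a†(λ)`. -/
def source (α : ℝ) {μ : Measure R3} (lam : PiLp 2 (fun _ : Fin 3 => PhotonSpace μ)) :
    PairSpace μ :=
  ((2 * √α : ℝ) : ℂ) • ∑ j : Fin 3, tensor (momentumGround α j) (lam j)

/-- The vector `Φ_# = 2 α^{1/2} (h_α - e_α + H_f)⁻¹ P u_α ⊗ A⁺ Ω`. -/
def phiSharp (α : ℝ) {μ : Measure R3} (lam : PiLp 2 (fun _ : Fin 3 => PhotonSpace μ)) :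
    PairSpace μ :=
  invApply (pairOp α μ) (source α lam)

/-- `‖Φ‖_#² = ⟨Φ | h_α - e_α + H_f | Φ⟩`. -/
def sharpNormSq (α : ℝ) {μ : Measure R3} (Φ : PairSpace μ) : ℝ := quadForm (pairOp α μ) Φ

/-- The quantity `𝓔 = α (‖λ_y‖² - ‖λ_∞‖²) + ‖Φ_#^∞‖_#² - ‖Φ_#^y‖_#²`. -/
def normDifference (c : Cutoff) {Λ : ℝ} (hΛ : 0 < Λ) (p : Polarization) (α y : ℝ) : ℝ :=
  α * (‖lambdaWall c hΛ p y‖ ^ 2 - ‖lambdaInf c hΛ p‖ ^ 2)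
    + sharpNormSq α (phiSharp α (lambdaInf c hΛ p))
    - sharpNormSq α (phiSharp α (lambdaWall c hΛ p y))

/-- `(h_α - e_α + H_f)⁻¹` exists as an unbounded operator and is defined at the vector
`2 α^{1/2} P u_α ⊗ A⁺ Ω`, so that `Φ_#` is a well-defined element of the domain of
`h_α - e_α + H_f`. -/
def PhiWellDefined (α : ℝ) {μ : Measure R3} (lam : PiLp 2 (fun _ : Fin 3 => PhotonSpace μ)) :
    Prop :=
  Function.Injective (pairOp α μ) ∧ source α lam ∈ Set.range (pairOp α μ)

end CasimirPolder

end

noncomputable section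

namespace CasimirPolder

/-! ## Nonnegative self-adjoint operators and their resolvents -/

section Resolvent

variable {E : Type*} [NormedAddCommGroup E] [InnerProductSpace ℂ E]

/-! The two quantities inside the absolute value are not compared with each other. Each is
separately of order α³/L², and since log(α⁻¹) ≥ log 2 for α ≤ 1/2, the first error term already
absorbs both; the second one enters only as a nonnegative number.

Write T = h_α - e_α. Everything rests on T ≥ 0 being self-adjoint (`nonnegSelfAdj_excitation`) and
on the identity T (x_j u_α) = 2i P_j u_α (`dipole_mem_excitation`). The identity places P_j u_α in
the range of T, so (T + r)⁻¹ P_j u_α is bounded by ‖x_j u_α‖ uniformly in r > 0. Solving in each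
fibre of fixed photon momentum k with r = |k| then gives a square integrable vector, hence
`phiWellDefined`.

Leading term (`leading_term_bound`): replacing arctan(1/(αLT)) by π/2 in ℵ gives exactly αL, because
∑_j ‖x_j u_1‖² = 12, and then α²/L³ - ℵ α/L⁴ would vanish. The defect π/2 - arctan(1/(sT)) =
arctan(sT) lies between 0 and sT with s = αL, and ⟨x_j u_1 | T | x_j u_1⟩ is finite by the identity
for α = 1. This leaves a multiple of (α²/L³) αL = α³/L².

The difference 𝓔 (`exists_abs_normDifference_le`): summing over polarizations gives the projection
orthogonal to k. Reflections in the coordinate planes remove the mixed terms i ≠ j. In the diagonal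
ones the squared wall profile is 2(1 ± cos(2 y k₁)) on a half space: the constant part reproduces
the free model and cancels, and 𝓔 becomes α times a signed sum of integrals of cos(2 y k₁) against a
function of |k|, k₁ (`normDifference_eq`). The radial factor is 1 or q(r) = ⟨(T + r)⁻¹ P_j u_α, P_j
u_α⟩. Integrating over the sphere first, the problem becomes one-dimensional, with an oscillating
kernel whose antiderivative is O(1/y²) down to r = 0. One integration by parts suffices
(`abs_oscIntegral_le`): q is bounded by 2 independently of α, since ‖x_j u_α‖ is of order 1/α and
‖P_j u_α‖ of order α, and it is decreasing, so its total variation is controlled by the same bound.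
Thus |𝓔| ≤ C α/y² = C α³/L².

Self-adjointness is proved from the Fourier side for -Δ, with Schwartz functions as a core. The
inequality T ≥ 0 comes from completing a square with the logarithmic gradient of the ground state,
and Hardy's inequality makes the Coulomb potential a small perturbation of -Δ + μ for large μ. -/

theorem shift_apply (T : E →ₗ.[ℂ] E) (c : ℝ) (y : T.domain) :
    shift T c ⟨y, y.2⟩ = (c : ℂ) • (y : E) + T y := rfl

theorem mem_graph_shift {T : E →ₗ.[ℂ] E} {c : ℝ} {f g : E} :
    (f, g) ∈ (shift T c).graph ↔ (f, g - (c : ℂ) • f) ∈ T.graph := by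
  simp only [LinearPMap.mem_graph_iff]
  constructor
  · rintro ⟨⟨y, hy⟩, rfl, h2⟩
    refine ⟨⟨y, hy⟩, rfl, ?_⟩
    rw [← h2, shift_apply T c ⟨y, hy⟩, add_sub_cancel_left]
  · rintro ⟨⟨y, hy⟩, rfl, h2⟩
    refine ⟨⟨y, hy⟩, rfl, ?_⟩
    rw [shift_apply T c ⟨y, hy⟩, h2, add_sub_cancel]

/-- A symmetric operator with nonnegative quadratic form. -/
structure NonnegSymm (T : E →ₗ.[ℂ] E) : Prop where
  symm : ∀ {f f' g g' : E}, (f, f') ∈ T.graph → (g, g') ∈ T.graph →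
    inner ℂ f g' = inner ℂ f' g
  nonneg : ∀ {f f' : E}, (f, f') ∈ T.graph → 0 ≤ (inner ℂ f f').re

/-- A nonnegative self-adjoint operator, characterized by `range (T + r) = ⊤` for `r > 0`. -/
structure NonnegSelfAdj (T : E →ₗ.[ℂ] E) : Prop extends NonnegSymm T where
  surj : ∀ r : ℝ, 0 < r → ∀ v : E, ∃ f : E, (f, v) ∈ (shift T r).graph

theorem NonnegSymm.mul_sq_le {T : E →ₗ.[ℂ] E} (hT : NonnegSymm T) {r : ℝ} {f g : E}
    (h : (f, g) ∈ (shift T r).graph) : r * ‖f‖ ^ 2 ≤ (inner ℂ f g).re := by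
  have h1 := hT.nonneg (mem_graph_shift.1 h)
  rw [inner_sub_right, inner_smul_right, inner_self_eq_norm_sq_to_K] at h1
  have : ((r : ℂ) * ((‖f‖ : ℝ) : ℂ) ^ 2).re = r * ‖f‖ ^ 2 := by norm_cast
  simp only [Complex.sub_re, Complex.coe_algebraMap] at h1
  linarith

theorem NonnegSymm.mul_norm_le {T : E →ₗ.[ℂ] E} (hT : NonnegSymm T) {r : ℝ} {f g : E}
    (h : (f, g) ∈ (shift T r).graph) : r * ‖f‖ ≤ ‖g‖ := by
  have h1 := hT.mul_sq_le h
  have h2 : (inner ℂ f g).re ≤ ‖f‖ * ‖g‖ := (Complex.re_le_norm _).trans (norm_inner_le_norm _ _)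
  rcases (norm_nonneg f).eq_or_lt with h0 | h0
  · rw [← h0]; simp
  · refine le_of_mul_le_mul_left ?_ h0
    nlinarith

theorem NonnegSymm.eq_zero {T : E →ₗ.[ℂ] E} (hT : NonnegSymm T) {r : ℝ} (hr : 0 < r) {f : E}
    (h : (f, 0) ∈ (shift T r).graph) : f = 0 := by
  have h1 := hT.mul_norm_le h
  rw [norm_zero] at h1
  have := norm_nonneg f
  exact norm_eq_zero.1 (le_antisymm (by nlinarith) this)

theorem NonnegSymm.unique {T : E →ₗ.[ℂ] E} (hT : NonnegSymm T) {r : ℝ} (hr : 0 < r) {f f' g : E}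
    (h : (f, g) ∈ (shift T r).graph) (h' : (f', g) ∈ (shift T r).graph) : f = f' := by
  have h1 := sub_mem h h'
  rw [Prod.mk_sub_mk, sub_self] at h1
  exact sub_eq_zero.1 (hT.eq_zero hr h1)

/-- The lower bound r‖f‖ ≤ ‖(T + r) f‖ makes solutions unique, so any choice of solutions is
automatically linear and bounded by 1/r. -/
theorem NonnegSymm.exists_isBoundedInverse {T : E →ₗ.[ℂ] E} (hT : NonnegSymm T) {r : ℝ}
    (hr : 0 < r) (hs : ∀ v : E, ∃ f : E, (f, v) ∈ (shift T r).graph) :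
    ∃ B : E →L[ℂ] E, IsBoundedInverse (shift T r) B := by
  choose R hR using hs
  let R' : E →ₗ[ℂ] E :=
    { toFun := R
      map_add' := fun x y => hT.unique hr (hR _) (by simpa using add_mem (hR x) (hR y))
      map_smul' := fun c x => hT.unique hr (hR _)
        (by simpa using Submodule.smul_mem _ c (hR x)) }
  refine ⟨R'.mkContinuous r⁻¹ fun x => ?_, fun v w => ?_⟩
  · rw [inv_mul_eq_div, le_div_iff₀ hr, mul_comm]
    exact hT.mul_norm_le (hR x)
  · constructor
    · rintro rfl
      exact hR v
    · intro h
      exact hT.unique hr (hR v) h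

/-- The resolvent `(T + r)⁻¹`. -/
def resolv (T : E →ₗ.[ℂ] E) (r : ℝ) : E →L[ℂ] E := boundedInverse (shift T r)

theorem NonnegSymm.resolv_spec {T : E →ₗ.[ℂ] E} (hT : NonnegSymm T) {r : ℝ}
    (hr : 0 < r) (hs : ∀ v : E, ∃ f : E, (f, v) ∈ (shift T r).graph) :
    IsBoundedInverse (shift T r) (resolv T r) := by
  have h := hT.exists_isBoundedInverse hr hs
  rw [resolv, boundedInverse, dif_pos h]
  exact h.choose_spec

theorem NonnegSymm.norm_resolv_le {T : E →ₗ.[ℂ] E} (hT : NonnegSymm T) {r : ℝ}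
    (hr : 0 < r) (hs : ∀ v : E, ∃ f : E, (f, v) ∈ (shift T r).graph) :
    ‖resolv T r‖ ≤ r⁻¹ := by
  refine ContinuousLinearMap.opNorm_le_bound _ (by positivity) fun v => ?_
  rw [inv_mul_eq_div, le_div_iff₀ hr, mul_comm]
  exact hT.mul_norm_le ((hT.resolv_spec hr hs v _).1 rfl)

/-- An operator that has an approximate bounded right inverse `B` with an error `S` of norm less
than one is surjective. -/
theorem surjective_of_perturbation [CompleteSpace E] {T : E →ₗ.[ℂ] E} (B S : E →L[ℂ] E)
    (h : ∀ w, (B w, w + S w) ∈ T.graph) (hS : ‖S‖ < 1) (v : E) : ∃ f, (f, v) ∈ T.graph := by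
  have hu : IsUnit (1 - (-S)) := isUnit_one_sub_of_norm_lt_one (by rwa [norm_neg])
  obtain ⟨u, hu⟩ := hu
  refine ⟨B ((↑u⁻¹ : E →L[ℂ] E) v), ?_⟩
  have h1 : (1 + S) ((↑u⁻¹ : E →L[ℂ] E) v) = v := by
    have h2 : ((u : E →L[ℂ] E) * (↑u⁻¹ : E →L[ℂ] E)) v = v := by simp
    rw [hu, sub_neg_eq_add] at h2
    exact h2
  have h3 := h ((↑u⁻¹ : E →L[ℂ] E) v)
  simp only [add_apply, one_apply_eq_self] at h1
  rwa [h1] at h3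

/-- Surjectivity for large shifts spreads to all positive ones: (T + r)(T + μ)⁻¹ = 1 + (r - μ)(T +
μ)⁻¹, and for r ≤ μ the last term has norm at most (μ - r)/μ < 1. A perturbation argument therefore
only has to treat large shifts. -/
theorem NonnegSymm.nonnegSelfAdj [CompleteSpace E] {T : E →ₗ.[ℂ] E} (hT : NonnegSymm T) (μ₀ : ℝ)
    (hs : ∀ μ : ℝ, 0 < μ → μ₀ ≤ μ → ∀ v : E, ∃ f : E, (f, v) ∈ (shift T μ).graph) :
    NonnegSelfAdj T := by
  refine ⟨hT, fun r hr => ?_⟩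
  obtain ⟨μ, h1, h2⟩ : ∃ μ, r ≤ μ ∧ μ₀ ≤ μ := ⟨max r μ₀, le_max_left _ _, le_max_right _ _⟩
  have hμ : 0 < μ := hr.trans_le h1
  have hs' := hs μ hμ h2
  refine surjective_of_perturbation (resolv T μ) (((r - μ : ℝ) : ℂ) • resolv T μ) (fun w => ?_) ?_
  · have h3 := (hT.resolv_spec hμ hs' w _).1 rfl
    rw [mem_graph_shift] at h3 ⊢
    convert h3 using 2
    rw [smul_apply, Complex.ofReal_sub, sub_smul]
    abel
  · rw [norm_smul, Complex.norm_real, Real.norm_eq_abs, abs_of_nonpos (by linarith)]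
    have h3 := hT.norm_resolv_le hμ hs'
    calc -(r - μ) * ‖resolv T μ‖ ≤ (μ - r) * μ⁻¹ := by
          rw [neg_sub]; gcongr
      _ < 1 := by rw [← div_eq_mul_inv, div_lt_one hμ]; linarith

/-! ### Resolvent identities, and the resolvent as a function of the shift. -/

namespace NonnegSelfAdj

variable {T : E →ₗ.[ℂ] E} (hT : NonnegSelfAdj T) {r s : ℝ}
include hT

theorem resolv_eq_iff (hr : 0 < r) {v w : E} : resolv T r v = w ↔ (w, v) ∈ (shift T r).graph :=
  hT.toNonnegSymm.resolv_spec hr (hT.surj r hr) v w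

theorem resolv_mem (hr : 0 < r) (v : E) : (resolv T r v, v) ∈ (shift T r).graph :=
  (hT.resolv_eq_iff hr).1 rfl

theorem resolv_mem_graph (hr : 0 < r) (v : E) :
    (resolv T r v, v - (r : ℂ) • resolv T r v) ∈ T.graph :=
  mem_graph_shift.1 (hT.resolv_mem hr v)

theorem norm_resolv_le (hr : 0 < r) : ‖resolv T r‖ ≤ r⁻¹ :=
  hT.toNonnegSymm.norm_resolv_le hr (hT.surj r hr)

theorem mul_norm_resolv_apply_le (hr : 0 < r) (v : E) : r * ‖resolv T r v‖ ≤ ‖v‖ :=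
  hT.toNonnegSymm.mul_norm_le (hT.resolv_mem hr v)

theorem resolv_apply_image (hr : 0 < r) {f g : E} (h : (f, g) ∈ T.graph) :
    resolv T r g = f - (r : ℂ) • resolv T r f := by
  have h1 : resolv T r (g + (r : ℂ) • f) = f := by
    rw [hT.resolv_eq_iff hr, mem_graph_shift]
    simpa using h
  rw [map_add, map_smul] at h1
  rw [← h1, h1]
  exact eq_sub_of_add_eq h1

/-- On the range of T the resolvent does not blow up as r → 0, since (T + r)⁻¹ T f = f - r (T + r)⁻¹
f. This uniformity in r is what makes small photon momenta harmless. -/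
theorem norm_resolv_image_le (hr : 0 < r) {f g : E} (h : (f, g) ∈ T.graph) :
    ‖resolv T r g‖ ≤ 2 * ‖f‖ := by
  rw [hT.resolv_apply_image hr h]
  refine (norm_sub_le _ _).trans ?_
  rw [norm_smul, Complex.norm_real, Real.norm_eq_abs, abs_of_pos hr]
  linarith [hT.mul_norm_resolv_apply_le hr f]

theorem inner_resolv (hr : 0 < r) (v w : E) :
    inner ℂ (resolv T r v) w = inner ℂ v (resolv T r w) := by
  have h := hT.symm (hT.resolv_mem_graph hr v) (hT.resolv_mem_graph hr w)
  rw [inner_sub_right, inner_sub_left, inner_smul_left, inner_smul_right, Complex.conj_ofReal]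
    at h
  exact sub_left_injective h

theorem inner_resolv_nonneg (hr : 0 < r) (v : E) : 0 ≤ (inner ℂ v (resolv T r v)).re := by
  have h := hT.toNonnegSymm.mul_sq_le (hT.resolv_mem hr v)
  rw [hT.inner_resolv hr] at h
  exact le_trans (by positivity) h

theorem resolv_sub (hr : 0 < r) (hs : 0 < s) (v : E) :
    resolv T r v - resolv T s v = ((s - r : ℝ) : ℂ) • resolv T r (resolv T s v) := by
  rw [← map_smul, sub_eq_iff_eq_add,
    hT.resolv_eq_iff hr, mem_graph_shift]
  have h1 := hT.resolv_mem_graph hs v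
  have h2 := hT.resolv_mem_graph hr (((s - r : ℝ) : ℂ) • resolv T s v)
  have h3 := add_mem h2 h1
  rw [Prod.mk_add_mk] at h3
  convert h3 using 2
  simp only [Complex.ofReal_sub, sub_smul, smul_add]
  abel

theorem norm_resolv_sub_le (hr : 0 < r) (hs : 0 < s) (v : E) :
    ‖resolv T r v - resolv T s v‖ ≤ |s - r| * (r⁻¹ * ‖resolv T s v‖) := by
  rw [hT.resolv_sub hr hs, norm_smul, Complex.norm_real, Real.norm_eq_abs]
  gcongr
  exact (ContinuousLinearMap.le_opNorm _ _).trans (by gcongr; exact hT.norm_resolv_le hr)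

theorem continuousAt_resolv (hs : 0 < s) (v : E) :
    ContinuousAt (fun r => resolv T r v) s := by
  rw [ContinuousAt, tendsto_iff_norm_sub_tendsto_zero]
  have h1 : Tendsto (fun r : ℝ => |s - r| * (r⁻¹ * ‖resolv T s v‖)) (𝓝 s) (𝓝 0) := by
    have : ContinuousAt (fun r : ℝ => |s - r| * (r⁻¹ * ‖resolv T s v‖)) s := by
      have := hs.ne'
      fun_prop (disch := assumption)
    simpa using this.tendsto
  refine squeeze_zero' (Eventually.of_forall fun _ => norm_nonneg _) ?_ h1
  filter_upwards [lt_mem_nhds hs] with r hr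
  exact hT.norm_resolv_sub_le hr hs v

theorem continuousOn_resolv (v : E) : ContinuousOn (fun r => resolv T r v) (Set.Ioi 0) :=
  fun _ hs => (hT.continuousAt_resolv hs v).continuousWithinAt

/-- By the resolvent identity the difference quotient is -⟨(T + s)⁻¹ v, (T + r)⁻¹ v⟩, and the
resolvent is strongly continuous. What matters later is the sign: diagonal matrix elements decrease
in the photon energy. -/
theorem hasDerivAt_inner_resolv (hs : 0 < s) (v : E) :
    HasDerivAt (fun r => (inner ℂ (resolv T r v) v).re) (-‖resolv T s v‖ ^ 2) s := by
  rw [hasDerivAt_iff_tendsto_slope]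
  have h1 : Tendsto (fun r => -(inner ℂ (resolv T s v) (resolv T r v)).re) (𝓝[≠] s)
      (𝓝 (-‖resolv T s v‖ ^ 2)) := by
    have h2 : ContinuousAt (fun r => -(inner ℂ (resolv T s v) (resolv T r v)).re) s := by
      have := hT.continuousAt_resolv hs v
      have h3 : ContinuousAt (fun r => inner ℂ (resolv T s v) (resolv T r v)) s :=
        (innerSL ℂ (resolv T s v)).continuous.continuousAt.comp this
      exact (Complex.continuous_re.continuousAt.comp h3).neg
    have h4 := h2.tendsto.mono_left (nhdsWithin_le_nhds (s := {s}ᶜ))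
    simp only [inner_self_eq_norm_sq_to_K] at h4
    convert h4 using 2
    norm_cast
  refine h1.congr' ?_
  have h5 : ∀ᶠ r in 𝓝[≠] s, 0 < r := nhdsWithin_le_nhds (lt_mem_nhds hs)
  filter_upwards [h5, self_mem_nhdsWithin] with r hr hne
  rw [slope_def_field, ← Complex.sub_re, ← inner_sub_left, hT.resolv_sub hr hs, inner_smul_left,
    Complex.conj_ofReal, Complex.re_ofReal_mul, hT.inner_resolv hr]
  have : r - s ≠ 0 := sub_ne_zero.2 hne
  field_simp
  ring

end NonnegSelfAdj

end Resolvent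

/-! ## The kinetic energy on Schwartz functions -/

section Schwartz

open scoped LineDeriv

/-- The coordinate vectors of `ℝ³`. -/
abbrev axis (j : Fin 3) : R3 := EuclideanSpace.single j (1 : ℝ)

theorem integrable_inner_of_memLp {X 𝕜 H : Type*} [RCLike 𝕜] [NormedAddCommGroup H]
    [InnerProductSpace 𝕜 H] [MeasurableSpace X] {μ : Measure X} {f g : X → H}
    (hf : MemLp f 2 μ) (hg : MemLp g 2 μ) : Integrable (fun x => inner 𝕜 (f x) (g x)) μ := by
  refine (L2.integrable_inner (𝕜 := 𝕜) (hf.toLp f) (hg.toLp g)).congr ?_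
  filter_upwards [hf.coeFn_toLp, hg.coeFn_toLp] with x h1 h2
  rw [h1, h2]

theorem inner_toLp_toLp {X 𝕜 H : Type*} [RCLike 𝕜] [NormedAddCommGroup H]
    [InnerProductSpace 𝕜 H] [MeasurableSpace X] {μ : Measure X} {f g : X → H}
    (hf : MemLp f 2 μ) (hg : MemLp g 2 μ) :
    inner 𝕜 (hf.toLp f) (hg.toLp g) = ∫ x, inner 𝕜 (f x) (g x) ∂μ := by
  rw [L2.inner_def]
  refine integral_congr_ae ?_
  filter_upwards [hf.coeFn_toLp, hg.coeFn_toLp] with x h1 h2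
  rw [h1, h2]

/-- The `L²` class of a Schwartz function. -/
def schwartzL2 (φ : 𝓢(R3, ℂ)) : ElectronSpace := φ.toLp 2

theorem inner_toLp_schwartz (φ ψ : 𝓢(R3, ℂ)) :
    inner ℂ (schwartzL2 φ) (schwartzL2 ψ) = ∫ x, inner ℂ (φ x) (ψ x) :=
  inner_toLp_toLp (SchwartzMap.memLp φ 2) (SchwartzMap.memLp ψ 2)

theorem schwartz_laplacian_eq_sum (φ : 𝓢(R3, ℂ)) : Δ φ = ∑ j, ∂_{axis j} (∂_{axis j} φ) := by
  rw [SchwartzMap.laplacian_eq_sum (EuclideanSpace.basisFun (Fin 3) ℝ)]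
  simp

theorem inner_laplacian_schwartz (φ ψ : 𝓢(R3, ℂ)) :
    inner ℂ (schwartzL2 φ) (schwartzL2 (-Δ ψ)) =
      inner ℂ (schwartzL2 (-Δ φ)) (schwartzL2 ψ) := by
  rw [inner_toLp_schwartz, inner_toLp_schwartz]
  have h := SchwartzMap.integral_bilinear_laplacian_right_eq_left (μ := volume) φ ψ
    ((ContinuousLinearMap.mul ℝ ℂ).comp (Complex.conjCLE : ℂ →L[ℝ] ℂ))
  simp only [ContinuousLinearMap.comp_apply, ContinuousLinearMap.mul_apply',
    ContinuousLinearEquiv.coe_coe, Complex.conjCLE_apply] at h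
  simp only [neg_apply, RCLike.inner_apply', mul_neg, map_neg, neg_mul, integral_neg]
  rw [h]

theorem re_inner_neg_laplacian_schwartz (φ : 𝓢(R3, ℂ)) :
    (inner ℂ (schwartzL2 φ) (schwartzL2 (-Δ φ))).re =
      ∑ j, ∫ x, ‖∂_{axis j} φ x‖ ^ 2 := by
  rw [inner_toLp_schwartz, schwartz_laplacian_eq_sum]
  have h0 : ∀ x, inner ℂ (φ x) ((-∑ j, ∂_{axis j} (∂_{axis j} φ)) x) =
      ∑ j, -inner ℂ (φ x) (∂_{axis j} (∂_{axis j} φ) x) := by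
    intro x
    simp [Finset.sum_mul]
  simp_rw [h0]
  have hi : ∀ ψ : 𝓢(R3, ℂ), Integrable fun x => inner ℂ (φ x) (ψ x) := fun ψ =>
    integrable_inner_of_memLp (SchwartzMap.memLp φ 2) (SchwartzMap.memLp ψ 2)
  rw [integral_finsetSum _ fun j _ => by exact (hi _).neg, Complex.re_sum]
  refine Finset.sum_congr rfl fun j _ => ?_
  have h := SchwartzMap.integral_bilinear_lineDerivOp_right_eq_neg_left (μ := volume) φ
    (∂_{axis j} φ) ((ContinuousLinearMap.mul ℝ ℂ).comp (Complex.conjCLE : ℂ →L[ℝ] ℂ)) (axis j)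
  simp only [ContinuousLinearMap.comp_apply, ContinuousLinearMap.mul_apply',
    ContinuousLinearEquiv.coe_coe, Complex.conjCLE_apply] at h
  simp only [RCLike.inner_apply', integral_neg]
  rw [h, neg_neg]
  have h2 : ∀ x, (starRingEnd ℂ) (∂_{axis j} φ x) * ∂_{axis j} φ x =
      ((‖∂_{axis j} φ x‖ ^ 2 : ℝ) : ℂ) := by
    intro x
    rw [Complex.conj_mul']
    norm_cast
  simp_rw [h2]
  rw [integral_complex_ofReal, Complex.ofReal_re]

/-- Expand 0 ≤ ∫ |∂_v φ + F φ|² and integrate the cross term ∫ F ∂_v |φ|² by parts. The bounds on F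
and its derivative only serve integrability. -/
theorem integral_vectorField_le (φ : 𝓢(R3, ℂ)) {F : R3 → ℝ} (hF : ContDiff ℝ 1 F) {v : R3} {C : ℝ}
    (hC : ∀ x, |F x| ≤ C) (hC' : ∀ x, |fderiv ℝ F x v| ≤ C) :
    ∫ x, (fderiv ℝ F x v - F x ^ 2) * ‖φ x‖ ^ 2 ≤ ∫ x, ‖∂_{v} φ x‖ ^ 2 := by
  have hcF := hF.continuous
  have hcF' : Continuous fun x => fderiv ℝ F x v := (hF.continuous_fderiv one_ne_zero).clm_apply
    continuous_const
  have hn : ∀ ψ : 𝓢(R3, ℂ), Integrable fun x => ‖ψ x‖ ^ 2 := fun ψ =>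
    (SchwartzMap.memLp ψ 2).integrable_norm_pow two_ne_zero
  have hd : ∀ x, HasFDerivAt (fun x => ‖φ x‖ ^ 2)
      (2 • (innerSL ℝ (φ x)).comp (fderiv ℝ φ x)) x :=
    fun x => (SchwartzMap.hasFDerivAt φ x).norm_sq
  have hG : ∀ x, fderiv ℝ (fun x => ‖φ x‖ ^ 2) x v = 2 * inner ℝ (φ x) (∂_{v} φ x) := by
    intro x
    rw [(hd x).fderiv, SchwartzMap.lineDerivOp_apply_eq_fderiv, two_smul, two_mul]
    rfl
  have hcI : Integrable fun x => inner ℝ (φ x) (∂_{v} φ x) :=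
    integrable_inner_of_memLp (SchwartzMap.memLp φ 2) (SchwartzMap.memLp (∂_{v} φ) 2)
  have i1 : Integrable fun x => fderiv ℝ F x v * ‖φ x‖ ^ 2 :=
    (hn φ).bdd_mul hcF'.aestronglyMeasurable (Eventually.of_forall hC')
  have i2 : Integrable fun x => F x * (2 * inner ℝ (φ x) (∂_{v} φ x)) :=
    (hcI.const_mul 2).bdd_mul hcF.aestronglyMeasurable (Eventually.of_forall hC)
  have i3 : Integrable fun x => F x * ‖φ x‖ ^ 2 :=
    (hn φ).bdd_mul hcF.aestronglyMeasurable (Eventually.of_forall hC)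
  have i4 : Integrable fun x => F x ^ 2 * ‖φ x‖ ^ 2 := by
    refine (i3.bdd_mul hcF.aestronglyMeasurable (Eventually.of_forall hC)).congr ?_
    exact Eventually.of_forall fun x => by simp only; ring
  have key := integral_mul_fderiv_eq_neg_fderiv_mul_of_integrable (μ := volume) (v := v)
    i1 (by simpa only [hG] using i2) i3 (fun x _ => hF.differentiable one_ne_zero x)
    (fun x _ => (hd x).differentiableAt)
  simp only [hG] at key
  have hp : 0 ≤ ∫ x, ‖∂_{v} φ x + F x • φ x‖ ^ 2 := integral_nonneg fun x => by positivity
  have he : ∀ x, ‖∂_{v} φ x + F x • φ x‖ ^ 2 =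
      ‖∂_{v} φ x‖ ^ 2 + F x * (2 * inner ℝ (φ x) (∂_{v} φ x)) + F x ^ 2 * ‖φ x‖ ^ 2 := by
    intro x
    rw [norm_add_sq_real, inner_smul_right, real_inner_comm, norm_smul, mul_pow, Real.norm_eq_abs,
      sq_abs]
    ring
  simp_rw [he] at hp
  rw [integral_add (by exact (hn _).add i2) i4, integral_add (hn _) i2, key] at hp
  simp_rw [sub_mul]
  rw [integral_sub i1 i4]
  linarith

theorem norm_schwartzL2_sq (φ : 𝓢(R3, ℂ)) : ‖schwartzL2 φ‖ ^ 2 = ∫ x, ‖φ x‖ ^ 2 := by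
  have h := inner_toLp_schwartz φ φ
  rw [inner_self_eq_norm_sq_to_K] at h
  simp only [inner_self_eq_norm_sq_to_K, Complex.coe_algebraMap] at h
  have h2 : ∀ x, ((‖φ x‖ : ℝ) : ℂ) ^ 2 = ((‖φ x‖ ^ 2 : ℝ) : ℂ) := fun x => by norm_cast
  simp_rw [h2] at h
  rw [integral_complex_ofReal] at h
  exact_mod_cast h

/-- An inequality `W ≤ div F - |F|² + c` for a bounded vector field `F` implies the form inequality
`W ≤ -Δ + c`. -/
theorem integral_le_of_vectorField (φ : 𝓢(R3, ℂ)) {F : Fin 3 → R3 → ℝ}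
    (hF : ∀ j, ContDiff ℝ 1 (F j)) {C : ℝ} (hC : ∀ j x, |F j x| ≤ C)
    (hC' : ∀ j x, |fderiv ℝ (F j) x (axis j)| ≤ C) {W : R3 → ℝ} (hW : ∀ x, 0 ≤ W x) {c : ℝ}
    (hWF : ∀ x, W x ≤ (∑ j, (fderiv ℝ (F j) x (axis j) - F j x ^ 2)) + c) :
    ∫ x, W x * ‖φ x‖ ^ 2 ≤
      (inner ℂ (schwartzL2 φ) (schwartzL2 (-Δ φ))).re + c * ‖schwartzL2 φ‖ ^ 2 := by
  have hn : Integrable fun x => ‖φ x‖ ^ 2 :=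
    (SchwartzMap.memLp φ 2).integrable_norm_pow two_ne_zero
  have hi : ∀ j, Integrable fun x => (fderiv ℝ (F j) x (axis j) - F j x ^ 2) * ‖φ x‖ ^ 2 := by
    intro j
    have h1 : Continuous fun x => fderiv ℝ (F j) x (axis j) :=
      ((hF j).continuous_fderiv one_ne_zero).clm_apply continuous_const
    have h2 := (hF j).continuous
    refine hn.bdd_mul (c := C + C ^ 2) (by fun_prop) (Eventually.of_forall fun x => ?_)
    refine (norm_sub_le _ _).trans (add_le_add (hC' j x) ?_)
    rw [norm_pow]
    exact pow_le_pow_left₀ (norm_nonneg _) (hC j x) 2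
  rw [re_inner_neg_laplacian_schwartz, norm_schwartzL2_sq]
  calc ∫ x, W x * ‖φ x‖ ^ 2
      ≤ ∫ x, ((∑ j, (fderiv ℝ (F j) x (axis j) - F j x ^ 2) * ‖φ x‖ ^ 2) + c * ‖φ x‖ ^ 2) := by
        refine integral_mono_of_nonneg (Eventually.of_forall fun x => ?_)
          ((integrable_finsetSum _ fun j _ => hi j).add (hn.const_mul c))
          (Eventually.of_forall fun x => ?_)
        · exact mul_nonneg (hW x) (by positivity)
        · simp only
          rw [← Finset.sum_mul, ← add_mul]
          gcongr
          exact hWF x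
    _ = (∑ j, ∫ x, (fderiv ℝ (F j) x (axis j) - F j x ^ 2) * ‖φ x‖ ^ 2) +
          c * ∫ x, ‖φ x‖ ^ 2 := by
        rw [integral_add (integrable_finsetSum _ fun j _ => hi j) (hn.const_mul c),
          integral_finsetSum _ fun j _ => hi j, integral_const_mul]
    _ ≤ _ := by
        refine add_le_add (Finset.sum_le_sum fun j _ => ?_) le_rfl
        exact integral_vectorField_le φ (hF j) (hC j) (hC' j)

end Schwartz

/-! ## The kinetic energy is a nonnegative self-adjoint operator -/

section Kinetic

open TemperedDistribution

theorem toTempered_add (f g : ElectronSpace) :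
    ((f + g : ElectronSpace) : 𝓢'(R3, ℂ)) = f + g :=
  map_add (Lp.toTemperedDistributionCLM ℂ (volume : Measure R3) 2) f g

theorem toTempered_smul (c : ℂ) (f : ElectronSpace) :
    ((c • f : ElectronSpace) : 𝓢'(R3, ℂ)) = c • (f : 𝓢'(R3, ℂ)) :=
  map_smul (Lp.toTemperedDistributionCLM ℂ (volume : Measure R3) 2) c f

theorem toTempered_sub (f g : ElectronSpace) :
    ((f - g : ElectronSpace) : 𝓢'(R3, ℂ)) = f - g :=
  map_sub (Lp.toTemperedDistributionCLM ℂ (volume : Measure R3) 2) f g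

theorem toTempered_eq_zero {f : ElectronSpace} (h : (f : 𝓢'(R3, ℂ)) = 0) : f = 0 := by
  have hker := Lp.ker_toTemperedDistributionCLM_eq_bot (F := ℂ) (μ := (volume : Measure R3))
    (p := 2)
  rw [LinearMap.ker_eq_bot'] at hker
  exact hker _ h

theorem toTempered_schwartzL2 (φ : 𝓢(R3, ℂ)) : ((schwartzL2 φ : ElectronSpace) : 𝓢'(R3, ℂ)) =
    (φ : 𝓢'(R3, ℂ)) :=
  Lp.toTemperedDistribution_toLp_eq φ

/-- The multiplier `c ‖x‖² + 1`. -/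
theorem fourierMultiplier_one_add (c : ℝ) (u : 𝓢'(R3, ℂ)) :
    fourierMultiplierCLM ℂ (fun x : R3 => ((1 + c * ‖x‖ ^ 2 : ℝ) : ℂ)) u =
      u - ((c / (2 * Real.pi) ^ 2 : ℝ) : ℂ) • Δ u := by
  have h1 : (fun x : R3 => ((1 + c * ‖x‖ ^ 2 : ℝ) : ℂ)) =
      fun x => ∑ i ∈ (Finset.univ : Finset (Fin 2)),
        (![fun _ => (1 : ℂ), (c : ℂ) • fun x : R3 => ((‖x‖ ^ 2 : ℝ) : ℂ)] i) x := by
    ext x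
    simp
  have h2 : (fun x : R3 => ((‖x‖ ^ 2 : ℝ) : ℂ)).HasTemperateGrowth := by fun_prop
  rw [h1, fourierMultiplierCLM_sum]
  · rw [Fin.sum_univ_two, laplacian_eq_fourierMultiplierCLM]
    simp only [Matrix.cons_val_zero, Matrix.cons_val_one]
    rw [fourierMultiplierCLM_smul h2, fourierMultiplierCLM_const, add_apply, one_smul,
      smul_apply, ContinuousLinearMap.id_apply, neg_smul, smul_neg, sub_neg_eq_add,
      ← Complex.coe_smul, smul_smul]
    congr 2
    have := Real.pi_ne_zero
    push_cast
    field_simp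
  · intro i _
    fin_cases i
    · exact Function.HasTemperateGrowth.const _
    · exact (Function.HasTemperateGrowth.const (c : ℂ)).mul h2

/-- Sobolev regularity is automatic once Δf is in L²: in this Fourier convention the Bessel
potential of order 2 has symbol 1 + |ξ|², which is 1 - Δ/(2π)². -/
theorem mem_kineticGraph_iff {f g : ElectronSpace} :
    (f, g) ∈ kineticGraph ↔ (g : 𝓢'(R3, ℂ)) = -Δ (f : 𝓢'(R3, ℂ)) := by
  refine ⟨fun h => h.2, fun h => ⟨⟨f + ((1 / (2 * Real.pi) ^ 2 : ℝ) : ℂ) • g, ?_⟩, h⟩⟩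
  rw [toTempered_add, toTempered_smul, h, smul_neg, ← sub_eq_add_neg,
    ← fourierMultiplier_one_add, besselPotential]
  congr
  ext x
  simp

theorem schwartz_mem_kineticGraph (φ : 𝓢(R3, ℂ)) :
    (schwartzL2 φ, schwartzL2 (-Δ φ)) ∈ kineticGraph := by
  rw [mem_kineticGraph_iff, toTempered_schwartzL2, toTempered_schwartzL2, map_neg,
    laplacian_toTemperedDistributionCLM_eq]

theorem isClosed_kineticGraph : IsClosed (kineticGraph : Set (ElectronSpace × ElectronSpace)) := by
  have h : (kineticGraph : Set (ElectronSpace × ElectronSpace)) =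
      {p | Lp.toTemperedDistributionCLM ℂ (volume : Measure R3) 2 p.2 =
        -(LineDeriv.laplacianCLM ℂ R3 𝓢'(R3, ℂ)
          (Lp.toTemperedDistributionCLM ℂ (volume : Measure R3) 2 p.1))} := by
    ext ⟨f, g⟩
    rw [SetLike.mem_coe, mem_kineticGraph_iff, Set.mem_ofPred_eq, laplacianCLM_apply,
      Lp.toTemperedDistributionCLM_apply, Lp.toTemperedDistributionCLM_apply]
  rw [h]
  refine isClosed_eq ?_ ?_
  · exact (ContinuousLinearMap.continuous _).comp continuous_snd
  · exact ((ContinuousLinearMap.continuous _).comp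
      ((ContinuousLinearMap.continuous _).comp continuous_fst)).neg

theorem hasTemperateGrowth_one_add_inv {c : ℝ} (hc : 0 ≤ c) :
    (fun x : R3 => (((1 + c * ‖x‖ ^ 2)⁻¹ : ℝ) : ℂ)).HasTemperateGrowth := by
  have h1 : (fun x : R3 => (1 + ‖x‖ ^ 2) ^ (-1 : ℝ)).HasTemperateGrowth := by fun_prop
  have h2 := h1.comp (f := (√c • ContinuousLinearMap.id ℝ R3 : R3 →L[ℝ] R3)) (by fun_prop)
  have h0 : Complex.ofReal.HasTemperateGrowth := by fun_prop
  have h3 := h0.comp h2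
  convert h3 using 1
  ext x
  simp only [Function.comp_apply, smul_apply, ContinuousLinearMap.id_apply, norm_smul, mul_pow,
    Real.norm_eq_abs, sq_abs, Real.sq_sqrt hc, Real.rpow_neg_one]

/-- The symbol 1 + c|ξ|² has no zeros and its reciprocal is again of temperate growth, so the
multiplier can be inverted on tempered distributions. Composition in the other order, on Schwartz
functions, gives `schwartz_solve`. -/
theorem eq_zero_of_sub_smul_laplacian {c : ℝ} (hc : 0 ≤ c) {u : 𝓢'(R3, ℂ)}
    (h : u - ((c / (2 * Real.pi) ^ 2 : ℝ) : ℂ) • Δ u = 0) : u = 0 := by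
  rw [← fourierMultiplier_one_add] at h
  have h1 := congrArg (fourierMultiplierCLM ℂ (fun x : R3 => (((1 + c * ‖x‖ ^ 2)⁻¹ : ℝ) : ℂ))) h
  rw [fourierMultiplierCLM_fourierMultiplierCLM_apply (by fun_prop)
    (hasTemperateGrowth_one_add_inv hc), map_zero] at h1
  have h2 : ((fun x : R3 => ((1 + c * ‖x‖ ^ 2 : ℝ) : ℂ)) *
      fun x : R3 => (((1 + c * ‖x‖ ^ 2)⁻¹ : ℝ) : ℂ)) = fun _ => 1 := by
    ext x
    have : (1 + c * ‖x‖ ^ 2) ≠ 0 := by positivity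
    simp only [Pi.mul_apply]
    norm_cast
    exact mul_inv_cancel₀ this
  rw [h2, fourierMultiplierCLM_const] at h1
  simpa using h1

theorem schwartz_solve {c : ℝ} (hc : 0 ≤ c) (h : 𝓢(R3, ℂ)) :
    ∃ φ : 𝓢(R3, ℂ), φ - ((c / (2 * Real.pi) ^ 2 : ℝ) : ℂ) • Δ φ = h := by
  let m : R3 → ℂ := fun x => (((1 + c * ‖x‖ ^ 2)⁻¹ : ℝ) : ℂ)
  have hm : m.HasTemperateGrowth := hasTemperateGrowth_one_add_inv hc
  refine ⟨SchwartzMap.fourierMultiplierCLM ℂ m h, ?_⟩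
  apply SchwartzMap.injective_toLp (F := ℂ) 2 (volume : Measure R3)
  change schwartzL2 _ = schwartzL2 _
  refine sub_eq_zero.1 (toTempered_eq_zero ?_)
  rw [toTempered_sub, sub_eq_zero, toTempered_schwartzL2, toTempered_schwartzL2, map_sub, map_smul,
    ← laplacian_toTemperedDistributionCLM_eq, ← fourierMultiplierCLM_toTemperedDistributionCLM_eq hm,
    ← fourierMultiplier_one_add, fourierMultiplierCLM_fourierMultiplierCLM_apply hm (by fun_prop)]
  have h2 : (m * fun x : R3 => ((1 + c * ‖x‖ ^ 2 : ℝ) : ℂ)) = fun _ => 1 := by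
    ext x
    have : (1 + c * ‖x‖ ^ 2) ≠ 0 := by positivity
    simp only [Pi.mul_apply, m]
    norm_cast
    exact inv_mul_cancel₀ this
  rw [h2, fourierMultiplierCLM_const]
  simp

theorem schwartzL2_add (φ ψ : 𝓢(R3, ℂ)) : schwartzL2 (φ + ψ) = schwartzL2 φ + schwartzL2 ψ := rfl

theorem schwartzL2_sub (φ ψ : 𝓢(R3, ℂ)) : schwartzL2 (φ - ψ) = schwartzL2 φ - schwartzL2 ψ := rfl

theorem schwartzL2_smul (c : ℂ) (φ : 𝓢(R3, ℂ)) : schwartzL2 (c • φ) = c • schwartzL2 φ := rfl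

theorem exists_schwartz_tendsto (f : ElectronSpace) :
    ∃ φ : ℕ → 𝓢(R3, ℂ), Tendsto (fun n => schwartzL2 (φ n)) atTop (𝓝 f) := by
  have hd : DenseRange (SchwartzMap.toLpCLM ℝ ℂ 2 (volume : Measure R3)) :=
    SchwartzMap.denseRange_toLpCLM ENNReal.ofNat_ne_top
  obtain ⟨u, hu, hl⟩ := mem_closure_iff_seq_limit.1 (hd f)
  choose φ hφ using hu
  refine ⟨φ, hl.congr fun n => ?_⟩
  rw [← hφ n]
  rfl

theorem re_inner_schwartz_nonneg (φ : 𝓢(R3, ℂ)) :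
    0 ≤ (inner ℂ (schwartzL2 φ) (schwartzL2 (-Δ φ))).re := by
  rw [re_inner_neg_laplacian_schwartz]
  exact Finset.sum_nonneg fun j _ => integral_nonneg fun x => by positivity

theorem schwartz_mul_norm_le (μ : ℝ) (φ : 𝓢(R3, ℂ)) :
    μ * ‖schwartzL2 φ‖ ≤ ‖schwartzL2 (-Δ φ + (μ : ℂ) • φ)‖ := by
  have h1 := re_inner_schwartz_nonneg φ
  have h2 : (inner ℂ (schwartzL2 φ) (schwartzL2 (-Δ φ + (μ : ℂ) • φ))).re ≤
      ‖schwartzL2 φ‖ * ‖schwartzL2 (-Δ φ + (μ : ℂ) • φ)‖ :=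
    (Complex.re_le_norm _).trans (norm_inner_le_norm _ _)
  rw [schwartzL2_add, schwartzL2_smul, inner_add_right, inner_smul_right,
    inner_self_eq_norm_sq_to_K, Complex.add_re] at h2
  have h3 : ((μ : ℂ) * ((‖schwartzL2 φ‖ : ℝ) : ℂ) ^ 2).re = μ * ‖schwartzL2 φ‖ ^ 2 := by norm_cast
  simp only [Complex.coe_algebraMap] at h2
  rw [h3] at h2
  rw [schwartzL2_add, schwartzL2_smul]
  rcases (norm_nonneg (schwartzL2 φ)).eq_or_lt with h0 | h0
  · rw [← h0]; simp
  · refine le_of_mul_le_mul_left ?_ h0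
    nlinarith

/-- Approximate the right-hand side by Schwartz functions and solve (-Δ + μ) φ = ψ exactly within
the Schwartz space. The lower bound `schwartz_mul_norm_le` turns convergence of the right-hand sides
into convergence of the solutions. This yields both the range condition and the core property. -/
theorem exists_core_of_rhs {μ : ℝ} (hμ : 0 < μ) (h : ElectronSpace) :
    ∃ f : ElectronSpace, ∃ φ : ℕ → 𝓢(R3, ℂ), Tendsto (fun n => schwartzL2 (φ n)) atTop (𝓝 f) ∧
      Tendsto (fun n => schwartzL2 (-Δ (φ n))) atTop (𝓝 (h - (μ : ℂ) • f)) := by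
  obtain ⟨ψ, hψ⟩ := exists_schwartz_tendsto h
  have hs : ∀ n, ∃ φ : 𝓢(R3, ℂ), -Δ φ + (μ : ℂ) • φ = ψ n := by
    intro n
    -- With this c the operator of `schwartz_solve` is 1 - μ⁻¹Δ, the factor (2π)² being the Fourier
    -- normalization; multiplying by μ gives -Δ + μ.
    obtain ⟨φ, hφ⟩ := schwartz_solve (c := (2 * Real.pi) ^ 2 / μ) (by positivity)
      ((μ⁻¹ : ℂ) • ψ n)
    refine ⟨φ, ?_⟩
    have h1 : (2 * Real.pi) ^ 2 / μ / (2 * Real.pi) ^ 2 = μ⁻¹ := by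
      have := Real.pi_ne_zero
      field_simp
    have hμ' : (μ : ℂ) ≠ 0 := by exact_mod_cast hμ.ne'
    rw [h1] at hφ
    have h2 := congrArg (fun g => (μ : ℂ) • g) hφ
    simp only [smul_sub, smul_smul, Complex.ofReal_inv, mul_inv_cancel₀ hμ', one_smul] at h2
    rw [← h2]
    abel
  choose φ hφ using hs
  have hb : ∀ m n, μ * ‖schwartzL2 (φ m) - schwartzL2 (φ n)‖ ≤
      ‖schwartzL2 (ψ m) - schwartzL2 (ψ n)‖ := by
    intro m n
    rw [← schwartzL2_sub, ← schwartzL2_sub, ← hφ m, ← hφ n]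
    refine (schwartz_mul_norm_le μ (φ m - φ n)).trans_eq ?_
    have : Δ (φ m - φ n) = Δ (φ m) - Δ (φ n) :=
      map_sub (LineDeriv.laplacianCLM ℝ R3 𝓢(R3, ℂ)) (φ m) (φ n)
    rw [this, smul_sub]
    congr 2
    abel
  have hc : CauchySeq fun n => schwartzL2 (φ n) := by
    rw [Metric.cauchySeq_iff]
    intro ε hε
    obtain ⟨N, hN⟩ := Metric.cauchySeq_iff.1 hψ.cauchySeq (μ * ε) (by positivity)
    refine ⟨N, fun m hm n hn => ?_⟩
    have h1 := hN m hm n hn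
    rw [dist_eq_norm] at h1 ⊢
    exact lt_of_mul_lt_mul_left ((hb m n).trans_lt h1) hμ.le
  obtain ⟨f, hf⟩ := cauchySeq_tendsto_of_complete hc
  refine ⟨f, φ, hf, (hψ.sub (hf.const_smul (μ : ℂ))).congr fun n => ?_⟩
  rw [← hφ n, schwartzL2_add, schwartzL2_smul, add_sub_cancel_right]

/-- The Schwartz space is a core of the kinetic energy. -/
theorem exists_core {f g : ElectronSpace} (h : (f, g) ∈ kineticGraph) :
    ∃ φ : ℕ → 𝓢(R3, ℂ), Tendsto (fun n => schwartzL2 (φ n)) atTop (𝓝 f) ∧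
      Tendsto (fun n => schwartzL2 (-Δ (φ n))) atTop (𝓝 g) := by
  obtain ⟨f', φ, h1, h2⟩ := exists_core_of_rhs (μ := 1) one_pos (g + f)
  rw [Complex.ofReal_one, one_smul] at h2
  have h3 : (f', g + f - f') ∈ kineticGraph :=
    isClosed_kineticGraph.mem_of_tendsto (h1.prodMk_nhds h2)
      (Eventually.of_forall fun n => schwartz_mem_kineticGraph (φ n))
  have h4 := sub_mem h h3
  rw [Prod.mk_sub_mk, mem_kineticGraph_iff] at h4
  -- The difference solves (1 - Δ)(f - f') = 0 as a distribution, so the limit of the approximants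
  -- is f itself.
  have h5 : f - f' = 0 := by
    refine toTempered_eq_zero (eq_zero_of_sub_smul_laplacian (c := (2 * Real.pi) ^ 2)
      (by positivity) ?_)
    rw [div_self (by have := Real.pi_ne_zero; positivity), Complex.ofReal_one, one_smul,
      sub_eq_add_neg, ← h4, ← toTempered_add]
    convert toTempered_smul 0 0 using 2
    · rw [smul_zero]; abel
    · simp
  rw [← sub_eq_zero.1 h5] at h1 h2
  refine ⟨φ, h1, ?_⟩
  simpa using h2

theorem nonnegSelfAdj_kinetic : NonnegSelfAdj kinetic := by
  refine ⟨⟨?_, ?_⟩, ?_⟩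
  · intro f f' g g' hf hg
    rw [kinetic_graph] at hf hg
    obtain ⟨φ, h1, h2⟩ := exists_core hf
    obtain ⟨ψ, h3, h4⟩ := exists_core hg
    refine tendsto_nhds_unique (h1.inner h4) ((h2.inner h3).congr fun n => ?_)
    rw [inner_laplacian_schwartz]
  · intro f f' hf
    rw [kinetic_graph] at hf
    obtain ⟨φ, h1, h2⟩ := exists_core hf
    exact ge_of_tendsto' ((Complex.continuous_re.tendsto _).comp (h1.inner h2)) fun n =>
      re_inner_schwartz_nonneg (φ n)
  · intro r hr v
    obtain ⟨f, φ, h1, h2⟩ := exists_core_of_rhs hr v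
    refine ⟨f, ?_⟩
    rw [mem_graph_shift, kinetic_graph]
    exact isClosed_kineticGraph.mem_of_tendsto (h1.prodMk_nhds h2)
      (Eventually.of_forall fun n => schwartz_mem_kineticGraph (φ n))

end Kinetic

/-! ## Hardy's inequality and the Coulomb inequality -/

section Hardy

/-- Two limits are taken at once, from Schwartz functions to the whole operator domain and from
bounded weights to a singular one: pass to a subsequence of the core sequence converging almost
everywhere and apply Fatou's lemma. The lower integral avoids assuming that W|f|² is integrable. -/
theorem lintegral_weight_le {W : R3 → ℝ} {w : ℕ → R3 → ℝ} (hw0 : ∀ n x, 0 ≤ w n x)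
    (hwm : ∀ n, Continuous (w n)) {C : ℕ → ℝ} (hwb : ∀ n x, w n x ≤ C n)
    (hlim : ∀ᵐ x, Tendsto (fun n => w n x) atTop (𝓝 (W x))) {c : ℝ}
    (h : ∀ n (φ : 𝓢(R3, ℂ)), ∫ x, w n x * ‖φ x‖ ^ 2 ≤
      (inner ℂ (schwartzL2 φ) (schwartzL2 (-Δ φ))).re + c * ‖schwartzL2 φ‖ ^ 2)
    {f g : ElectronSpace} (hfg : (f, g) ∈ kineticGraph) :
    ∫⁻ x, ENNReal.ofReal (W x) * ‖f x‖ₑ ^ 2 ≤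
      ENNReal.ofReal ((inner ℂ f g).re + c * ‖f‖ ^ 2) := by
  obtain ⟨φ, h1, h2⟩ := exists_core hfg
  obtain ⟨ns, hns, hae⟩ := (tendstoInMeasure_of_tendsto_Lp h1).exists_seq_tendsto_ae
  have hB : Tendsto (fun n => ENNReal.ofReal
      ((inner ℂ (schwartzL2 (φ (ns n))) (schwartzL2 (-Δ (φ (ns n))))).re +
        c * ‖schwartzL2 (φ (ns n))‖ ^ 2)) atTop
      (𝓝 (ENNReal.ofReal ((inner ℂ f g).re + c * ‖f‖ ^ 2))) := by
    have h3 := h1.comp hns.tendsto_atTop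
    have h4 := h2.comp hns.tendsto_atTop
    exact (ENNReal.continuous_ofReal.tendsto _).comp
      (((Complex.continuous_re.tendsto _).comp (h3.inner h4)).add ((h3.norm.pow 2).const_mul c))
  have hb : ∀ n, ∫⁻ x, ENNReal.ofReal (w n x) * ‖φ (ns n) x‖ₑ ^ 2 ≤ ENNReal.ofReal
      ((inner ℂ (schwartzL2 (φ (ns n))) (schwartzL2 (-Δ (φ (ns n))))).re +
        c * ‖schwartzL2 (φ (ns n))‖ ^ 2) := by
    intro n
    refine le_trans (le_of_eq ?_) (ENNReal.ofReal_le_ofReal (h n (φ (ns n))))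
    have hi : Integrable fun x => w n x * ‖φ (ns n) x‖ ^ 2 := by
      refine ((SchwartzMap.memLp (φ (ns n)) 2).integrable_norm_pow two_ne_zero).bdd_mul
        (c := C n) (hwm n).aestronglyMeasurable (Eventually.of_forall fun x => ?_)
      rw [Real.norm_eq_abs, abs_of_nonneg (hw0 n x)]
      exact hwb n x
    rw [ofReal_integral_eq_lintegral_ofReal hi
      (Eventually.of_forall fun x => mul_nonneg (hw0 n x) (by positivity))]
    refine lintegral_congr fun x => ?_
    rw [ENNReal.ofReal_mul (hw0 n x), ENNReal.ofReal_pow (norm_nonneg _), ofReal_norm]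
  have hsw : ∀ᵐ x, ∀ n, schwartzL2 (φ (ns n)) x = φ (ns n) x :=
    ae_all_iff.2 fun n => SchwartzMap.coeFn_toLp (φ (ns n)) 2 volume
  calc ∫⁻ x, ENNReal.ofReal (W x) * ‖f x‖ₑ ^ 2
      = ∫⁻ x, liminf (fun n => ENNReal.ofReal (w n x) * ‖φ (ns n) x‖ₑ ^ 2) atTop := by
        refine lintegral_congr_ae ?_
        filter_upwards [hlim, hae, hsw] with x hx1 hx2 hx3
        refine (Tendsto.liminf_eq ?_).symm
        simp only [hx3] at hx2
        refine ENNReal.Tendsto.mul ((ENNReal.continuous_ofReal.tendsto _).comp hx1)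
          (Or.inr (by finiteness))
          (((ENNReal.continuous_pow 2).tendsto _).comp ((continuous_enorm.tendsto _).comp hx2))
          (Or.inr ENNReal.ofReal_ne_top)
    _ ≤ liminf (fun n => ∫⁻ x, ENNReal.ofReal (w n x) * ‖φ (ns n) x‖ₑ ^ 2) atTop := by
        refine lintegral_liminf_le fun n => ?_
        have := (hwm n).measurable
        have := (φ (ns n)).continuous.measurable
        fun_prop
    _ ≤ liminf (fun n => ENNReal.ofReal
          ((inner ℂ (schwartzL2 (φ (ns n))) (schwartzL2 (-Δ (φ (ns n))))).re +
            c * ‖schwartzL2 (φ (ns n))‖ ^ 2)) atTop :=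
        liminf_le_liminf (Eventually.of_forall hb)
    _ = _ := hB.liminf_eq

/-! ### Radial vector fields for the Hardy and Coulomb inequalities. -/

theorem hasFDerivAt_coord_mul_radial (i : Fin 3) {g : ℝ → ℝ} {g' : ℝ} {x : R3}
    (hg : HasDerivAt g g' (‖x‖ ^ 2)) :
    HasFDerivAt (fun x : R3 => x i * g (‖x‖ ^ 2))
      ((x i * g') • ((2 : ℝ) • innerSL ℝ x) +
        g (‖x‖ ^ 2) • (EuclideanSpace.proj i : R3 →L[ℝ] ℝ)) x := by
  have h1 : HasFDerivAt (fun x : R3 => ‖x‖ ^ 2) ((2 : ℝ) • innerSL ℝ x) x := by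
    have := (hasStrictFDerivAt_norm_sq x).hasFDerivAt
    rwa [← Nat.cast_smul_eq_nsmul ℝ, Nat.cast_ofNat] at this
  have h2 : HasFDerivAt (fun x : R3 => x i) (EuclideanSpace.proj i : R3 →L[ℝ] ℝ) x :=
    (EuclideanSpace.proj i : R3 →L[ℝ] ℝ).hasFDerivAt
  have h3 := h2.mul (hg.comp_hasFDerivAt x h1)
  rw [smul_smul] at h3
  exact h3

theorem inner_axis (x : R3) (j : Fin 3) : inner ℝ x (axis j) = x j := by
  simp [axis, EuclideanSpace.inner_single_right]

theorem fderiv_coord_mul_radial (i j : Fin 3) {g : ℝ → ℝ} {g' : ℝ} {x : R3}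
    (hg : HasDerivAt g g' (‖x‖ ^ 2)) :
    fderiv ℝ (fun x : R3 => x i * g (‖x‖ ^ 2)) x (axis j) =
      (if i = j then g (‖x‖ ^ 2) else 0) + 2 * (x i * x j) * g' := by
  rw [(hasFDerivAt_coord_mul_radial i hg).fderiv]
  simp only [add_apply, smul_apply, innerSL_apply_apply, inner_axis, smul_eq_mul,
    PiLp.proj_apply]
  split_ifs with h
  · subst h
    simp
    ring
  · simp [h]
    ring

theorem abs_coord_le (x : R3) (j : Fin 3) : |x j| ≤ ‖x‖ := PiLp.norm_apply_le x j

theorem norm_sq_eq_sum (x : R3) : ‖x‖ ^ 2 = ∑ j, x j ^ 2 := EuclideanSpace.real_norm_sq_eq x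

theorem sq_coord_le (x : R3) (j : Fin 3) : x j ^ 2 ≤ ‖x‖ ^ 2 := by
  rw [← sq_abs (x j)]
  exact pow_le_pow_left₀ (abs_nonneg _) (abs_coord_le x j) 2

theorem contDiff_coord (j : Fin 3) {n : WithTop ℕ∞} : ContDiff ℝ n fun x : R3 => x j :=
  (EuclideanSpace.proj j : R3 →L[ℝ] ℝ).contDiff

/-- The field is F = x/(2Q) with Q = |x|² + δ², a smooth version of x/(2|x|²), for which div F -
|F|² = 1/(4|x|²) exactly. With δ > 0 one finds (6Q - 5|x|²)/(4Q²), which is at least 1/(4Q) because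
|x|² ≤ Q. -/
theorem hardy_regularized {δ : ℝ} (hδ : 0 < δ) (φ : 𝓢(R3, ℂ)) :
    ∫ x, (1 / (4 * (‖x‖ ^ 2 + δ ^ 2))) * ‖φ x‖ ^ 2 ≤
      (inner ℂ (schwartzL2 φ) (schwartzL2 (-Δ φ))).re + 0 * ‖schwartzL2 φ‖ ^ 2 := by
  have hQ : ∀ x : R3, 0 < ‖x‖ ^ 2 + δ ^ 2 := fun x => by positivity
  have hg : ∀ t : ℝ, 0 ≤ t → HasDerivAt (fun t => (2 * (t + δ ^ 2))⁻¹)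
      (-(2 * (t + δ ^ 2) ^ 2)⁻¹) t := by
    intro t ht
    have h0 : 2 * (t + δ ^ 2) ≠ 0 := by positivity
    have h1 : HasDerivAt (fun t : ℝ => 2 * (t + δ ^ 2)) (2 * 1) t :=
      ((hasDerivAt_id t).add_const _).const_mul 2
    refine (h1.inv h0).congr_deriv ?_
    have : t + δ ^ 2 ≠ 0 := by positivity
    field_simp
  have hfd : ∀ (j : Fin 3) (x : R3),
      fderiv ℝ (fun x : R3 => x j * (2 * (‖x‖ ^ 2 + δ ^ 2))⁻¹) x (axis j) =
        (2 * (‖x‖ ^ 2 + δ ^ 2))⁻¹ - x j ^ 2 * ((‖x‖ ^ 2 + δ ^ 2) ^ 2)⁻¹ := by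
    intro j x
    rw [fderiv_coord_mul_radial j j (g := fun t => (2 * (t + δ ^ 2))⁻¹) (hg _ (by positivity)),
      if_pos rfl, mul_inv 2 ((‖x‖ ^ 2 + δ ^ 2) ^ 2)]
    ring
  refine integral_le_of_vectorField φ (F := fun j x => x j * (2 * (‖x‖ ^ 2 + δ ^ 2))⁻¹)
    (C := δ⁻¹ + 2 * (δ ^ 2)⁻¹) (fun j => ?_) (fun j x => ?_) (fun j x => ?_)
    (W := fun x => 1 / (4 * (‖x‖ ^ 2 + δ ^ 2))) (c := 0)
    (fun x => by have := hQ x; positivity) (fun x => ?_)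
  · refine (contDiff_coord j).mul (ContDiff.inv ?_ fun x => ?_)
    · exact contDiff_const.mul ((contDiff_norm_sq ℝ).add contDiff_const)
    · have := hQ x
      positivity
  · have h2 : |x j| * (2 * (‖x‖ ^ 2 + δ ^ 2))⁻¹ ≤ δ⁻¹ := by
      rw [← div_eq_mul_inv, div_le_iff₀ (by have := hQ x; positivity), inv_mul_eq_div,
        le_div_iff₀ hδ]
      nlinarith [abs_coord_le x j, sq_nonneg (‖x‖ - δ)]
    rw [abs_mul, abs_of_pos (a := (2 * (‖x‖ ^ 2 + δ ^ 2))⁻¹) (by have := hQ x; positivity)]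
    have : 0 < (δ ^ 2)⁻¹ := by positivity
    linarith
  · rw [hfd]
    have h1 : (2 * (‖x‖ ^ 2 + δ ^ 2))⁻¹ ≤ (δ ^ 2)⁻¹ := by
      apply inv_anti₀ (by positivity)
      nlinarith [sq_nonneg ‖x‖, sq_nonneg δ]
    have h2 : x j ^ 2 * ((‖x‖ ^ 2 + δ ^ 2) ^ 2)⁻¹ ≤ (δ ^ 2)⁻¹ := by
      rw [← div_eq_mul_inv, div_le_iff₀ (by have := hQ x; positivity), inv_mul_eq_div,
        le_div_iff₀ (by positivity)]
      nlinarith [sq_coord_le x j, sq_nonneg ‖x‖, sq_nonneg δ, mul_nonneg (sq_nonneg ‖x‖) (sq_nonneg δ),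
        sq_nonneg (‖x‖ ^ 2)]
    have h3 : 0 ≤ (2 * (‖x‖ ^ 2 + δ ^ 2))⁻¹ := by have := hQ x; positivity
    have h4 : 0 ≤ x j ^ 2 * ((‖x‖ ^ 2 + δ ^ 2) ^ 2)⁻¹ := by positivity
    have : 0 < δ⁻¹ := by positivity
    rw [abs_le]
    constructor <;> linarith
  · simp only [hfd]
    have hx := norm_sq_eq_sum x
    rw [Fin.sum_univ_three] at hx ⊢
    have hq := hQ x
    generalize hQQ : ‖x‖ ^ 2 + δ ^ 2 = Q at *
    have h5 : (2 * Q)⁻¹ - x 0 ^ 2 * (Q ^ 2)⁻¹ - (x 0 * (2 * Q)⁻¹) ^ 2 +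
        ((2 * Q)⁻¹ - x 1 ^ 2 * (Q ^ 2)⁻¹ - (x 1 * (2 * Q)⁻¹) ^ 2) +
        ((2 * Q)⁻¹ - x 2 ^ 2 * (Q ^ 2)⁻¹ - (x 2 * (2 * Q)⁻¹) ^ 2) + 0 =
        (6 * Q - 5 * (x 0 ^ 2 + x 1 ^ 2 + x 2 ^ 2)) / (4 * Q ^ 2) := by
      field_simp
      ring
    rw [h5, ← hx, div_le_div_iff₀ (by positivity) (by positivity)]
    have : ‖x‖ ^ 2 ≤ Q := by rw [← hQQ]; nlinarith
    nlinarith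

/-- The field F = (a/2) x/q, with q = (|x|² + δ²)^{1/2}, is minus the logarithmic gradient of exp(-a
q/2), a regularized ground state. For δ = 0 one has div F - |F|² = a/|x| - a²/4 exactly; the
regularization only adds nonnegative terms. -/
theorem coulomb_regularized {a : ℝ} (ha : 0 ≤ a) {δ : ℝ} (hδ : 0 < δ) (φ : 𝓢(R3, ℂ)) :
    ∫ x, (a / √(‖x‖ ^ 2 + δ ^ 2)) * ‖φ x‖ ^ 2 ≤
      (inner ℂ (schwartzL2 φ) (schwartzL2 (-Δ φ))).re + a ^ 2 / 4 * ‖schwartzL2 φ‖ ^ 2 := by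
  have hQ : ∀ x : R3, 0 < ‖x‖ ^ 2 + δ ^ 2 := fun x => by positivity
  have hq : ∀ x : R3, 0 < √(‖x‖ ^ 2 + δ ^ 2) := fun x => Real.sqrt_pos.2 (hQ x)
  have hsq : ∀ x : R3, √(‖x‖ ^ 2 + δ ^ 2) ^ 2 = ‖x‖ ^ 2 + δ ^ 2 := fun x => Real.sq_sqrt (hQ x).le
  have hqδ : ∀ x : R3, δ ≤ √(‖x‖ ^ 2 + δ ^ 2) := fun x => Real.le_sqrt_of_sq_le (by nlinarith)
  have hqx : ∀ x : R3, ‖x‖ ≤ √(‖x‖ ^ 2 + δ ^ 2) := fun x => Real.le_sqrt_of_sq_le (by nlinarith)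
  have hg : ∀ t : ℝ, 0 ≤ t → HasDerivAt (fun t => a / 2 * (√(t + δ ^ 2))⁻¹)
      (-(a / 4 * (√(t + δ ^ 2) ^ 3)⁻¹)) t := by
    intro t ht
    have h0 : t + δ ^ 2 ≠ 0 := by positivity
    have h1 : HasDerivAt (fun t : ℝ => √(t + δ ^ 2)) (1 / (2 * √(t + δ ^ 2))) t :=
      ((hasDerivAt_id t).add_const _).sqrt h0
    have h2 : √(t + δ ^ 2) ≠ 0 := (Real.sqrt_pos.2 (by positivity)).ne'
    refine ((h1.inv h2).const_mul (a / 2)).congr_deriv ?_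
    field_simp
    norm_num
  have hfd : ∀ (j : Fin 3) (x : R3),
      fderiv ℝ (fun x : R3 => x j * (a / 2 * (√(‖x‖ ^ 2 + δ ^ 2))⁻¹)) x (axis j) =
        a / 2 * (√(‖x‖ ^ 2 + δ ^ 2))⁻¹ - a / 2 * (x j ^ 2 * (√(‖x‖ ^ 2 + δ ^ 2) ^ 3)⁻¹) := by
    intro j x
    rw [fderiv_coord_mul_radial j j (g := fun t => a / 2 * (√(t + δ ^ 2))⁻¹) (hg _ (by positivity)),
      if_pos rfl]
    ring
  refine integral_le_of_vectorField φ (F := fun j x => x j * (a / 2 * (√(‖x‖ ^ 2 + δ ^ 2))⁻¹))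
    (C := a / 2 + a / 2 * δ⁻¹) (fun j => ?_) (fun j x => ?_) (fun j x => ?_)
    (W := fun x => a / √(‖x‖ ^ 2 + δ ^ 2)) (c := a ^ 2 / 4)
    (fun x => by have := hq x; positivity) (fun x => ?_)
  · refine (contDiff_coord j).mul (contDiff_const.mul (ContDiff.inv (ContDiff.sqrt ?_ fun x => ?_)
      fun x => (hq x).ne'))
    · exact (contDiff_norm_sq ℝ).add contDiff_const
    · exact (hQ x).ne'
  · have h2 : |x j| * (√(‖x‖ ^ 2 + δ ^ 2))⁻¹ ≤ 1 := by
      rw [← div_eq_mul_inv, div_le_one (hq x)]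
      exact (abs_coord_le x j).trans (hqx x)
    rw [abs_mul, abs_of_nonneg (a := a / 2 * _) (by have := hq x; positivity)]
    have : 0 ≤ a / 2 * δ⁻¹ := by positivity
    calc |x j| * (a / 2 * (√(‖x‖ ^ 2 + δ ^ 2))⁻¹)
        = a / 2 * (|x j| * (√(‖x‖ ^ 2 + δ ^ 2))⁻¹) := by ring
      _ ≤ a / 2 * 1 := by gcongr
      _ ≤ _ := by linarith
  · rw [hfd]
    have hq0 := hq x
    have h1 : (√(‖x‖ ^ 2 + δ ^ 2))⁻¹ ≤ δ⁻¹ := inv_anti₀ hδ (hqδ x)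
    have h2 : x j ^ 2 * (√(‖x‖ ^ 2 + δ ^ 2) ^ 3)⁻¹ ≤ (√(‖x‖ ^ 2 + δ ^ 2))⁻¹ := by
      have h3 : x j ^ 2 ≤ √(‖x‖ ^ 2 + δ ^ 2) ^ 2 := by
        rw [hsq]
        nlinarith [sq_coord_le x j]
      calc x j ^ 2 * (√(‖x‖ ^ 2 + δ ^ 2) ^ 3)⁻¹
          ≤ √(‖x‖ ^ 2 + δ ^ 2) ^ 2 * (√(‖x‖ ^ 2 + δ ^ 2) ^ 3)⁻¹ := by gcongr
        _ = _ := by field_simp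
    have h4 : 0 ≤ x j ^ 2 * (√(‖x‖ ^ 2 + δ ^ 2) ^ 3)⁻¹ := by positivity
    rw [← mul_sub, abs_of_nonneg (mul_nonneg (by positivity) (by linarith))]
    have : a / 2 * ((√(‖x‖ ^ 2 + δ ^ 2))⁻¹ - x j ^ 2 * (√(‖x‖ ^ 2 + δ ^ 2) ^ 3)⁻¹) ≤
        a / 2 * δ⁻¹ := by
      gcongr
      linarith
    linarith
  · simp only [hfd]
    have hx := norm_sq_eq_sum x
    rw [Fin.sum_univ_three] at hx ⊢
    have hq0 := hq x
    have hs := hsq x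
    generalize √(‖x‖ ^ 2 + δ ^ 2) = q at *
    have h5 : a / 2 * q⁻¹ - a / 2 * (x 0 ^ 2 * (q ^ 3)⁻¹) - (x 0 * (a / 2 * q⁻¹)) ^ 2 +
        (a / 2 * q⁻¹ - a / 2 * (x 1 ^ 2 * (q ^ 3)⁻¹) - (x 1 * (a / 2 * q⁻¹)) ^ 2) +
        (a / 2 * q⁻¹ - a / 2 * (x 2 ^ 2 * (q ^ 3)⁻¹) - (x 2 * (a / 2 * q⁻¹)) ^ 2) + a ^ 2 / 4 =
        a / q + a / 2 * ((q ^ 2 - (x 0 ^ 2 + x 1 ^ 2 + x 2 ^ 2)) / q ^ 3) +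
          a ^ 2 / 4 * ((q ^ 2 - (x 0 ^ 2 + x 1 ^ 2 + x 2 ^ 2)) / q ^ 2) := by
      field_simp
      ring
    rw [h5, ← hx, hs, add_sub_cancel_left]
    have : 0 ≤ a / 2 * (δ ^ 2 / q ^ 3) + a ^ 2 / 4 * (δ ^ 2 / (‖x‖ ^ 2 + δ ^ 2)) := by positivity
    rw [← hs] at this ⊢
    linarith

theorem ae_ne_zero : ∀ᵐ x : R3, x ≠ 0 := by
  simp [ae_iff, measure_singleton]

theorem tendsto_inv_nat_sq (t : ℝ) :
    Tendsto (fun n : ℕ => t + ((n : ℝ) + 1)⁻¹ ^ 2) atTop (𝓝 t) := by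
  have h : Tendsto (fun n : ℕ => ((n : ℝ) + 1)⁻¹) atTop (𝓝 0) := by
    simpa only [one_div] using tendsto_one_div_add_atTop_nhds_zero_nat (𝕜 := ℝ)
  simpa using (h.pow 2).const_add t

/-- Hardy's inequality. -/
theorem hardy {f g : ElectronSpace} (hfg : (f, g) ∈ kineticGraph) :
    ∫⁻ x, ENNReal.ofReal (1 / (4 * ‖x‖ ^ 2)) * ‖f x‖ₑ ^ 2 ≤ ENNReal.ofReal (inner ℂ f g).re := by
  have hδ : ∀ n : ℕ, 0 < ((n : ℝ) + 1)⁻¹ := fun n => by positivity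
  have h := lintegral_weight_le (W := fun x => 1 / (4 * ‖x‖ ^ 2)) (c := 0)
    (w := fun n x => 1 / (4 * (‖x‖ ^ 2 + ((n : ℝ) + 1)⁻¹ ^ 2)))
    (C := fun n => 1 / (4 * ((n : ℝ) + 1)⁻¹ ^ 2))
    (fun n x => by positivity) (fun n => ?_) (fun n x => ?_) ?_
    (fun n φ => hardy_regularized (hδ n) φ) hfg
  · simpa using h
  · refine continuous_const.div (by fun_prop) fun x => ?_
    have := hδ n
    positivity
  · have := hδ n
    gcongr
    nlinarith [sq_nonneg ‖x‖]
  · filter_upwards [ae_ne_zero] with x hx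
    have : 4 * ‖x‖ ^ 2 ≠ 0 := by have := norm_pos_iff.2 hx; positivity
    exact tendsto_const_nhds.div ((tendsto_inv_nat_sq _).const_mul 4) this

/-- The Coulomb inequality `a / |x| ≤ -Δ + a² / 4`. -/
theorem coulomb {a : ℝ} (ha : 0 ≤ a) {f g : ElectronSpace} (hfg : (f, g) ∈ kineticGraph) :
    ∫⁻ x, ENNReal.ofReal (a / ‖x‖) * ‖f x‖ₑ ^ 2 ≤
      ENNReal.ofReal ((inner ℂ f g).re + a ^ 2 / 4 * ‖f‖ ^ 2) := by
  have hδ : ∀ n : ℕ, 0 < ((n : ℝ) + 1)⁻¹ := fun n => by positivity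
  have hq : ∀ (n : ℕ) (x : R3), ((n : ℝ) + 1)⁻¹ ≤ √(‖x‖ ^ 2 + ((n : ℝ) + 1)⁻¹ ^ 2) :=
    fun n x => Real.le_sqrt_of_sq_le (by nlinarith)
  refine lintegral_weight_le (W := fun x => a / ‖x‖)
    (w := fun n x => a / √(‖x‖ ^ 2 + ((n : ℝ) + 1)⁻¹ ^ 2))
    (C := fun n => a / ((n : ℝ) + 1)⁻¹)
    (fun n x => by positivity) (fun n => ?_) (fun n x => ?_) ?_
    (fun n φ => coulomb_regularized ha (hδ n) φ) hfg
  · exact continuous_const.div (by fun_prop) fun x => ((hδ n).trans_le (hq n x)).ne'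
  · have := hδ n
    have := hq n x
    gcongr
  · filter_upwards [ae_ne_zero] with x hx
    have h1 : ‖x‖ ≠ 0 := norm_ne_zero_iff.2 hx
    have h2 := (Real.continuous_sqrt.tendsto _).comp (tendsto_inv_nat_sq (‖x‖ ^ 2))
    rw [Real.sqrt_sq (norm_nonneg x)] at h2
    exact tendsto_const_nhds.div h2 h1

end Hardy

/-! ## The hydrogen atom is self-adjoint and bounded from below by its ground state energy -/

section Hydrogen

/-- The Coulomb potential. -/
def coulombPot (α : ℝ) (x : R3) : ℂ := ((-(α / ‖x‖) : ℝ) : ℂ)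

theorem measurable_coulombPot (α : ℝ) : Measurable (coulombPot α) := by
  unfold coulombPot
  fun_prop

theorem mem_hydrogen_graph {α : ℝ} {f g : ElectronSpace} :
    (f, g) ∈ (hydrogen α).graph ↔
      ∃ g₀ v, (f, g₀) ∈ kineticGraph ∧ (f, v) ∈ multGraph (coulombPot α) ∧ g = g₀ + v := by
  rw [← kinetic_graph, ← mult_graph]
  constructor
  · intro h
    obtain ⟨⟨y, hy⟩, h1, h2⟩ := (LinearPMap.mem_graph_iff _).1 h
    obtain rfl : y = f := h1
    have h3 := LinearPMap.mem_graph kinetic ⟨y, hy.1⟩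
    have h4 := LinearPMap.mem_graph (mult (coulombPot α)) ⟨y, hy.2⟩
    refine ⟨_, _, h3, h4, h2.symm⟩
  · rintro ⟨g₀, v, h1, h2, rfl⟩
    obtain ⟨⟨y, hy⟩, h3, rfl⟩ := (LinearPMap.mem_graph_iff _).1 h1
    obtain ⟨⟨z, hz⟩, h5, rfl⟩ := (LinearPMap.mem_graph_iff _).1 h2
    obtain rfl : y = f := h3
    obtain rfl : z = y := h5
    exact LinearPMap.mem_graph (kinetic + mult (coulombPot α)) ⟨z, hy, hz⟩

theorem mem_excitation_graph {α : ℝ} {f g : ElectronSpace} :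
    (f, g) ∈ (excitation α).graph ↔ ∃ g₀ v, (f, g₀) ∈ kineticGraph ∧
      (f, v) ∈ multGraph (coulombPot α) ∧ g = g₀ + v + ((α ^ 2 / 4 : ℝ) : ℂ) • f := by
  have h0 : -groundEnergy α = α ^ 2 / 4 := by rw [groundEnergy, neg_neg]
  rw [excitation, mem_graph_shift, mem_hydrogen_graph, h0]
  simp only [sub_eq_iff_eq_add]

theorem integrable_inner_mult {V : R3 → ℂ} {f v : ElectronSpace} (h : (f, v) ∈ multGraph V) :
    inner ℂ f v = ∫ x, V x * ((‖f x‖ ^ 2 : ℝ) : ℂ) := by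
  have h' : ∀ᵐ x, v x = V x * f x := h
  rw [L2.inner_def]
  refine integral_congr_ae ?_
  filter_upwards [h'] with x hx
  rw [hx, RCLike.inner_apply', mul_left_comm, Complex.conj_mul']
  push_cast
  rfl

/-- The constant in `coulomb` is the exact ground state energy. Nothing weaker would do: resolvents
are needed at every shift r > 0, however small. -/
theorem coulomb_form {α : ℝ} (hα : 0 ≤ α) {f g v : ElectronSpace} (hfg : (f, g) ∈ kineticGraph)
    (h : (f, v) ∈ multGraph (coulombPot α)) :
    0 ≤ (inner ℂ f g).re + (inner ℂ f v).re + α ^ 2 / 4 * ‖f‖ ^ 2 := by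
  have h1 := coulomb hα hfg
  have h2 : (inner ℂ f v).re = -∫ x, α / ‖x‖ * ‖f x‖ ^ 2 := by
    rw [integrable_inner_mult h, ← integral_neg]
    have : ∀ x, coulombPot α x * ((‖f x‖ ^ 2 : ℝ) : ℂ) = ((-(α / ‖x‖ * ‖f x‖ ^ 2) : ℝ) : ℂ) := by
      intro x
      rw [coulombPot]
      push_cast
      ring
    simp_rw [this]
    rw [integral_complex_ofReal, Complex.ofReal_re]
  have hm : AEStronglyMeasurable (fun x => α / ‖x‖ * ‖f x‖ ^ 2) (volume : Measure R3) := by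
    have := (Lp.memLp f).aestronglyMeasurable.norm
    have h3 : Measurable fun x : R3 => α / ‖x‖ := by fun_prop
    exact h3.aestronglyMeasurable.mul (this.pow 2)
  have h0 : 0 ≤ (inner ℂ f g).re + α ^ 2 / 4 * ‖f‖ ^ 2 := by
    have := nonnegSelfAdj_kinetic.nonneg (kinetic_graph ▸ hfg)
    positivity
  have h3 : ∫ x, α / ‖x‖ * ‖f x‖ ^ 2 ≤ (inner ℂ f g).re + α ^ 2 / 4 * ‖f‖ ^ 2 := by
    rw [integral_eq_lintegral_of_nonneg_ae
      (Eventually.of_forall fun x => by simp only [Pi.zero_apply]; positivity) hm]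
    refine ENNReal.toReal_le_of_le_ofReal h0 (le_trans (le_of_eq ?_) h1)
    refine lintegral_congr fun x => ?_
    rw [ENNReal.ofReal_mul (by positivity), ENNReal.ofReal_pow (norm_nonneg _), ofReal_norm]
  linarith

/-- By Hardy's inequality the Coulomb potential is defined on the domain of the kinetic energy. -/
theorem exists_coulomb_mult (α : ℝ) {f g : ElectronSpace}
    (hfg : (f, g) ∈ kineticGraph) :
    ∃ v : ElectronSpace, (f, v) ∈ multGraph (coulombPot α) ∧
      ‖v‖ ^ 2 ≤ 4 * α ^ 2 * (inner ℂ f g).re := by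
  have h1 := hardy hfg
  have hm : AEStronglyMeasurable (fun x => coulombPot α x * f x) (volume : Measure R3) :=
    (measurable_coulombPot α).aestronglyMeasurable.mul (Lp.memLp f).aestronglyMeasurable
  have h0 := nonnegSelfAdj_kinetic.nonneg (kinetic_graph ▸ hfg)
  have h2 : ∫⁻ x, ‖coulombPot α x * f x‖ₑ ^ 2 ≤
      ENNReal.ofReal (4 * α ^ 2 * (inner ℂ f g).re) := by
    rw [ENNReal.ofReal_mul (by positivity)]
    refine le_trans (le_of_eq ?_) (mul_le_mul_right h1 (ENNReal.ofReal (4 * α ^ 2)))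
    rw [← lintegral_const_mul' _ _ ENNReal.ofReal_ne_top]
    refine lintegral_congr fun x => ?_
    rw [enorm_mul, mul_pow, ← mul_assoc, ← ENNReal.ofReal_mul (by positivity)]
    congr 1
    rw [← ofReal_norm, ← ENNReal.ofReal_pow (norm_nonneg _)]
    congr 1
    rw [coulombPot, Complex.norm_real, Real.norm_eq_abs, sq_abs, neg_sq, div_pow]
    -- At the origin both sides vanish by the convention for division by zero.
    rcases eq_or_ne (‖x‖ ^ 2) 0 with h | h
    · simp [h]
    · field_simp
  have hL : MemLp (fun x => coulombPot α x * f x) 2 (volume : Measure R3) := by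
    refine ⟨hm, ?_⟩
    rw [eLpNorm_lt_top_iff_lintegral_rpow_enorm_lt_top (by norm_num) (by norm_num)]
    simp only [ENNReal.toReal_ofNat, ENNReal.rpow_ofNat]
    exact h2.trans_lt ENNReal.ofReal_lt_top
  refine ⟨hL.toLp _, hL.coeFn_toLp, ?_⟩
  have h3 : ‖hL.toLp _‖ ^ 2 = ∫ x, ‖coulombPot α x * f x‖ ^ 2 := by
    have h4 := inner_toLp_toLp (𝕜 := ℂ) hL hL
    rw [inner_self_eq_norm_sq_to_K] at h4
    simp only [inner_self_eq_norm_sq_to_K, Complex.coe_algebraMap] at h4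
    simp_rw [← Complex.ofReal_pow] at h4
    rw [integral_complex_ofReal] at h4
    exact_mod_cast h4
  rw [h3, integral_eq_lintegral_of_nonneg_ae
    (Eventually.of_forall fun x => by simp only [Pi.zero_apply]; positivity) (by exact hm.norm.pow 2)]
  refine ENNReal.toReal_le_of_le_ofReal (by positivity) (le_trans (le_of_eq ?_) h2)
  refine lintegral_congr fun x => ?_
  rw [ENNReal.ofReal_pow (norm_nonneg _), ofReal_norm]

theorem multGraph_symm (α : ℝ) {f f' g g' : ElectronSpace}
    (h : (f, f') ∈ multGraph (coulombPot α)) (h' : (g, g') ∈ multGraph (coulombPot α)) :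
    inner ℂ f g' = inner ℂ f' g := by
  have h1 : ∀ᵐ x, f' x = coulombPot α x * f x := h
  have h2 : ∀ᵐ x, g' x = coulombPot α x * g x := h'
  rw [L2.inner_def, L2.inner_def]
  refine integral_congr_ae ?_
  filter_upwards [h1, h2] with x hx hx'
  rw [hx, hx', RCLike.inner_apply', RCLike.inner_apply', map_mul, coulombPot]
  simp only [Complex.conj_ofReal]
  ring

theorem nonnegSymm_excitation {α : ℝ} (hα : 0 ≤ α) : NonnegSymm (excitation α) := by
  constructor
  · intro f f' g g' hf hg
    obtain ⟨f₀, v, h1, h2, rfl⟩ := mem_excitation_graph.1 hf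
    obtain ⟨g₀, w, h3, h4, rfl⟩ := mem_excitation_graph.1 hg
    simp only [inner_add_right, inner_add_left, inner_smul_left, inner_smul_right,
      Complex.conj_ofReal]
    rw [multGraph_symm α h2 h4, nonnegSelfAdj_kinetic.symm (kinetic_graph ▸ h1) (kinetic_graph ▸ h3)]
  · intro f f' hf
    obtain ⟨f₀, v, h1, h2, rfl⟩ := mem_excitation_graph.1 hf
    rw [inner_add_right, inner_add_right, inner_smul_right, inner_self_eq_norm_sq_to_K]
    have h3 : (((α ^ 2 / 4 : ℝ) : ℂ) * ((‖f‖ : ℝ) : ℂ) ^ 2).re = α ^ 2 / 4 * ‖f‖ ^ 2 := by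
      norm_cast
    simp only [Complex.add_re, Complex.coe_algebraMap]
    rw [h3]
    exact coulomb_form hα h1 h2

/-- A Kato–Rellich argument. Put m = μ + α²/4 and R = (-Δ + m)⁻¹; then (h_α - e_α + μ) R = 1 + V R
with V the Coulomb potential. Hardy's inequality gives ‖V R w‖² ≤ 4α² ⟨R w | -Δ | R w⟩ ≤ 4α² ‖w‖²/m,
so V R has norm less than 1 once μ exceeds 4α². -/
theorem nonnegSelfAdj_excitation {α : ℝ} (hα : 0 ≤ α) : NonnegSelfAdj (excitation α) := by
  refine (nonnegSymm_excitation hα).nonnegSelfAdj (4 * α ^ 2 + 1) fun μ hμ hμα => ?_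
  have hm : 0 < μ + α ^ 2 / 4 := by positivity
  have hK := nonnegSelfAdj_kinetic
  have hR : ∀ w, (resolv kinetic (μ + α ^ 2 / 4) w,
      w - ((μ + α ^ 2 / 4 : ℝ) : ℂ) • resolv kinetic (μ + α ^ 2 / 4) w) ∈ kineticGraph := by
    intro w
    have := hK.resolv_mem_graph hm w
    rwa [kinetic_graph] at this
  choose S hS hSn using fun w => exists_coulomb_mult α (hR w)
  have hadd : ∀ w w', S (w + w') = S w + S w' := by
    intro w w'
    have h1 := sub_mem (hS (w + w')) (add_mem (hS w) (hS w'))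
    rw [Prod.mk_add_mk, Prod.mk_sub_mk] at h1
    exact sub_eq_zero.1 (multGraph_functional _ _ h1 (by simp))
  have hsmul : ∀ (c : ℂ) w, S (c • w) = c • S w := by
    intro c w
    have h1 := sub_mem (hS (c • w)) (Submodule.smul_mem _ c (hS w))
    rw [Prod.smul_mk, Prod.mk_sub_mk] at h1
    exact sub_eq_zero.1 (multGraph_functional _ _ h1 (by simp))
  have hbound : ∀ w, ‖S w‖ ≤ 2 * α / √(μ + α ^ 2 / 4) * ‖w‖ := by
    intro w
    refine le_of_sq_le_sq ?_ (by positivity)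
    refine (hSn w).trans ?_
    rw [mul_pow, div_pow, Real.sq_sqrt hm.le, mul_pow]
    have h2 := hK.mul_norm_resolv_apply_le hm w
    have h3 : (inner ℂ (resolv kinetic (μ + α ^ 2 / 4) w)
        (w - ((μ + α ^ 2 / 4 : ℝ) : ℂ) • resolv kinetic (μ + α ^ 2 / 4) w)).re ≤
        ‖resolv kinetic (μ + α ^ 2 / 4) w‖ * ‖w‖ := by
      rw [inner_sub_right, inner_smul_right, inner_self_eq_norm_sq_to_K, Complex.sub_re]
      have h4 : (((μ + α ^ 2 / 4 : ℝ) : ℂ) * ((‖resolv kinetic (μ + α ^ 2 / 4) w‖ : ℝ) : ℂ) ^ 2).re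
          = (μ + α ^ 2 / 4) * ‖resolv kinetic (μ + α ^ 2 / 4) w‖ ^ 2 := by norm_cast
      simp only [Complex.coe_algebraMap]
      rw [h4]
      have h5 := (Complex.re_le_norm _).trans
        (norm_inner_le_norm (𝕜 := ℂ) (resolv kinetic (μ + α ^ 2 / 4) w) w)
      have : 0 ≤ (μ + α ^ 2 / 4) * ‖resolv kinetic (μ + α ^ 2 / 4) w‖ ^ 2 := by positivity
      linarith
    have h6 : ‖resolv kinetic (μ + α ^ 2 / 4) w‖ ≤ ‖w‖ / (μ + α ^ 2 / 4) := by
      rw [le_div_iff₀ hm, mul_comm]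
      exact h2
    calc 4 * α ^ 2 * _ ≤ 4 * α ^ 2 * (‖w‖ / (μ + α ^ 2 / 4) * ‖w‖) := by
          refine mul_le_mul_of_nonneg_left (h3.trans ?_) (by positivity)
          gcongr
      _ = _ := by field_simp; ring
  let S' : ElectronSpace →L[ℂ] ElectronSpace :=
    LinearMap.mkContinuous { toFun := S, map_add' := hadd, map_smul' := hsmul } _ hbound
  refine surjective_of_perturbation (resolv kinetic (μ + α ^ 2 / 4)) S' (fun w => ?_) ?_
  · rw [mem_graph_shift, mem_excitation_graph]
    refine ⟨_, S w, hR w, hS w, ?_⟩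
    change w + S w - _ = _
    rw [Complex.ofReal_add, add_smul]
    abel
  · refine (LinearMap.mkContinuous_norm_le _ (by positivity) _).trans_lt ?_
    rw [div_lt_one (Real.sqrt_pos.2 hm)]
    apply Real.lt_sqrt_of_sq_lt
    nlinarith [sq_nonneg α]

end Hydrogen

/-! ## The ground state and its dipole moments -/

section GroundState

theorem integral_radial_R3 (f : ℝ → ℝ) :
    ∫ x : R3, f ‖x‖ = 4 * Real.pi * ∫ r in Set.Ioi (0 : ℝ), r ^ 2 * f r := by
  have h := integral_fun_norm_addHaar (volume : Measure R3) f
  have hd : Module.finrank ℝ R3 = 3 := by simp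
  have hv : (volume : Measure R3).real (Metric.ball 0 1) = Real.pi * 4 / 3 := by
    rw [measureReal_def, EuclideanSpace.volume_ball_fin_three]
    simp
    positivity
  rw [h, hd, hv]
  simp only [smul_eq_mul, nsmul_eq_mul]
  push_cast
  ring

theorem integrable_pow_mul_exp {α : ℝ} (hα : 0 < α) (n : ℕ) :
    IntegrableOn (fun r : ℝ => r ^ n * Real.exp (-(α * r))) (Set.Ioi 0) := by
  have h := integrableOn_rpow_mul_exp_neg_mul_rpow (p := 1) (s := n) (b := α)
    (by have : (0 : ℝ) ≤ n := n.cast_nonneg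
        linarith) one_pos hα
  simpa [Real.rpow_natCast] using h

theorem integral_pow_mul_exp {α : ℝ} (hα : 0 < α) (n : ℕ) :
    ∫ r in Set.Ioi (0 : ℝ), r ^ n * Real.exp (-(α * r)) = n.factorial / α ^ (n + 1) := by
  have h := Real.integral_rpow_mul_exp_neg_mul_Ioi (a := n + 1) (r := α) (by positivity) hα
  rw [Real.Gamma_nat_eq_factorial, ← Nat.cast_succ, Real.rpow_natCast] at h
  simp only [Nat.cast_succ, add_sub_cancel_right, Real.rpow_natCast] at h
  rw [h]
  simp only [one_div, inv_pow, Nat.succ_eq_add_one]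
  field_simp

theorem integrable_radial_moment {α : ℝ} (hα : 0 < α) (n : ℕ) :
    Integrable fun x : R3 => ‖x‖ ^ n * Real.exp (-(α * ‖x‖)) := by
  refine (integrable_fun_norm_addHaar (volume : Measure R3)
    (f := fun r : ℝ => r ^ n * Real.exp (-(α * r)))).2 ?_
  have hd : Module.finrank ℝ R3 - 1 = 2 := by simp
  rw [hd]
  refine (integrable_pow_mul_exp hα (n + 2)).congr_fun (fun r _ => ?_) measurableSet_Ioi
  simp only [smul_eq_mul]
  ring

theorem integral_radial_moment {α : ℝ} (hα : 0 < α) (n : ℕ) :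
    ∫ x : R3, ‖x‖ ^ n * Real.exp (-(α * ‖x‖)) =
      4 * Real.pi * ((n + 2).factorial / α ^ (n + 3)) := by
  rw [integral_radial_R3 (fun r => r ^ n * Real.exp (-(α * r))), ← integral_pow_mul_exp hα (n + 2)]
  congr 1
  refine integral_congr_ae (Eventually.of_forall fun r => ?_)
  simp only
  ring

theorem groundState_sq {α : ℝ} (hα : 0 < α) (x : R3) :
    groundState α x ^ 2 = α ^ 3 / (8 * Real.pi) * Real.exp (-(α * ‖x‖)) := by
  have h1 : (α ^ (3 / 2 : ℝ)) ^ 2 = α ^ 3 := by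
    rw [← Real.rpow_natCast, ← Real.rpow_mul hα.le]
    norm_num
  rw [groundState, mul_pow, div_pow, h1, Real.sq_sqrt (by positivity), ← Real.exp_nat_mul]
  congr 2
  push_cast
  ring

theorem continuous_groundState (α : ℝ) : Continuous (groundState α) := by
  unfold groundState
  fun_prop

theorem integral_groundState_sq {α : ℝ} (hα : 0 < α) : ∫ x, groundState α x ^ 2 = 1 := by
  have h := integral_radial_moment hα 0
  simp only [pow_zero, one_mul] at h
  simp_rw [groundState_sq hα]
  rw [integral_const_mul, h]
  have := Real.pi_ne_zero
  simp [Nat.factorial]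
  field_simp
  norm_num

theorem integral_norm_sq_groundState_sq {α : ℝ} (hα : 0 < α) :
    ∫ x, ‖x‖ ^ 2 * groundState α x ^ 2 = 12 / α ^ 2 := by
  have h := integral_radial_moment hα 2
  simp_rw [groundState_sq hα, mul_left_comm]
  rw [integral_const_mul, h]
  have := Real.pi_ne_zero
  simp [Nat.factorial]
  field_simp
  norm_num

theorem integrable_norm_sq_groundState_sq {α : ℝ} (hα : 0 < α) :
    Integrable fun x : R3 => ‖x‖ ^ 2 * groundState α x ^ 2 := by
  simp_rw [groundState_sq hα, mul_left_comm]
  exact (integrable_radial_moment hα 2).const_mul _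

theorem integrable_groundState_sq {α : ℝ} (hα : 0 < α) :
    Integrable fun x : R3 => groundState α x ^ 2 := by
  simp_rw [groundState_sq hα]
  simpa using (integrable_radial_moment hα 0).const_mul (α ^ 3 / (8 * Real.pi))

theorem toL2_coeFn {f : R3 → ℂ} (h : MemLp f 2 volume) : toL2 f =ᵐ[volume] f := by
  rw [toL2, dif_pos h]
  exact h.coeFn_toLp

theorem norm_toL2_ofReal_sq {F : R3 → ℝ} (h : MemLp (fun x => (F x : ℂ)) 2 volume) :
    ‖toL2 fun x => (F x : ℂ)‖ ^ 2 = ∫ x, F x ^ 2 := by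
  have h4 := inner_toLp_toLp (𝕜 := ℂ) h h
  rw [inner_self_eq_norm_sq_to_K] at h4
  simp only [inner_self_eq_norm_sq_to_K, Complex.coe_algebraMap] at h4
  simp_rw [← Complex.ofReal_pow] at h4
  rw [integral_complex_ofReal] at h4
  have h5 := Complex.ofReal_injective h4
  rw [toL2, dif_pos h, h5]
  simp

/-- The vector `x_j u_α`. -/
def dipole (α : ℝ) (j : Fin 3) : ElectronSpace :=
  toL2 fun x => ((x j * groundState α x : ℝ) : ℂ)

/-- The vector `(x_j / |x|) u_α`. -/
def unitDipole (α : ℝ) (j : Fin 3) : ElectronSpace :=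
  toL2 fun x => ((x j / ‖x‖ * groundState α x : ℝ) : ℂ)

theorem measurable_unit_coord (j : Fin 3) : Measurable fun x : R3 => x j / ‖x‖ := by
  have := (contDiff_coord j (n := 0)).continuous.measurable
  fun_prop

theorem unit_coord_sq_le (x : R3) (j : Fin 3) : (x j / ‖x‖) ^ 2 ≤ 1 := by
  rw [div_pow]
  exact div_le_one_of_le₀ (sq_coord_le x j) (by positivity)

theorem memLp_dipole {α : ℝ} (hα : 0 < α) (j : Fin 3) :
    MemLp (fun x : R3 => ((x j * groundState α x : ℝ) : ℂ)) 2 volume := by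
  have hc : Continuous fun x : R3 => x j * groundState α x :=
    (contDiff_coord j (n := 0)).continuous.mul (continuous_groundState α)
  refine MemLp.ofReal ((memLp_two_iff_integrable_sq hc.aestronglyMeasurable).2 ?_)
  refine (integrable_norm_sq_groundState_sq hα).mono' (hc.pow 2).aestronglyMeasurable
    (Eventually.of_forall fun x => ?_)
  rw [Real.norm_eq_abs, abs_of_nonneg (by positivity), mul_pow]
  exact mul_le_mul_of_nonneg_right (sq_coord_le x j) (by positivity)

theorem memLp_unitDipole {α : ℝ} (hα : 0 < α) (j : Fin 3) :
    MemLp (fun x : R3 => ((x j / ‖x‖ * groundState α x : ℝ) : ℂ)) 2 volume := by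
  have hc : Measurable fun x : R3 => x j / ‖x‖ * groundState α x :=
    (measurable_unit_coord j).mul (continuous_groundState α).measurable
  refine MemLp.ofReal ((memLp_two_iff_integrable_sq hc.aestronglyMeasurable).2 ?_)
  refine (integrable_groundState_sq hα).mono' (hc.pow_const 2).aestronglyMeasurable
    (Eventually.of_forall fun x => ?_)
  rw [Real.norm_eq_abs, abs_of_nonneg (by positivity), mul_pow]
  exact mul_le_of_le_one_left (by positivity) (unit_coord_sq_le x j)

/-- For α = 1 the value 12 matches the prefactor of ℵ, since (π/2)·12 = 6π. The scaling 1/α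
compensates the factor α in ‖P_j u_α‖. -/
theorem sum_norm_dipole_sq {α : ℝ} (hα : 0 < α) : ∑ j, ‖dipole α j‖ ^ 2 = 12 / α ^ 2 := by
  have hi : ∀ j : Fin 3, Integrable fun x : R3 => (x j * groundState α x) ^ 2 := by
    intro j
    have h1 : MemLp (fun x : R3 => x j * groundState α x) 2 volume := by
      simpa using (memLp_dipole hα j).re
    exact h1.integrable_sq
  have h : ∀ j, ‖dipole α j‖ ^ 2 = ∫ x : R3, (x j * groundState α x) ^ 2 :=
    fun j => norm_toL2_ofReal_sq (memLp_dipole hα j)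
  simp_rw [h]
  rw [← integral_finsetSum _ fun j _ => hi j, ← integral_norm_sq_groundState_sq hα]
  simp_rw [mul_pow, ← Finset.sum_mul, ← norm_sq_eq_sum]

theorem norm_dipole_le {α : ℝ} (hα : 0 < α) (j : Fin 3) : ‖dipole α j‖ ≤ √12 / α := by
  have h1 : ‖dipole α j‖ ^ 2 ≤ 12 / α ^ 2 := by
    rw [← sum_norm_dipole_sq hα]
    exact Finset.single_le_sum (f := fun j => ‖dipole α j‖ ^ 2) (fun _ _ => by positivity)
      (Finset.mem_univ j)
  refine le_of_sq_le_sq ?_ (by positivity)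
  rwa [div_pow, Real.sq_sqrt (by norm_num)]

theorem norm_unitDipole_le {α : ℝ} (hα : 0 < α) (j : Fin 3) : ‖unitDipole α j‖ ≤ 1 := by
  refine le_of_sq_le_sq ?_ zero_le_one
  rw [one_pow, unitDipole, norm_toL2_ofReal_sq (memLp_unitDipole hα j),
    ← integral_groundState_sq hα]
  refine integral_mono_of_nonneg (Eventually.of_forall fun x => by positivity)
    (integrable_groundState_sq hα) (Eventually.of_forall fun x => ?_)
  simp only [mul_pow]
  exact mul_le_of_le_one_left (by positivity) (unit_coord_sq_le x j)

theorem hasFDerivAt_groundState {α : ℝ} {x : R3} (hx : x ≠ 0) :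
    HasFDerivAt (groundState α) ((-(α / 2) * groundState α x / ‖x‖) • innerSL ℝ x) x := by
  have h1 : HasFDerivAt (fun x : R3 => ‖x‖ ^ 2) ((2 : ℝ) • innerSL ℝ x) x := by
    have := (hasStrictFDerivAt_norm_sq x).hasFDerivAt
    rwa [← Nat.cast_smul_eq_nsmul ℝ, Nat.cast_ofNat] at this
  have hn : ‖x‖ ≠ 0 := norm_ne_zero_iff.2 hx
  have h2 : HasFDerivAt (fun x : R3 => ‖x‖) (‖x‖⁻¹ • innerSL ℝ x) x := by
    have h3 := h1.sqrt (by positivity)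
    simp only [Real.sqrt_sq (norm_nonneg _)] at h3
    refine h3.congr_fderiv ?_
    rw [smul_smul]
    congr 1
    field_simp
  have h4 := (((h2.const_mul α).mul_const (2 : ℝ)⁻¹).neg.exp).const_mul
    (α ^ (3 / 2 : ℝ) / √(8 * Real.pi))
  have h5 : groundState α = fun x => α ^ (3 / 2 : ℝ) / √(8 * Real.pi) *
      Real.exp (-(α * ‖x‖ * 2⁻¹)) := by
    ext x
    rw [groundState, div_eq_mul_inv (α * ‖x‖)]
  rw [h5]
  refine h4.congr_fderiv ?_
  simp only [smul_smul, ← neg_smul]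
  congr 1
  field_simp
  rfl

theorem momentumGround_eq {α : ℝ} (hα : 0 < α) (j : Fin 3) :
    momentumGround α j = (-((α / 2 : ℝ) : ℂ) * Complex.I) • unitDipole α j := by
  have h1 : (fun x : R3 => Complex.I *
      ((lineDeriv ℝ (groundState α) x (EuclideanSpace.single j (1 : ℝ)) : ℝ) : ℂ)) =ᵐ[volume]
      fun x => (-((α / 2 : ℝ) : ℂ) * Complex.I) * ((x j / ‖x‖ * groundState α x : ℝ) : ℂ) := by
    filter_upwards [ae_ne_zero] with x hx
    rw [((hasFDerivAt_groundState hx).hasLineDerivAt _).lineDeriv]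
    simp only [smul_apply, innerSL_apply_apply, smul_eq_mul]
    rw [show inner ℝ x (EuclideanSpace.single j (1 : ℝ)) = x j from inner_axis x j]
    push_cast
    ring
  have h2 : MemLp (fun x : R3 => (-((α / 2 : ℝ) : ℂ) * Complex.I) *
      ((x j / ‖x‖ * groundState α x : ℝ) : ℂ)) 2 volume := (memLp_unitDipole hα j).const_mul _
  have h3 := h2.ae_eq h1.symm
  refine Lp.ext ?_
  filter_upwards [toL2_coeFn h3, h1, Lp.coeFn_smul (-((α / 2 : ℝ) : ℂ) * Complex.I)
    (unitDipole α j), toL2_coeFn (memLp_unitDipole hα j)] with x hx1 hx2 hx3 hx4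
  rw [momentumGround, hx1, hx2, hx3, Pi.smul_apply, unitDipole, hx4, smul_eq_mul]

theorem norm_momentumGround_le {α : ℝ} (hα : 0 < α) (j : Fin 3) :
    ‖momentumGround α j‖ ≤ α / 2 := by
  rw [momentumGround_eq hα, norm_smul, norm_mul, norm_neg, Complex.norm_I, mul_one,
    Complex.norm_real, Real.norm_eq_abs, abs_of_pos (by positivity)]
  exact mul_le_of_le_one_right (by positivity) (norm_unitDipole_le hα j)

end GroundState

/-! ## The dipole vectors solve `(h_α - e_α) x_j u_α = 2 i P_j u_α` -/

section DipoleEquation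

open scoped LineDeriv

theorem integrable_affine_smul_schwartz (ψ : 𝓢(R3, ℂ)) (a b : ℝ) :
    Integrable fun x => (a + b * ‖x‖) * ‖ψ x‖ := by
  have h0 := ψ.integrable_pow_mul volume 0
  have h1 := ψ.integrable_pow_mul volume 1
  simp only [pow_zero, one_mul, pow_one] at h0 h1
  refine ((h0.const_mul a).add (h1.const_mul b)).congr (Eventually.of_forall fun x => ?_)
  simp only [Pi.add_apply]
  ring

theorem integrable_smul_schwartz {f : R3 → ℝ} (hf : AEStronglyMeasurable f volume) {a b : ℝ}
    (h : ∀ x, |f x| ≤ a + b * ‖x‖) (ψ : 𝓢(R3, ℂ)) : Integrable fun x => f x • ψ x := by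
  refine (integrable_affine_smul_schwartz ψ a b).mono'
    (hf.smul ψ.continuous.aestronglyMeasurable) (Eventually.of_forall fun x => ?_)
  rw [norm_smul, Real.norm_eq_abs]
  gcongr
  exact h x

theorem integral_smul_lineDeriv_schwartz {f f' : R3 → ℝ} {v : R3} (hf : Continuous f)
    (hf' : Continuous f') (hd : ∀ x, HasLineDerivAt ℝ f (f' x) x v) {a b : ℝ}
    (h : ∀ x, |f x| ≤ a + b * ‖x‖) {a' b' : ℝ} (h' : ∀ x, |f' x| ≤ a' + b' * ‖x‖)
    (ψ : 𝓢(R3, ℂ)) : ∫ x, f x • ∂_{v} ψ x = -∫ x, f' x • ψ x := by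
  refine integral_bilinear_hasLineDerivAt_right_eq_neg_left_of_integrable (μ := volume)
    (B := ContinuousLinearMap.lsmul ℝ ℝ) ?_ ?_ ?_ (fun x _ => hd x) fun x _ => ?_
  · exact integrable_smul_schwartz hf'.aestronglyMeasurable h' ψ
  · exact integrable_smul_schwartz hf.aestronglyMeasurable h (∂_{v} ψ)
  · exact integrable_smul_schwartz hf.aestronglyMeasurable h ψ
  · have := (SchwartzMap.hasFDerivAt ψ x).hasLineDerivAt v
    rwa [← SchwartzMap.lineDerivOp_apply_eq_fderiv] at this

variable {β δ : ℝ}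

/-- The regularized modulus `(|x|² + δ²)^{1/2}`. -/
def regNorm (δ : ℝ) (x : R3) : ℝ := √(‖x‖ ^ 2 + δ ^ 2)

theorem regNorm_pos (hδ : 0 < δ) (x : R3) : 0 < regNorm δ x := Real.sqrt_pos.2 (by positivity)

theorem norm_le_regNorm (x : R3) : ‖x‖ ≤ regNorm δ x := Real.le_sqrt_of_sq_le (by nlinarith)

theorem continuous_regNorm : Continuous (regNorm δ) := by
  unfold regNorm
  fun_prop

theorem abs_coord_div_regNorm_le (hδ : 0 < δ) (x : R3) (j : Fin 3) : |x j / regNorm δ x| ≤ 1 := by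
  rw [abs_div, abs_of_pos (regNorm_pos hδ x)]
  exact div_le_one_of_le₀ ((abs_coord_le x j).trans (norm_le_regNorm x)) (regNorm_pos hδ x).le

theorem hasLineDerivAt_coord (x : R3) (i j : Fin 3) :
    HasLineDerivAt ℝ (fun x : R3 => x j) (if j = i then 1 else 0) x (axis i) := by
  have h := (EuclideanSpace.proj j : R3 →L[ℝ] ℝ).hasFDerivAt.hasLineDerivAt (x := x) (axis i)
  simpa [axis] using h

theorem hasLineDerivAt_regNorm (hδ : 0 < δ) (x : R3) (i : Fin 3) :
    HasLineDerivAt ℝ (regNorm δ) (x i / regNorm δ x) x (axis i) := by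
  have h1 : HasFDerivAt (fun x : R3 => ‖x‖ ^ 2) ((2 : ℝ) • innerSL ℝ x) x := by
    have := (hasStrictFDerivAt_norm_sq x).hasFDerivAt
    rwa [← Nat.cast_smul_eq_nsmul ℝ, Nat.cast_ofNat] at this
  have h2 := ((h1.add_const (δ ^ 2)).sqrt (by positivity)).hasLineDerivAt (axis i)
  have h3 : (1 / (2 * √(‖x‖ ^ 2 + δ ^ 2))) • (2 : ℝ) • x i = x i / regNorm δ x := by
    have := (regNorm_pos hδ x).ne'
    rw [regNorm] at this ⊢
    simp only [smul_eq_mul]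
    field_simp
  simp only [smul_apply, innerSL_apply_apply, inner_axis] at h2
  rw [h3] at h2
  exact h2

theorem hasLineDerivAt_exp_regNorm (hδ : 0 < δ) (β : ℝ) (x : R3) (i : Fin 3) :
    HasLineDerivAt ℝ (fun x => Real.exp (-(β * regNorm δ x)))
      (-(β * (x i / regNorm δ x)) * Real.exp (-(β * regNorm δ x))) x (axis i) := by
  have h1 : HasDerivAt (fun t : ℝ => regNorm δ (x + t • axis i)) (x i / regNorm δ x) 0 :=
    hasLineDerivAt_regNorm hδ x i
  have h2 : HasDerivAt (fun t : ℝ => Real.exp (-(β * regNorm δ (x + t • axis i)))) _ 0 :=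
    ((h1.const_mul β).neg).exp
  refine h2.congr_deriv ?_
  simp [mul_comm]

theorem hasLineDerivAt_mul {f g : R3 → ℝ} {f' g' : ℝ} {x v : R3} (hf : HasLineDerivAt ℝ f f' x v)
    (hg : HasLineDerivAt ℝ g g' x v) :
    HasLineDerivAt ℝ (fun x => f x * g x) (f' * g x + f x * g') x v := by
  have hf' : HasDerivAt (fun t : ℝ => f (x + t • v)) f' 0 := hf
  have hg' : HasDerivAt (fun t : ℝ => g (x + t • v)) g' 0 := hg
  have h := hf'.mul hg'
  simp only [zero_smul, add_zero] at h
  exact h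

/-- First derivative `∂_i` of `x_j exp(-β q)`, `q` the regularized modulus. -/
def regDeriv (β δ : ℝ) (i j : Fin 3) (x : R3) : ℝ :=
  ((if j = i then 1 else 0) - β * (x j / regNorm δ x * x i)) * Real.exp (-(β * regNorm δ x))

/-- Second derivative `∂_i²` of `x_j exp(-β q)`, `q` the regularized modulus. -/
def regDerivTwo (β δ : ℝ) (i j : Fin 3) (x : R3) : ℝ :=
  (-(2 * β * ((if j = i then 1 else 0) * (x i / regNorm δ x))) - β * (x j / regNorm δ x)
    + β ^ 2 * (x i / regNorm δ x * (x j / regNorm δ x) * x i)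
    + β * ((x i / regNorm δ x) ^ 2 * (x j / regNorm δ x))) * Real.exp (-(β * regNorm δ x))

theorem hasLineDerivAt_reg (hδ : 0 < δ) (β : ℝ) (x : R3) (i j : Fin 3) :
    HasLineDerivAt ℝ (fun x : R3 => x j * Real.exp (-(β * regNorm δ x)))
      (regDeriv β δ i j x) x (axis i) := by
  convert hasLineDerivAt_mul (hasLineDerivAt_coord x i j) (hasLineDerivAt_exp_regNorm hδ β x i)
    using 1
  rw [regDeriv]
  ring

theorem hasLineDerivAt_inv_regNorm (hδ : 0 < δ) (x : R3) (i : Fin 3) :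
    HasLineDerivAt ℝ (fun x => (regNorm δ x)⁻¹) (-(x i / regNorm δ x) / regNorm δ x ^ 2) x
      (axis i) := by
  have h1 : HasDerivAt (fun t : ℝ => regNorm δ (x + t • axis i)) (x i / regNorm δ x) 0 :=
    hasLineDerivAt_regNorm hδ x i
  have h2 := h1.inv (regNorm_pos hδ _).ne'
  simp only [zero_smul, add_zero] at h2
  exact h2

theorem hasLineDerivAt_regDeriv (hδ : 0 < δ) (β : ℝ) (x : R3) (i j : Fin 3) :
    HasLineDerivAt ℝ (regDeriv β δ i j) (regDerivTwo β δ i j x) x (axis i) := by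
  have h1 := hasLineDerivAt_mul (hasLineDerivAt_mul (hasLineDerivAt_coord x i j)
    (hasLineDerivAt_inv_regNorm hδ x i)) (hasLineDerivAt_coord x i i)
  have h2 : HasLineDerivAt ℝ (fun x : R3 => (if j = i then (1 : ℝ) else 0) -
      β * (x j / regNorm δ x * x i)) _ x (axis i) :=
    HasDerivAt.const_sub _ (HasDerivAt.const_mul β (show HasDerivAt _ _ _ from h1))
  have h3 : HasLineDerivAt ℝ (regDeriv β δ i j) _ x (axis i) :=
    hasLineDerivAt_mul h2 (hasLineDerivAt_exp_regNorm hδ β x i)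
  convert h3 using 1
  have := (regNorm_pos hδ x).ne'
  rw [regDerivTwo]
  simp only [if_true]
  field_simp
  ring

theorem exp_reg_le_one (hβ : 0 ≤ β) (hδ : 0 < δ) (x : R3) :
    Real.exp (-(β * regNorm δ x)) ≤ 1 := by
  rw [Real.exp_le_one_iff]
  have := regNorm_pos hδ x
  have : 0 ≤ β * regNorm δ x := by positivity
  linarith

theorem abs_regDeriv_le (hβ : 0 ≤ β) (hδ : 0 < δ) (i j : Fin 3) (x : R3) :
    |regDeriv β δ i j x| ≤ 1 + β * ‖x‖ := by
  rw [regDeriv, abs_mul, abs_of_pos (Real.exp_pos _)]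
  refine (mul_le_of_le_one_right (abs_nonneg _) (exp_reg_le_one hβ hδ x)).trans ?_
  refine (abs_sub _ _).trans (add_le_add ?_ ?_)
  · split_ifs <;> simp
  · rw [abs_mul, abs_mul, abs_of_nonneg hβ]
    gcongr
    exact (mul_le_of_le_one_left (abs_nonneg _) (abs_coord_div_regNorm_le hδ x j)).trans
      (abs_coord_le x i)

theorem abs_regDerivTwo_le (hβ : 0 ≤ β) (hδ : 0 < δ) (i j : Fin 3) (x : R3) :
    |regDerivTwo β δ i j x| ≤ 4 * β + β ^ 2 * ‖x‖ := by
  rw [regDerivTwo, abs_mul, abs_of_pos (Real.exp_pos _)]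
  refine (mul_le_of_le_one_right (abs_nonneg _) (exp_reg_le_one hβ hδ x)).trans ?_
  have hi := abs_coord_div_regNorm_le hδ x i
  have hj := abs_coord_div_regNorm_le hδ x j
  generalize x i / regNorm δ x = a at *
  generalize x j / regNorm δ x = b at *
  have hx := abs_coord_le x i
  have h1 : |2 * β * ((if j = i then 1 else 0) * a)| ≤ 2 * β := by
    rw [abs_mul, abs_of_nonneg (by positivity : 0 ≤ 2 * β)]
    refine mul_le_of_le_one_right (by positivity) ?_
    split_ifs <;> simp [hi]
  have h2 : |β * b| ≤ β := by
    rw [abs_mul, abs_of_nonneg hβ]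
    exact mul_le_of_le_one_right hβ hj
  have h3 : |β ^ 2 * (a * b * x i)| ≤ β ^ 2 * ‖x‖ := by
    rw [abs_mul, abs_mul, abs_mul, abs_of_nonneg (by positivity : 0 ≤ β ^ 2)]
    gcongr
    exact (mul_le_of_le_one_left (abs_nonneg _) (mul_le_one₀ hi (abs_nonneg _) hj)).trans hx
  have h4 : |β * (a ^ 2 * b)| ≤ β := by
    rw [abs_mul, abs_mul, abs_of_nonneg hβ, abs_pow]
    exact mul_le_of_le_one_right hβ
      (mul_le_one₀ (pow_le_one₀ (abs_nonneg _) hi) (abs_nonneg _) hj)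
  rw [abs_le] at *
  constructor <;> linarith [h1.1, h1.2, h2.1, h2.2, h3.1, h3.2, h4.1, h4.2]

theorem continuous_regDeriv (hδ : 0 < δ) (β : ℝ) (i j : Fin 3) :
    Continuous (regDeriv β δ i j) := by
  have h1 := continuous_regNorm (δ := δ)
  have h2 : ∀ x, regNorm δ x ≠ 0 := fun x => (regNorm_pos hδ x).ne'
  unfold regDeriv
  fun_prop (disch := assumption)

theorem continuous_regDerivTwo (hδ : 0 < δ) (β : ℝ) (i j : Fin 3) :
    Continuous (regDerivTwo β δ i j) := by
  have h1 := continuous_regNorm (δ := δ)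
  have h2 : ∀ x, regNorm δ x ≠ 0 := fun x => (regNorm_pos hδ x).ne'
  unfold regDerivTwo
  fun_prop (disch := assumption)

theorem abs_coord_mul_exp_reg_le (hβ : 0 ≤ β) (hδ : 0 < δ) (j : Fin 3) (x : R3) :
    |x j * Real.exp (-(β * regNorm δ x))| ≤ 0 + 1 * ‖x‖ := by
  rw [abs_mul, abs_of_pos (Real.exp_pos _), zero_add, one_mul]
  exact (mul_le_of_le_one_right (abs_nonneg _) (exp_reg_le_one hβ hδ x)).trans (abs_coord_le x j)

theorem continuous_coord_mul_exp_reg (β : ℝ) (j : Fin 3) :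
    Continuous fun x : R3 => x j * Real.exp (-(β * regNorm δ x)) := by
  have h1 := continuous_regNorm (δ := δ)
  fun_prop

theorem integral_laplacian_reg (hβ : 0 ≤ β) (hδ : 0 < δ) (j : Fin 3) (ψ : 𝓢(R3, ℂ)) :
    ∫ x : R3, (x j * Real.exp (-(β * regNorm δ x))) • Δ ψ x =
      ∫ x, (∑ i, regDerivTwo β δ i j x) • ψ x := by
  rw [schwartz_laplacian_eq_sum]
  have h1 : ∀ x : R3, (x j * Real.exp (-(β * regNorm δ x))) •
      (∑ i, ∂_{axis i} (∂_{axis i} ψ)) x =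
      ∑ i, (x j * Real.exp (-(β * regNorm δ x))) • ∂_{axis i} (∂_{axis i} ψ) x := by
    intro x
    rw [sum_apply, Finset.smul_sum]
  simp_rw [h1, Finset.sum_smul]
  rw [integral_finsetSum _ fun i _ => integrable_smul_schwartz
    (continuous_coord_mul_exp_reg β j).aestronglyMeasurable (abs_coord_mul_exp_reg_le hβ hδ j) _,
    integral_finsetSum _ fun i _ => integrable_smul_schwartz
    (continuous_regDerivTwo hδ β i j).aestronglyMeasurable (abs_regDerivTwo_le hβ hδ i j) _]
  refine Finset.sum_congr rfl fun i _ => ?_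
  rw [integral_smul_lineDeriv_schwartz (continuous_coord_mul_exp_reg β j)
    (continuous_regDeriv hδ β i j) (fun x => hasLineDerivAt_reg hδ β x i j)
    (abs_coord_mul_exp_reg_le hβ hδ j) (abs_regDeriv_le hβ hδ i j),
    integral_smul_lineDeriv_schwartz (continuous_regDeriv hδ β i j)
    (continuous_regDerivTwo hδ β i j) (fun x => hasLineDerivAt_regDeriv hδ β x i j)
    (abs_regDeriv_le hβ hδ i j) (abs_regDerivTwo_le hβ hδ i j), neg_neg]

theorem sum_regDerivTwo (β δ : ℝ) (j : Fin 3) (x : R3) :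
    ∑ i, regDerivTwo β δ i j x = (-(3 * β) + β ^ 2 * (‖x‖ ^ 2 / regNorm δ x)
      + β * (‖x‖ ^ 2 / regNorm δ x ^ 2) - 2 * β) * (x j / regNorm δ x) *
        Real.exp (-(β * regNorm δ x)) := by
  have h1 : ∀ i, regDerivTwo β δ i j x = (if j = i then -(2 * β * (x i / regNorm δ x)) *
      Real.exp (-(β * regNorm δ x)) else 0) +
      (-β * (x j / regNorm δ x) * Real.exp (-(β * regNorm δ x)) +
      x i ^ 2 * ((β ^ 2 / regNorm δ x + β / regNorm δ x ^ 2) * (x j / regNorm δ x) *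
      Real.exp (-(β * regNorm δ x)))) := by
    intro i
    rw [regDerivTwo]
    split_ifs <;> ring
  simp_rw [h1]
  rw [Finset.sum_add_distrib, Finset.sum_ite_eq, if_pos (Finset.mem_univ j),
    Finset.sum_add_distrib, Finset.sum_const, Finset.card_univ, Fintype.card_fin,
    ← Finset.sum_mul, ← norm_sq_eq_sum, nsmul_eq_mul]
  push_cast
  ring

theorem tendsto_regNorm (x : R3) :
    Tendsto (fun n : ℕ => regNorm ((n : ℝ) + 1)⁻¹ x) atTop (𝓝 ‖x‖) := by
  have h2 := (Real.continuous_sqrt.tendsto _).comp (tendsto_inv_nat_sq (‖x‖ ^ 2))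
  rwa [Real.sqrt_sq (norm_nonneg x)] at h2

/-- The Laplacian of `x_j exp(-β |x|)` in the sense of distributions. -/
theorem integral_laplacian_coord_mul_exp (hβ : 0 ≤ β) (j : Fin 3) (ψ : 𝓢(R3, ℂ)) :
    ∫ x : R3, (x j * Real.exp (-(β * ‖x‖))) • Δ ψ x =
      ∫ x : R3, ((β ^ 2 * x j - 4 * β * (x j / ‖x‖)) * Real.exp (-(β * ‖x‖))) • ψ x := by
  have hδ : ∀ n : ℕ, 0 < ((n : ℝ) + 1)⁻¹ := fun n => by positivity
  -- The function x_j exp(-β|x|) is not twice differentiable at the origin, so the two integrations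
  -- by parts are done with |x| replaced by (|x|² + δ²)^{1/2}, and δ = 1/(n+1) tends to 0 under
  -- bounds independent of δ.
  have hL : Tendsto (fun n : ℕ => ∫ x : R3,
      (x j * Real.exp (-(β * regNorm ((n : ℝ) + 1)⁻¹ x))) • Δ ψ x) atTop
      (𝓝 (∫ x : R3, (x j * Real.exp (-(β * ‖x‖))) • Δ ψ x)) := by
    refine tendsto_integral_of_dominated_convergence (fun x => (0 + 1 * ‖x‖) * ‖Δ ψ x‖)
      (fun n => ?_) (integrable_affine_smul_schwartz (Δ ψ) 0 1) (fun n => ?_) ?_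
    · exact ((continuous_coord_mul_exp_reg β j).smul (Δ ψ).continuous).aestronglyMeasurable
    · refine Eventually.of_forall fun x => ?_
      rw [norm_smul, Real.norm_eq_abs]
      exact mul_le_mul_of_nonneg_right (abs_coord_mul_exp_reg_le hβ (hδ n) j x) (norm_nonneg _)
    · refine Eventually.of_forall fun x => ?_
      exact (((Real.continuous_exp.tendsto _).comp
        ((tendsto_regNorm x).const_mul β).neg).const_mul _).smul_const _
  have hR : Tendsto (fun n : ℕ => ∫ x : R3,
      (∑ i, regDerivTwo β ((n : ℝ) + 1)⁻¹ i j x) • ψ x) atTop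
      (𝓝 (∫ x : R3, ((β ^ 2 * x j - 4 * β * (x j / ‖x‖)) * Real.exp (-(β * ‖x‖))) • ψ x)) := by
    refine tendsto_integral_of_dominated_convergence
      (fun x => (12 * β + 3 * β ^ 2 * ‖x‖) * ‖ψ x‖)
      (fun n => ?_) (integrable_affine_smul_schwartz ψ _ _) (fun n => ?_) ?_
    · exact ((continuous_finsetSum _ fun i _ => continuous_regDerivTwo (hδ n) β i j).smul
        ψ.continuous).aestronglyMeasurable
    · refine Eventually.of_forall fun x => ?_
      rw [norm_smul]
      refine mul_le_mul_of_nonneg_right ?_ (norm_nonneg _)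
      refine (norm_sum_le _ _).trans ((Finset.sum_le_sum fun i _ =>
        abs_regDerivTwo_le hβ (hδ n) i j x).trans_eq ?_)
      simp only [Finset.sum_const, Finset.card_univ, Fintype.card_fin, nsmul_eq_mul]
      push_cast
      ring
    · filter_upwards [ae_ne_zero] with x hx
      have hn : ‖x‖ ≠ 0 := norm_ne_zero_iff.2 hx
      simp_rw [sum_regDerivTwo]
      refine Tendsto.smul_const ?_ _
      have hq := tendsto_regNorm x
      have h1 : Tendsto (fun n : ℕ => x j / regNorm ((n : ℝ) + 1)⁻¹ x) atTop (𝓝 (x j / ‖x‖)) :=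
        tendsto_const_nhds.div hq hn
      have h2 : Tendsto (fun n : ℕ => ‖x‖ ^ 2 / regNorm ((n : ℝ) + 1)⁻¹ x) atTop
          (𝓝 (‖x‖ ^ 2 / ‖x‖)) := tendsto_const_nhds.div hq hn
      have h3 : Tendsto (fun n : ℕ => ‖x‖ ^ 2 / regNorm ((n : ℝ) + 1)⁻¹ x ^ 2) atTop
          (𝓝 (‖x‖ ^ 2 / ‖x‖ ^ 2)) := tendsto_const_nhds.div (hq.pow 2) (pow_ne_zero 2 hn)
      have h4 : Tendsto (fun n : ℕ => Real.exp (-(β * regNorm ((n : ℝ) + 1)⁻¹ x))) atTop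
          (𝓝 (Real.exp (-(β * ‖x‖)))) := (Real.continuous_exp.tendsto _).comp (hq.const_mul β).neg
      -- Since |x|²/q² tends to 1 away from the origin, the coefficients -3β + β - 2β add up to the
      -- -4β of the limit.
      have h5 := (((((h2.const_mul (β ^ 2)).const_add (-(3 * β))).add (h3.const_mul β)).sub_const
        (2 * β)).mul h1).mul h4
      convert h5 using 2
      field_simp
      ring
  refine tendsto_nhds_unique hL (hR.congr fun n => ?_)
  rw [integral_laplacian_reg hβ (hδ n)]

theorem dipole_mem_kineticGraph {α : ℝ} (hα : 0 < α) (j : Fin 3) :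
    (dipole α j, (-((α / 2) ^ 2 : ℝ) : ℂ) • dipole α j +
      ((2 * α : ℝ) : ℂ) • unitDipole α j) ∈ kineticGraph := by
  rw [mem_kineticGraph_iff]
  ext ψ
  set N : ℝ := α ^ (3 / 2 : ℝ) / √(8 * Real.pi) with hN
  have hu : ∀ x, groundState α x = N * Real.exp (-(α / 2 * ‖x‖)) := by
    intro x
    rw [groundState, hN]
    congr 3
    ring
  have h := integral_laplacian_coord_mul_exp (β := α / 2) (by positivity) j ψ
  have h1 : (dipole α j : 𝓢'(R3, ℂ)) (Δ ψ) =
      (N : ℂ) * ∫ x : R3, (x j * Real.exp (-(α / 2 * ‖x‖))) • Δ ψ x := by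
    rw [Lp.toTemperedDistribution_apply, ← integral_const_mul]
    refine integral_congr_ae ?_
    filter_upwards [toL2_coeFn (memLp_dipole hα j)] with x hx
    rw [dipole, hx, hu]
    simp only [smul_eq_mul, Complex.real_smul]
    push_cast
    ring
  have h2 : (((-((α / 2) ^ 2 : ℝ) : ℂ) • dipole α j +
      ((2 * α : ℝ) : ℂ) • unitDipole α j : ElectronSpace) : 𝓢'(R3, ℂ)) ψ =
      -((N : ℂ) * ∫ x : R3, (((α / 2) ^ 2 * x j - 4 * (α / 2) * (x j / ‖x‖)) *
        Real.exp (-(α / 2 * ‖x‖))) • ψ x) := by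
    rw [Lp.toTemperedDistribution_apply, ← integral_const_mul, ← integral_neg]
    refine integral_congr_ae ?_
    filter_upwards [toL2_coeFn (memLp_dipole hα j), toL2_coeFn (memLp_unitDipole hα j),
      Lp.coeFn_add ((-((α / 2) ^ 2 : ℝ) : ℂ) • dipole α j) (((2 * α : ℝ) : ℂ) • unitDipole α j),
      Lp.coeFn_smul (-((α / 2) ^ 2 : ℝ) : ℂ) (dipole α j),
      Lp.coeFn_smul ((2 * α : ℝ) : ℂ) (unitDipole α j)] with x hx1 hx2 hx3 hx4 hx5
    rw [hx3, Pi.add_apply, hx4, hx5, Pi.smul_apply, Pi.smul_apply, dipole, unitDipole, hx1, hx2, hu]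
    simp only [smul_eq_mul, Complex.real_smul]
    push_cast
    ring
  rw [h2, ← h, ← h1, neg_apply, TemperedDistribution.laplacian_apply_apply]

theorem dipole_mem_multGraph {α : ℝ} (hα : 0 < α) (j : Fin 3) :
    (dipole α j, (-(α : ℂ)) • unitDipole α j) ∈ multGraph (coulombPot α) := by
  change ∀ᵐ x, ((-(α : ℂ)) • unitDipole α j : ElectronSpace) x = coulombPot α x * dipole α j x
  filter_upwards [toL2_coeFn (memLp_dipole hα j), toL2_coeFn (memLp_unitDipole hα j),
    Lp.coeFn_smul (-(α : ℂ)) (unitDipole α j)] with x hx1 hx2 hx3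
  rw [hx3, Pi.smul_apply, dipole, unitDipole, hx1, hx2, coulombPot]
  simp only [smul_eq_mul]
  push_cast
  ring

/-- Conceptually this is the commutator [-Δ, x_j] = -2∂_j = 2i P_j together with (h_α - e_α) u_α =
0. It is checked explicitly: the terms (α/2)² and α²/4 cancel, and 2α from the Laplacian minus α
from the potential leaves α (x_j/|x|) u_α. -/
theorem dipole_mem_excitation {α : ℝ} (hα : 0 < α) (j : Fin 3) :
    (dipole α j, (2 * Complex.I) • momentumGround α j) ∈ (excitation α).graph := by
  rw [mem_excitation_graph]
  refine ⟨_, _, dipole_mem_kineticGraph hα j, dipole_mem_multGraph hα j, ?_⟩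
  rw [momentumGround_eq hα, smul_smul]
  have h1 : 2 * Complex.I * (-((α / 2 : ℝ) : ℂ) * Complex.I) = (α : ℂ) := by
    push_cast
    linear_combination (-(α : ℂ)) * Complex.I_mul_I
  rw [h1]
  push_cast
  module

end DipoleEquation

/-! ## The functional calculus and the leading term -/

section FunctionalCalculus

variable {E : Type*} [NormedAddCommGroup E] [InnerProductSpace ℂ E] [CompleteSpace E]

theorem re_inner_cfc_nonneg {B : E →L[ℂ] E} {g : ℝ → ℝ}
    (hg : ∀ b ∈ spectrum ℝ B, 0 ≤ g b) (v : E) : 0 ≤ (inner ℂ v (cfc g B v)).re := by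
  have h : 0 ≤ cfc g B := cfc_nonneg hg
  rw [ContinuousLinearMap.nonneg_iff_isPositive] at h
  exact h.re_inner_nonneg_right v

theorem spectrum_subset_Icc {B : E →L[ℂ] E} (hB : IsSelfAdjoint B)
    (hp : ∀ v, 0 ≤ (inner ℂ v (B v)).re) (hn : ‖B‖ ≤ 1) : spectrum ℝ B ⊆ Set.Icc 0 1 := by
  intro b hb
  have h0 : 0 ≤ B := by
    rw [ContinuousLinearMap.nonneg_iff_isPositive, ContinuousLinearMap.isPositive_def]
    refine ⟨hB.isSymmetric, fun v => ?_⟩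
    rw [ContinuousLinearMap.reApplyInnerSelf, ← inner_re_symm]
    exact hp v
  refine ⟨spectrum_nonneg_of_nonneg h0 hb, ?_⟩
  have h1 := spectrum.norm_le_norm_mul_of_mem hb
  have h2 : ‖(1 : E →L[ℂ] E)‖ ≤ 1 := ContinuousLinearMap.norm_id_le
  have h3 : ‖B‖ * ‖(1 : E →L[ℂ] E)‖ ≤ 1 := mul_le_one₀ hn (norm_nonneg _) h2
  exact (le_abs_self b).trans (h1.trans h3)

/-- The function `b ↦ arctan (1 / (s t))`, `t = 1 / b - 1`. -/
def arctanRecipInv (s b : ℝ) : ℝ := if b = 0 then 0 else arctanRecip s (b⁻¹ - 1)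

theorem arctanRecip_eq {s t : ℝ} (hs : 0 < s) (ht : 0 ≤ t) :
    arctanRecip s t = Real.pi / 2 - Real.arctan (s * t) := by
  rw [arctanRecip]
  split_ifs with h
  · simp [h]
  · have : 0 < t := lt_of_le_of_ne ht (Ne.symm h)
    rw [one_div, Real.arctan_inv_of_pos (by positivity)]

theorem arctanRecipInv_eq {s b : ℝ} (hs : 0 < s) (hb : 0 < b) (hb1 : b ≤ 1) :
    arctanRecipInv s b = Real.pi / 2 - Real.arctan (s * (b⁻¹ - 1)) := by
  rw [arctanRecipInv, if_neg hb.ne', arctanRecip_eq hs]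
  have := (one_le_inv₀ hb).2 hb1
  linarith

theorem arctanRecipInv_eq_arctan {s b : ℝ} (hb : b ≠ 1) :
    arctanRecipInv s b = Real.arctan (b / (s * (1 - b))) := by
  rw [arctanRecipInv]
  split_ifs with h
  · simp [h]
  · have h2 : b⁻¹ - 1 ≠ 0 := by
      rw [sub_ne_zero]
      intro h3
      exact hb (inv_eq_one.1 h3)
    rw [arctanRecip, if_neg h2]
    congr 1
    have h4 : b⁻¹ - 1 = (1 - b) / b := by field_simp
    rw [h4, one_div, ← mul_div_assoc, inv_div]

/-- Two formulas cover the interval: π/2 - arctan(s(1/b - 1)) near b = 1, the image of t = 0, and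
arctan(b/(s(1 - b))) elsewhere, including b = 0, the image of t = ∞. -/
theorem continuousOn_arctanRecipInv {s : ℝ} (hs : 0 < s) :
    ContinuousOn (arctanRecipInv s) (Set.Icc 0 1) := by
  intro b hb
  rcases eq_or_ne b 1 with h1 | h1
  · have hc : ContinuousAt (fun b : ℝ => Real.pi / 2 - Real.arctan (s * (b⁻¹ - 1))) b := by
      have h0 : b ≠ 0 := by rw [h1]; exact one_ne_zero
      exact continuousAt_const.sub (Real.continuous_arctan.continuousAt.comp
        (continuousAt_const.mul ((continuousAt_inv₀ h0).sub continuousAt_const)))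
    refine hc.continuousWithinAt.congr_of_eventuallyEq ?_
      (arctanRecipInv_eq hs (by rw [h1]; exact one_pos) hb.2)
    filter_upwards [self_mem_nhdsWithin, mem_nhdsWithin_of_mem_nhds
      (lt_mem_nhds (show 0 < b by rw [h1]; exact one_pos))] with x hx hx'
    exact arctanRecipInv_eq hs hx' hx.2
  · have hc : ContinuousAt (fun b : ℝ => Real.arctan (b / (s * (1 - b)))) b := by
      have h0 : s * (1 - b) ≠ 0 := mul_ne_zero hs.ne' (sub_ne_zero.2 h1.symm)
      have : ContinuousAt (fun b : ℝ => b / (s * (1 - b))) b := by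
        fun_prop (disch := assumption)
      exact Real.continuous_arctan.continuousAt.comp this
    refine (hc.congr ?_).continuousWithinAt
    filter_upwards [isOpen_ne.mem_nhds h1] with x hx
    exact (arctanRecipInv_eq_arctan hx).symm

theorem arctan_le_self {x : ℝ} (hx : 0 ≤ x) : Real.arctan x ≤ x := by
  by_cases h : x < Real.pi / 2
  · calc Real.arctan x ≤ Real.arctan (Real.tan x) :=
          Real.arctan_strictMono.monotone (Real.le_tan hx h)
      _ = x := Real.arctan_tan (by linarith [Real.pi_pos]) h
  · exact (Real.arctan_lt_pi_div_two x).le.trans (not_lt.1 h)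

/-- This is 0 ≤ arctan(st) ≤ st in the variable b = 1/(t + 1). Multiplication by b clears the
denominator in t = (1 - b)/b, so that the inequality also makes sense at b = 0 and both sides are
bounded. -/
theorem arctanRecipInv_bounds {s b : ℝ} (hs : 0 < s) (hb : b ∈ Set.Icc (0 : ℝ) 1) :
    0 ≤ Real.pi / 2 - arctanRecipInv s b ∧
      b * (Real.pi / 2 - arctanRecipInv s b) ≤ s * (1 - b) := by
  rcases hb.1.eq_or_lt with h | h
  · rw [← h, arctanRecipInv, if_pos rfl]
    constructor
    · linarith [Real.pi_pos]
    · simp [hs.le]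
  · rw [arctanRecipInv_eq hs h hb.2, sub_sub_cancel]
    have h1 := (one_le_inv₀ h).2 hb.2
    have h2 : 0 ≤ s * (b⁻¹ - 1) := mul_nonneg hs.le (by linarith)
    refine ⟨Real.arctan_nonneg.2 h2, ?_⟩
    calc b * Real.arctan (s * (b⁻¹ - 1)) ≤ b * (s * (b⁻¹ - 1)) := by
          gcongr
          exact arctan_le_self h2
      _ = s * (1 - b) := by field_simp

theorem NonnegSelfAdj.isSelfAdjoint_resolv {T : E →ₗ.[ℂ] E} (hT : NonnegSelfAdj T) {r : ℝ}
    (hr : 0 < r) : IsSelfAdjoint (resolv T r) := by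
  rw [ContinuousLinearMap.isSelfAdjoint_iff_isSymmetric]
  exact fun v w => hT.inner_resolv hr v w

/-- The operator inequality `0 ≤ π / 2 - arctan (1 / (s T)) ≤ s T`. -/
theorem NonnegSelfAdj.arctanRecip_bounds {T : E →ₗ.[ℂ] E} (hT : NonnegSelfAdj T) {s : ℝ}
    (hs : 0 < s) {d d' : E} (hd : (d, d') ∈ T.graph) :
    0 ≤ Real.pi / 2 * ‖d‖ ^ 2 - (inner ℂ d (funCalc T (arctanRecip s) d)).re ∧
      Real.pi / 2 * ‖d‖ ^ 2 - (inner ℂ d (funCalc T (arctanRecip s) d)).re ≤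
        s * (inner ℂ d d').re := by
  set B := resolv T 1 with hBdef
  have hB : IsSelfAdjoint B := hT.isSelfAdjoint_resolv one_pos
  have hspec : spectrum ℝ B ⊆ Set.Icc 0 1 :=
    spectrum_subset_Icc hB (hT.inner_resolv_nonneg one_pos) (by simpa using hT.norm_resolv_le one_pos)
  have hF : ContinuousOn (arctanRecipInv s) (spectrum ℝ B) :=
    (continuousOn_arctanRecipInv hs).mono hspec
  set P := funCalc T (arctanRecip s) with hPdef
  have hP : P = cfc (arctanRecipInv s) B := rfl
  have hQ : cfc (fun b => Real.pi / 2 - arctanRecipInv s b) B =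
      algebraMap ℝ (E →L[ℂ] E) (Real.pi / 2) - P := by
    rw [cfc_sub (fun _ => Real.pi / 2) (arctanRecipInv s) B continuousOn_const hF,
      cfc_const (Real.pi / 2) B hB, hP]
  have hQv : ∀ v, (inner ℂ v (cfc (fun b => Real.pi / 2 - arctanRecipInv s b) B v)).re =
      Real.pi / 2 * ‖v‖ ^ 2 - (inner ℂ v (P v)).re := by
    intro v
    rw [hQ, Algebra.algebraMap_eq_smul_one]
    have h1 : ((Real.pi / 2 : ℝ) • (1 : E →L[ℂ] E) - P) v = ((Real.pi / 2 : ℝ) : ℂ) • v - P v := by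
      rw [Complex.coe_smul]; rfl
    rw [h1, inner_sub_right, inner_smul_right, inner_self_eq_norm_sq_to_K, Complex.sub_re]
    congr 1
    simp only [Complex.coe_algebraMap]
    norm_cast
  rw [← hQv]
  refine ⟨re_inner_cfc_nonneg (fun b hb => (arctanRecipInv_bounds hs (hspec hb)).1) d, ?_⟩
  have hdB : B (d' + d) = d := by
    rw [hT.resolv_eq_iff one_pos, mem_graph_shift]
    simpa using hd
  -- A further factor b symmetrizes the inequality. Taken in the state d + d', where B(d + d') = d,
  -- the two outer factors B produce the form of π/2 - arctan(1/(sT)) at d, while B(1 - B) produces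
  -- ⟨d, d'⟩, because (1 - B)(d + d') = d'.
  have key := re_inner_cfc_nonneg (B := B)
    (g := fun b => s * (b * (1 - b)) - b * ((Real.pi / 2 - arctanRecipInv s b) * b))
    (fun b hb => by
      have h1 := (arctanRecipInv_bounds hs (hspec hb)).2
      have h2 := (hspec hb).1
      nlinarith [mul_le_mul_of_nonneg_left h1 h2]) (d' + d)
  have hc1 : ContinuousOn (fun b : ℝ => Real.pi / 2 - arctanRecipInv s b) (spectrum ℝ B) :=
    continuousOn_const.sub hF
  have hc2 : ContinuousOn (fun b : ℝ => (Real.pi / 2 - arctanRecipInv s b) * b) (spectrum ℝ B) :=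
    hc1.mul continuousOn_id
  have hc3 : ContinuousOn (fun b : ℝ => b * ((Real.pi / 2 - arctanRecipInv s b) * b))
    (spectrum ℝ B) := continuousOn_id.mul hc2
  have hop : cfc (fun b => s * (b * (1 - b)) - b * ((Real.pi / 2 - arctanRecipInv s b) * b)) B =
      s • (B * (1 - B)) - B * (cfc (fun b => Real.pi / 2 - arctanRecipInv s b) B * B) := by
    rw [cfc_sub (fun b => s * (b * (1 - b))) _ B (by fun_prop) hc3,
      cfc_const_mul s (fun b : ℝ => b * (1 - b)) B (by fun_prop),
      cfc_mul (fun b : ℝ => b) (fun b : ℝ => 1 - b) B (by fun_prop) (by fun_prop),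
      cfc_sub (fun _ : ℝ => 1) (fun b : ℝ => b) B (by fun_prop) (by fun_prop),
      cfc_mul (fun b : ℝ => b) _ B (by fun_prop) hc2,
      cfc_mul _ (fun b : ℝ => b) B hc1 (by fun_prop), cfc_id' ℝ B, cfc_const_one ℝ B]
  rw [hop] at key
  have h3 : (s • (B * (1 - B)) - B * (cfc (fun b => Real.pi / 2 - arctanRecipInv s b) B * B))
      (d' + d) = (s : ℂ) • B d' - B (cfc (fun b => Real.pi / 2 - arctanRecipInv s b) B d) := by
    have h4 : (s • (B * (1 - B)) - B * (cfc (fun b => Real.pi / 2 - arctanRecipInv s b) B * B))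
      (d' + d) = s • B ((d' + d) - B (d' + d)) -
        B (cfc (fun b => Real.pi / 2 - arctanRecipInv s b) B (B (d' + d))) := rfl
    rw [h4, hdB, add_sub_cancel_right, Complex.coe_smul]
  rw [h3, inner_sub_right, inner_smul_right, ← hT.inner_resolv one_pos, ← hT.inner_resolv one_pos,
    ← hBdef, hdB, Complex.sub_re, Complex.re_ofReal_mul] at key
  linarith

end FunctionalCalculus

/-- The difference equals α²/(6πL³) times the sum over j of the expectations of π/2 - arctan(1/(sT))
in x_j u_1, with s = αL and T = h_1 - e_1. Each lies between 0 and s ⟨x_j u_1 | T | x_j u_1⟩ ≤ 4s,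
using T x_j u_1 = 2i P_j u_1. -/
theorem leading_term_bound {α L : ℝ} (hα : 0 < α) (hL : 0 < L) :
    |α ^ 2 / L ^ 3 - aleph α L * (α / L ^ 4)| ≤ 3 * (α ^ 3 / L ^ 2) := by
  have hs : 0 < α * L := by positivity
  set q : Fin 3 → ℝ := fun j => (inner ℂ (dipole 1 j)
    (funCalc (excitation 1) (arctanRecip (α * L)) (dipole 1 j))).re with hq
  have hb : ∀ j, 0 ≤ Real.pi / 2 * ‖dipole 1 j‖ ^ 2 - q j ∧
      Real.pi / 2 * ‖dipole 1 j‖ ^ 2 - q j ≤ α * L * 4 := by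
    intro j
    have h := (nonnegSelfAdj_excitation zero_le_one).arctanRecip_bounds hs
      (dipole_mem_excitation one_pos j)
    refine ⟨h.1, h.2.trans ?_⟩
    gcongr
    refine (Complex.re_le_norm _).trans ((norm_inner_le_norm _ _).trans ?_)
    rw [norm_smul, norm_mul, Complex.norm_I]
    have h1 := norm_dipole_le one_pos j
    have h2 := norm_momentumGround_le one_pos j
    have h3 : √12 ≤ 4 := by
      rw [Real.sqrt_le_left (by norm_num)]
      norm_num
    calc ‖dipole 1 j‖ * (‖(2 : ℂ)‖ * 1 * ‖momentumGround 1 j‖) ≤ 4 * (2 * 1 * (1 / 2)) := by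
          gcongr
          · linarith
          · simp
      _ = 4 := by norm_num
  have hal : aleph α L = 1 / (6 * Real.pi) * (α * L * ∑ j, q j) := by
    rw [aleph]
    congr 1
    rw [Finset.mul_sum]
    refine Finset.sum_congr rfl fun j _ => ?_
    rw [inner_smul_right, Complex.re_ofReal_mul]
    rfl
  have hsum : ∑ j, (Real.pi / 2 * ‖dipole 1 j‖ ^ 2 - q j) = 6 * Real.pi - ∑ j, q j := by
    rw [Finset.sum_sub_distrib, ← Finset.mul_sum, sum_norm_dipole_sq one_pos]
    ring
  have hpi := Real.pi_pos
  have heq : α ^ 2 / L ^ 3 - aleph α L * (α / L ^ 4) =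
      α ^ 2 / (6 * Real.pi * L ^ 3) * ∑ j, (Real.pi / 2 * ‖dipole 1 j‖ ^ 2 - q j) := by
    rw [hsum, hal]
    field_simp
  have h0 : 0 ≤ ∑ j, (Real.pi / 2 * ‖dipole 1 j‖ ^ 2 - q j) :=
    Finset.sum_nonneg fun j _ => (hb j).1
  have h1 : ∑ j, (Real.pi / 2 * ‖dipole 1 j‖ ^ 2 - q j) ≤ 12 * (α * L) := by
    refine (Finset.sum_le_sum fun j _ => (hb j).2).trans_eq ?_
    simp only [Finset.sum_const, Finset.card_univ, Fintype.card_fin, nsmul_eq_mul]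
    push_cast
    ring
  rw [heq, abs_of_nonneg (by positivity)]
  calc α ^ 2 / (6 * Real.pi * L ^ 3) * ∑ j, (Real.pi / 2 * ‖dipole 1 j‖ ^ 2 - q j)
      ≤ α ^ 2 / (6 * 1 * L ^ 3) * (12 * (α * L)) := by
        gcongr
        linarith [Real.pi_gt_three]
    _ = 2 * (α ^ 3 / L ^ 2) := by field_simp; norm_num
    _ ≤ _ := by
        have : 0 ≤ α ^ 3 / L ^ 2 := by positivity
        linarith

/-! ## One electron and one photon: solving for `Φ_#` -/

theorem injective_pairOp {α : ℝ} (hα : 0 ≤ α) {μ : Measure R3} (hμ : ∀ᵐ k ∂μ, k ≠ 0) :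
    Function.Injective (pairOp α μ) := by
  intro x y hxy
  have hx : ((x : PairSpace μ), pairOp α μ x) ∈ pairGraph α μ := by
    rw [← pairOp_graph]; exact (pairOp α μ).mem_graph x
  have hy : ((y : PairSpace μ), pairOp α μ y) ∈ pairGraph α μ := by
    rw [← pairOp_graph]; exact (pairOp α μ).mem_graph y
  rw [hxy] at hx
  have hx' : ∀ᵐ k ∂μ, ∀ γ : Fin 2, ((x : PairSpace μ) k γ, (pairOp α μ y) k γ) ∈
    (shift (excitation α) ‖k‖).graph := hx
  have hy' : ∀ᵐ k ∂μ, ∀ γ : Fin 2, ((y : PairSpace μ) k γ, (pairOp α μ y) k γ) ∈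
    (shift (excitation α) ‖k‖).graph := hy
  apply Subtype.ext
  apply Lp.ext
  filter_upwards [hμ, hx', hy'] with k hk h1 h2
  ext1 γ
  exact (nonnegSelfAdj_excitation hα).toNonnegSymm.unique (norm_pos_iff.2 hk) (h1 γ) (h2 γ)

theorem tensorFiber_apply (f : ElectronSpace) (g : EuclideanSpace ℂ (Fin 2)) (γ : Fin 2) :
    tensorFiber f g γ = g γ • f := rfl

theorem norm_tensorFiber (f : ElectronSpace) (g : EuclideanSpace ℂ (Fin 2)) :
    ‖tensorFiber f g‖ = ‖f‖ * ‖g‖ := by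
  rw [PiLp.norm_eq_of_L2, EuclideanSpace.norm_eq, ← Real.sqrt_sq (norm_nonneg f),
    ← Real.sqrt_mul (sq_nonneg _), Finset.mul_sum]
  congr 1
  refine Finset.sum_congr rfl fun γ _ => ?_
  rw [tensorFiber_apply, norm_smul, mul_pow, mul_comm]

theorem continuous_tensorFiber :
    Continuous fun q : ElectronSpace × EuclideanSpace ℂ (Fin 2) => tensorFiber q.1 q.2 := by
  refine (PiLp.continuous_toLp 2 _).comp (continuous_pi fun γ => ?_)
  have : Continuous fun q : ElectronSpace × EuclideanSpace ℂ (Fin 2) => q.2 γ • q.1 := by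
    fun_prop
  exact this

theorem aestronglyMeasurable_tensorFiber_prod {μ : Measure R3}
    {f : R3 → ElectronSpace × EuclideanSpace ℂ (Fin 2)} (hf : AEStronglyMeasurable f μ) :
    AEStronglyMeasurable (fun k => tensorFiber (f k).1 (f k).2) μ :=
  Continuous.comp_aestronglyMeasurable
    (g := fun q : ElectronSpace × EuclideanSpace ℂ (Fin 2) => tensorFiber q.1 q.2)
    continuous_tensorFiber hf

theorem aestronglyMeasurable_tensorFiber {μ : Measure R3} {f : R3 → ElectronSpace}
    {g : R3 → EuclideanSpace ℂ (Fin 2)} (hf : AEStronglyMeasurable f μ)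
    (hg : AEStronglyMeasurable g μ) :
    AEStronglyMeasurable (fun k => tensorFiber (f k) (g k)) μ :=
  aestronglyMeasurable_tensorFiber_prod (f := fun k => (f k, g k)) (hf.prodMk hg)

theorem norm_resolv_momentumGround_le {α r : ℝ} (hα : 0 < α) (hr : 0 < r) (j : Fin 3) :
    ‖resolv (excitation α) r (momentumGround α j)‖ ≤ ‖dipole α j‖ := by
  have h := (nonnegSelfAdj_excitation hα.le).norm_resolv_image_le hr (dipole_mem_excitation hα j)
  rw [map_smul, norm_smul, norm_mul, Complex.norm_I, Complex.norm_two] at h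
  linarith

/-- No infrared condition on g beyond square integrability is needed: the fibre resolvents applied
to P_j u_α are bounded by ‖x_j u_α‖ uniformly in k ≠ 0, instead of by a multiple of 1/|k|. -/
theorem memLp_resolv_tensorFiber {α : ℝ} (hα : 0 < α) {μ : Measure R3} (hμ : ∀ᵐ k ∂μ, k ≠ 0)
    {g : R3 → EuclideanSpace ℂ (Fin 2)} (hg : MemLp g 2 μ) (j : Fin 3) :
    MemLp (fun k => tensorFiber (resolv (excitation α) ‖k‖ (momentumGround α j)) (g k)) 2 μ := by
  have hT := nonnegSelfAdj_excitation hα.le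
  have hm : AEStronglyMeasurable
      (fun k : R3 => resolv (excitation α) ‖k‖ (momentumGround α j)) μ := by
    have hc : ContinuousOn (fun k : R3 => resolv (excitation α) ‖k‖ (momentumGround α j))
        {k | k ≠ 0} :=
      (hT.continuousOn_resolv (momentumGround α j)).comp continuous_norm.continuousOn
        fun k hk => norm_pos_iff.2 hk
    have h := hc.aestronglyMeasurable (μ := μ) isOpen_ne.measurableSet
    rwa [Measure.restrict_eq_self_of_ae_mem (s := {k : R3 | k ≠ 0}) hμ] at h
  have hm2 : AEStronglyMeasurable
      (fun k => tensorFiber (resolv (excitation α) ‖k‖ (momentumGround α j)) (g k)) μ :=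
    aestronglyMeasurable_tensorFiber hm hg.aestronglyMeasurable
  refine MemLp.of_le_mul (c := ‖dipole α j‖) hg hm2 ?_
  filter_upwards [hμ] with k hk
  rw [norm_tensorFiber]
  exact mul_le_mul_of_nonneg_right
    (norm_resolv_momentumGround_le hα (norm_pos_iff.2 hk) j) (norm_nonneg _)

/-- The vector `Φ_#`, given by the resolvents `(h_α - e_α + |k|)⁻¹` in the fibres. -/
theorem exists_phi {α : ℝ} (hα : 0 < α) {μ : Measure R3} (hμ : ∀ᵐ k ∂μ, k ≠ 0)
    (lam : PiLp 2 (fun _ : Fin 3 => PhotonSpace μ)) :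
    ∃ Φ : PairSpace μ, (Φ, source α lam) ∈ (pairOp α μ).graph ∧
      (∀ᵐ k ∂μ, Φ k = ((2 * √α : ℝ) : ℂ) • ∑ j,
        tensorFiber (resolv (excitation α) ‖k‖ (momentumGround α j)) (lam j k)) ∧
      ∀ᵐ k ∂μ, source α lam k = ((2 * √α : ℝ) : ℂ) • ∑ j,
        tensorFiber (momentumGround α j) (lam j k) := by
  have hT := nonnegSelfAdj_excitation hα.le
  have hsum : MemLp (fun k => ((2 * √α : ℝ) : ℂ) • ∑ j,
      tensorFiber (resolv (excitation α) ‖k‖ (momentumGround α j)) (lam j k)) 2 μ := by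
    have h1 : MemLp (fun k => ∑ j,
        tensorFiber (resolv (excitation α) ‖k‖ (momentumGround α j)) (lam j k)) 2 μ :=
      memLp_finsetSum _ fun j _ => memLp_resolv_tensorFiber hα hμ (Lp.memLp (lam j)) j
    exact h1.const_smul ((2 * √α : ℝ) : ℂ)
  have hs : ∀ᵐ k ∂μ, source α lam k = ((2 * √α : ℝ) : ℂ) • ∑ j,
        tensorFiber (momentumGround α j) (lam j k) := by
    have h1 : ∀ j, ∀ᵐ k ∂μ, tensor (momentumGround α j) (lam j) k =
        tensorFiber (momentumGround α j) (lam j k) := fun j =>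
      ContinuousLinearMap.coeFn_compLp _ _
    filter_upwards [ae_all_iff.2 h1, Lp.coeFn_smul ((2 * √α : ℝ) : ℂ)
      (∑ j : Fin 3, tensor (momentumGround α j) (lam j)),
      Lp.coeFn_finsetSum Finset.univ fun j : Fin 3 => tensor (momentumGround α j) (lam j)]
      with k h1 h2 h3
    rw [source, h2, Pi.smul_apply, h3]
    simp only [Finset.sum_apply, h1]
  refine ⟨hsum.toLp _, ?_, hsum.coeFn_toLp, hs⟩
  rw [pairOp_graph]
  change ∀ᵐ k ∂μ, ∀ γ : Fin 2, (_, _) ∈ (shift (excitation α) ‖k‖).graph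
  filter_upwards [hμ, hsum.coeFn_toLp, hs] with k hk h1 h2 γ
  simp only
  rw [h1, h2]
  have h3 := Submodule.smul_mem _ ((2 * √α : ℝ) : ℂ) (Submodule.sum_mem
    (shift (excitation α) ‖k‖).graph (t := Finset.univ) fun j _ =>
      Submodule.smul_mem _ (lam j k γ) (hT.resolv_mem (norm_pos_iff.2 hk) (momentumGround α j)))
  convert h3 using 1
  ext1
  · simp [Prod.fst_sum, tensorFiber_apply]
  · simp [Prod.snd_sum, tensorFiber_apply]

theorem phiWellDefined {α : ℝ} (hα : 0 < α) {μ : Measure R3} (hμ : ∀ᵐ k ∂μ, k ≠ 0)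
    (lam : PiLp 2 (fun _ : Fin 3 => PhotonSpace μ)) : PhiWellDefined α lam := by
  obtain ⟨Φ, h, -⟩ := exists_phi hα hμ lam
  refine ⟨injective_pairOp hα.le hμ, ?_⟩
  rw [LinearPMap.mem_graph_iff] at h
  obtain ⟨x, -, hx⟩ := h
  exact ⟨x, hx⟩

theorem invApply_eq {E : Type*} [NormedAddCommGroup E] [InnerProductSpace ℂ E]
    {T : E →ₗ.[ℂ] E} (hT : Function.Injective T) {v w : E} (h : (w, v) ∈ T.graph) :
    invApply T v = w := by
  have hker : LinearMap.ker T.toFun = ⊥ := LinearMap.ker_eq_bot.2 hT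
  rw [LinearPMap.mem_graph_iff] at h
  obtain ⟨x, hx, hv⟩ := h
  have hd : v ∈ T.inverse.domain := by
    rw [LinearPMap.inverse_domain]
    exact ⟨x, hv⟩
  have hx : (x : E) = w := hx
  rw [invApply, dif_pos hd, ← hx]
  exact LinearPMap.inverse_apply_eq hker (y := ⟨v, hd⟩) hv

theorem quadForm_eq {E : Type*} [NormedAddCommGroup E] [InnerProductSpace ℂ E]
    {T : E →ₗ.[ℂ] E} {v w : E} (h : (w, v) ∈ T.graph) :
    quadForm T w = (inner ℂ w v).re := by
  rw [LinearPMap.mem_graph_iff] at h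
  obtain ⟨x, rfl, rfl⟩ := h
  rw [quadForm, dif_pos x.2]

theorem inner_tensorFiber (f f' : ElectronSpace) (g g' : EuclideanSpace ℂ (Fin 2)) :
    inner ℂ (tensorFiber f g) (tensorFiber f' g') = inner ℂ g g' * inner ℂ f f' := by
  rw [PiLp.inner_apply, PiLp.inner_apply, Finset.sum_mul]
  refine Finset.sum_congr rfl fun γ _ => ?_
  rw [tensorFiber_apply, tensorFiber_apply, inner_smul_left, inner_smul_right, RCLike.inner_apply]
  ring

/-- `‖Φ_#‖_#² = 4 α ∑_{i,j} ∫ ⟨λ^i(k), λ^j(k)⟩ ⟨(h_α - e_α + |k|)⁻¹ P_i u_α, P_j u_α⟩ dk`. -/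
theorem sharpNormSq_phiSharp {α : ℝ} (hα : 0 < α) {μ : Measure R3} (hμ : ∀ᵐ k ∂μ, k ≠ 0)
    (lam : PiLp 2 (fun _ : Fin 3 => PhotonSpace μ)) :
    sharpNormSq α (phiSharp α lam) = ∫ k, 4 * α * ∑ i, ∑ j, (inner ℂ (lam i k) (lam j k) *
      inner ℂ (resolv (excitation α) ‖k‖ (momentumGround α i)) (momentumGround α j)).re ∂μ := by
  obtain ⟨Φ, h, h1, h2⟩ := exists_phi hα hμ lam
  rw [phiSharp, invApply_eq (injective_pairOp hα.le hμ) h, sharpNormSq, quadForm_eq h, L2.inner_def]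
  refine (integral_re (L2.integrable_inner (𝕜 := ℂ) Φ (source α lam))).symm.trans ?_
  refine integral_congr_ae ?_
  filter_upwards [h1, h2] with k h1 h2
  rw [h1, h2, inner_smul_left, inner_smul_right, sum_inner, Complex.conj_ofReal, ← mul_assoc,
    ← Complex.ofReal_mul]
  have h3 : 2 * √α * (2 * √α) = 4 * α := by
    have := Real.mul_self_sqrt hα.le
    linear_combination 4 * this
  rw [h3]
  refine (Complex.re_ofReal_mul _ _).trans ?_
  rw [Complex.re_sum]
  congr 1
  refine Finset.sum_congr rfl fun i _ => ?_
  rw [inner_sum, Complex.re_sum]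
  exact Finset.sum_congr rfl fun j _ => congrArg Complex.re (inner_tensorFiber _ _ _ _)

/-! ## Reduction to integrals over the photon momentum -/

/-- The matrix element `⟨(h_α - e_α + r)⁻¹ P_i u_α, P_j u_α⟩` for `r > 0`. -/
def resolvForm (α : ℝ) (i j : Fin 3) : ℝ → ℝ :=
  (Set.Ioi 0).indicator fun r =>
    (inner ℂ (resolv (excitation α) r (momentumGround α i)) (momentumGround α j)).re

theorem resolvForm_of_pos (α : ℝ) (i j : Fin 3) {r : ℝ} (hr : 0 < r) :
    resolvForm α i j r =
      (inner ℂ (resolv (excitation α) r (momentumGround α i)) (momentumGround α j)).re :=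
  Set.indicator_of_mem hr _

theorem measurable_resolvForm {α : ℝ} (hα : 0 < α) (i j : Fin 3) :
    Measurable (resolvForm α i j) := by
  have hT := nonnegSelfAdj_excitation hα.le
  have hc : ContinuousOn (fun r =>
      (inner ℂ (resolv (excitation α) r (momentumGround α i)) (momentumGround α j)).re)
      (Set.Ioi 0) := by
    have h1 := hT.continuousOn_resolv (momentumGround α i)
    exact Complex.continuous_re.comp_continuousOn (continuous_inner.comp_continuousOn
      (h1.prodMk (continuousOn_const (c := momentumGround α j))))
  classical
  rw [resolvForm, ← Set.piecewise_eq_indicator]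
  exact hc.measurable_piecewise continuousOn_const measurableSet_Ioi

/-- The powers of α cancel: at most √12/α from ‖x_i u_α‖ and α/2 from ‖P_j u_α‖. A bound independent
of α and r is essential for the final constant. -/
theorem abs_resolvForm_le {α : ℝ} (hα : 0 < α) (i j : Fin 3) (r : ℝ) :
    |resolvForm α i j r| ≤ 2 := by
  by_cases hr : 0 < r
  · rw [resolvForm_of_pos α i j hr]
    refine (Complex.abs_re_le_norm _).trans ((norm_inner_le_norm _ _).trans ?_)
    have h1 := (norm_resolv_momentumGround_le hα hr i).trans (norm_dipole_le hα i)
    have h2 := norm_momentumGround_le hα j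
    have h3 : √12 ≤ 4 := by
      rw [Real.sqrt_le_left (by norm_num)]
      norm_num
    calc _ ≤ √12 / α * (α / 2) := by gcongr
      _ = √12 / 2 := by field_simp
      _ ≤ 2 := by linarith
  · rw [resolvForm, Set.indicator_of_notMem (by simpa using hr), abs_zero]
    exact zero_le_two

/-- The sum over the polarizations, as the projection orthogonal to the momentum. -/
theorem Polarization.sum_mul (p : Polarization) (i j : Fin 3) :
    ∀ᵐ k : R3, ∑ γ, p.e γ k i * p.e γ k j = (if i = j then 1 else 0) - k i * k j / ‖k‖ ^ 2 := by
  filter_upwards [p.orthonormal] with k hk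
  have hcard : Fintype.card (Fin 3) = Module.finrank ℝ R3 := by simp
  have hspan := hk.linearIndependent.span_eq_top_of_card_eq_finrank' hcard
  -- Parseval's identity for the basis k/|k|, e_0, e_1, applied to two coordinate vectors; the
  -- contribution of k/|k| is then moved to the other side.
  have h := (OrthonormalBasis.mk hk hspan.ge).sum_inner_mul_inner (axis i) (axis j)
  simp only [OrthonormalBasis.coe_mk, Fin.sum_univ_three, Matrix.cons_val_zero,
    Matrix.cons_val_one, Matrix.cons_val_two, Matrix.head_cons, Matrix.tail_cons] at h
  have e1 : ∀ (i : Fin 3) (v : R3), inner ℝ (axis i) v = v i := fun i v => by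
    rw [real_inner_comm]; exact inner_axis v i
  have e2 : ∀ (i : Fin 3) (v : R3), inner ℝ v (axis i) = v i := fun i v => inner_axis v i
  have e3 : (axis j) i = if i = j then (1 : ℝ) else 0 := by simp [axis]
  rw [e1, e1, e1, e1, e2, e2, e2, e3] at h
  rw [Fin.sum_univ_two]
  simp only [PiLp.smul_apply, smul_eq_mul] at h
  have h4 : k i * k j / ‖k‖ ^ 2 = ‖k‖⁻¹ * k i * (‖k‖⁻¹ * k j) := by
    rw [div_eq_mul_inv, ← inv_pow]; ring
  rw [h4]
  linarith

/-- The density `χ(|k|/Λ)² / (2 π² |k|) (δ_ij - k_i k_j / |k|²) q(|k|)`. -/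
def photonKernel (c : Cutoff) (Λ : ℝ) (i j : Fin 3) (q : ℝ → ℝ) (k : R3) : ℝ :=
  couplingFactor c Λ k ^ 2 * ((if i = j then 1 else 0) - k i * k j / ‖k‖ ^ 2) * q ‖k‖

theorem integrable_mul_photonKernel (c : Cutoff) {Λ : ℝ} (hΛ : 0 < Λ) (i j : Fin 3) {q : ℝ → ℝ}
    (hq : Measurable q) {M : ℝ} (hM : ∀ r, |q r| ≤ M) {m : R3 → ℝ} (hm : Measurable m) {b : ℝ}
    (hb : ∀ k, |m k| ≤ b) :
    Integrable (fun k => m k * photonKernel c Λ i j q k) := by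
  have h0 : Integrable (fun k => couplingFactor c Λ k ^ 2) :=
    (memLp_two_iff_integrable_sq (measurable_couplingFactor c Λ).aestronglyMeasurable).1
      (memLp_couplingFactor c hΛ)
  have hmeas := measurable_couplingFactor c Λ
  refine (h0.const_mul (b * (2 * M))).mono' ?_ (Eventually.of_forall fun k => ?_)
  · unfold photonKernel
    have : Measurable fun k : R3 => q ‖k‖ := hq.comp measurable_norm
    exact Measurable.aestronglyMeasurable (by fun_prop)
  · have h1 : |(if i = j then 1 else 0) - k i * k j / ‖k‖ ^ 2| ≤ 2 := by
      have h2 : |(if i = j then (1 : ℝ) else 0)| ≤ 1 := by split_ifs <;> simp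
      have h3 : |k i * k j / ‖k‖ ^ 2| ≤ 1 := by
        rw [abs_div, abs_mul, abs_of_nonneg (sq_nonneg ‖k‖), sq]
        exact div_le_one_of_le₀ (mul_le_mul (abs_coord_le k i) (abs_coord_le k j) (abs_nonneg _)
          (norm_nonneg _)) (by positivity)
      linarith [abs_sub (if i = j then (1 : ℝ) else 0) (k i * k j / ‖k‖ ^ 2)]
    have hb0 : 0 ≤ b := (abs_nonneg _).trans (hb k)
    rw [photonKernel, Real.norm_eq_abs, abs_mul, abs_mul, abs_mul,
      abs_of_nonneg (sq_nonneg (couplingFactor c Λ k))]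
    calc |m k| * (couplingFactor c Λ k ^ 2 * |(if i = j then 1 else 0) - k i * k j / ‖k‖ ^ 2| *
          |q ‖k‖|) ≤ b * (couplingFactor c Λ k ^ 2 * 2 * M) := by
          gcongr
          · exact hb k
          · exact hM _
      _ = _ := by ring

variable {μ : Measure R3}

theorem inner_couplingFun (c : Cutoff) (Λ : ℝ) (p : Polarization) (w : Fin 3 → R3 → ℝ)
    (i j : Fin 3) : ∀ᵐ k : R3, inner ℂ (couplingFun c Λ p (w i) i k) (couplingFun c Λ p (w j) j k) =
      ((w i k * w j k * photonKernel c Λ i j (fun _ => 1) k : ℝ) : ℂ) := by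
  filter_upwards [p.sum_mul i j] with k hk
  rw [photonKernel, ← hk, PiLp.inner_apply]
  simp only [couplingFun, RCLike.inner_apply, Complex.conj_ofReal, ← Complex.ofReal_mul,
    ← Complex.ofReal_sum, Finset.mul_sum]
  congr 1
  rw [Finset.sum_mul, Finset.mul_sum]
  exact Finset.sum_congr rfl fun γ _ => by ring

theorem sharpNormSq_eq_integral (c : Cutoff) {Λ : ℝ} (hΛ : 0 < Λ) (p : Polarization) {α : ℝ}
    (hα : 0 < α) (hμ : μ ≤ volume) {w : Fin 3 → R3 → ℝ} (hw : ∀ j, Measurable (w j)) {b : ℝ}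
    (hb : ∀ j k, |w j k| ≤ b) {lam : PiLp 2 (fun _ : Fin 3 => PhotonSpace μ)}
    (hlam : ∀ j, lam j =ᵐ[μ] couplingFun c Λ p (w j) j) :
    sharpNormSq α (phiSharp α lam) = 4 * α * ∑ i, ∑ j,
      ∫ k, w i k * w j k * photonKernel c Λ i j (resolvForm α i j) k ∂μ := by
  have hac : ∀ {P : R3 → Prop}, (∀ᵐ k : R3, P k) → ∀ᵐ k ∂μ, P k := fun h =>
    (Measure.absolutelyContinuous_of_le hμ).ae_le h
  rw [sharpNormSq_phiSharp hα (hac ae_ne_zero)]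
  have hb0 : 0 ≤ b := (abs_nonneg _).trans (hb 0 0)
  have hint : ∀ i j, Integrable
      (fun k => w i k * w j k * photonKernel c Λ i j (resolvForm α i j) k) μ := fun i j =>
    (integrable_mul_photonKernel c hΛ i j (measurable_resolvForm hα i j)
      (abs_resolvForm_le hα i j) (m := fun k => w i k * w j k) ((hw i).mul (hw j)) (b := b * b)
      (fun k => by rw [abs_mul]; exact mul_le_mul (hb i k) (hb j k) (abs_nonneg _) hb0)).mono_measure
      hμ
  have h0 : ∀ i, ∑ j, ∫ k, w i k * w j k * photonKernel c Λ i j (resolvForm α i j) k ∂μ =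
      ∫ k, ∑ j, w i k * w j k * photonKernel c Λ i j (resolvForm α i j) k ∂μ := fun i =>
    (integral_finsetSum _ fun j _ => hint i j).symm
  simp only [h0]
  rw [← integral_finsetSum _ fun i _ => integrable_finsetSum _ fun j _ => hint i j,
    ← integral_const_mul]
  refine integral_congr_ae ?_
  filter_upwards [ae_all_iff.2 hlam, hac ae_ne_zero,
    hac (ae_all_iff.2 fun i => ae_all_iff.2 fun j => inner_couplingFun c Λ p w i j)] with k h1 h2 h3
  simp only [h1, h3, Complex.re_ofReal_mul]
  congr 1
  refine Finset.sum_congr rfl fun i _ => Finset.sum_congr rfl fun j _ => ?_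
  rw [photonKernel, photonKernel, resolvForm_of_pos α i j (norm_pos_iff.2 h2)]
  ring

theorem norm_sq_eq_integral (c : Cutoff) {Λ : ℝ} (p : Polarization)
    (hμ : μ ≤ volume) {w : Fin 3 → R3 → ℝ} {lam : PiLp 2 (fun _ : Fin 3 => PhotonSpace μ)}
    (hlam : ∀ j, lam j =ᵐ[μ] couplingFun c Λ p (w j) j) :
    ‖lam‖ ^ 2 = ∑ j, ∫ k, w j k * w j k * photonKernel c Λ j j (fun _ => 1) k ∂μ := by
  have hac : ∀ {P : R3 → Prop}, (∀ᵐ k : R3, P k) → ∀ᵐ k ∂μ, P k := fun h =>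
    (Measure.absolutelyContinuous_of_le hμ).ae_le h
  rw [PiLp.norm_sq_eq_of_L2]
  refine Finset.sum_congr rfl fun j _ => ?_
  have h1 : ((‖lam j‖ ^ 2 : ℝ) : ℂ) = inner ℂ (lam j) (lam j) := by
    rw [inner_self_eq_norm_sq_to_K]; norm_cast
  have h2 : inner ℂ (lam j) (lam j) =
      ((∫ k, w j k * w j k * photonKernel c Λ j j (fun _ => 1) k ∂μ : ℝ) : ℂ) := by
    rw [L2.inner_def]
    refine Eq.trans ?_ integral_ofReal
    refine integral_congr_ae ?_
    filter_upwards [hlam j, hac (inner_couplingFun c Λ p w j j)] with k h1 h2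
    rw [h1, h2]
    rfl
  exact_mod_cast h1.trans h2

/-! ## Reflections of the photon momentum -/

/-- The reflection of the coordinate `m`. -/
def reflect (m : Fin 3) : R3 ≃ₗᵢ[ℝ] R3 :=
  LinearIsometryEquiv.piLpCongrRight 2 fun i : Fin 3 =>
    if i = m then LinearIsometryEquiv.neg ℝ else LinearIsometryEquiv.refl ℝ ℝ

theorem reflect_apply (m i : Fin 3) (k : R3) : reflect m k i = if i = m then -k i else k i := by
  rw [reflect, LinearIsometryEquiv.piLpCongrRight_apply]
  simp only
  split_ifs <;> rfl

theorem integral_reflect (m : Fin 3) (f : R3 → ℝ) : ∫ k, f (reflect m k) = ∫ k, f k :=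
  (reflect m).measurePreserving.integral_comp (reflect m).toHomeomorph.measurableEmbedding f

theorem integral_eq_zero_of_reflect (m : Fin 3) {f : R3 → ℝ}
    (hf : ∀ k, f (reflect m k) = -f k) : ∫ k, f k = 0 := by
  have h := integral_reflect m f
  simp only [hf] at h
  rw [integral_neg] at h
  linarith

theorem measurableSet_halfSpace : MeasurableSet {k : R3 | 0 < k 0} :=
  measurableSet_lt measurable_const (by fun_prop)

theorem ae_coord_ne_zero : ∀ᵐ k : R3, k 0 ≠ 0 := by
  have h := Measure.addHaar_submodule (volume : Measure R3)
    (LinearMap.ker (EuclideanSpace.proj (𝕜 := ℝ) (0 : Fin 3)).toLinearMap) (by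
      intro h
      have h1 : axis 0 ∈ LinearMap.ker (EuclideanSpace.proj (𝕜 := ℝ) (0 : Fin 3)).toLinearMap := by
        rw [h]; trivial
      have h2 : (axis 0 : R3) 0 = 0 := h1
      simp [axis] at h2)
  rw [ae_iff]
  convert h using 2
  ext k
  simp

theorem integral_halfMeasure {f : R3 → ℝ} (hi : Integrable f)
    (hf : ∀ k, f (reflect 0 k) = f k) : ∫ k, f k ∂halfMeasure = 1 / 2 * ∫ k, f k := by
  have h1 := integral_add_compl measurableSet_halfSpace hi
  have h2 : ∫ k in {k : R3 | 0 < k 0}ᶜ, f k = ∫ k in {k : R3 | 0 < k 0}, f k := by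
    rw [← integral_indicator measurableSet_halfSpace,
      ← integral_indicator measurableSet_halfSpace.compl, ← integral_reflect 0]
    refine integral_congr_ae ?_
    filter_upwards [ae_coord_ne_zero] with k hk
    have h3 : reflect 0 k 0 = -k 0 := by rw [reflect_apply, if_pos rfl]
    by_cases h4 : 0 < k 0
    · rw [Set.indicator_of_mem, Set.indicator_of_mem (show k ∈ {k : R3 | 0 < k 0} from h4), hf]
      change ¬ (0 < reflect 0 k 0)
      rw [h3]
      linarith
    · rw [Set.indicator_of_notMem, Set.indicator_of_notMem (show k ∉ {k : R3 | 0 < k 0} from h4)]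
      rw [Set.notMem_compl_iff]
      change 0 < reflect 0 k 0
      rw [h3]
      have := lt_of_le_of_ne (not_lt.1 h4) hk
      linarith
  rw [h2] at h1
  linarith

theorem photonKernel_reflect (c : Cutoff) (Λ : ℝ) (i j m : Fin 3) (q : ℝ → ℝ) (k : R3) :
    photonKernel c Λ i j q (reflect m k) =
      (if i ≠ j ∧ (i = m ∨ j = m) then -1 else 1) * photonKernel c Λ i j q k := by
  unfold photonKernel couplingFactor
  rw [(reflect m).norm_map, reflect_apply, reflect_apply]
  by_cases hij : i = j
  · subst hij
    by_cases him : i = m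
    · simp [him]
    · simp [him]
  · by_cases him : i = m
    · have hjm : j ≠ m := fun h => hij (him.trans h.symm)
      rw [if_neg hij, if_pos him, if_neg hjm,
        if_pos (show i ≠ j ∧ (i = m ∨ j = m) from ⟨hij, Or.inl him⟩)]
      ring
    · by_cases hjm : j = m
      · rw [if_neg hij, if_neg him, if_pos hjm,
          if_pos (show i ≠ j ∧ (i = m ∨ j = m) from ⟨hij, Or.inr hjm⟩)]
        ring
      · rw [if_neg him, if_neg hjm,
          if_neg (show ¬(i ≠ j ∧ (i = m ∨ j = m)) from fun h => h.2.elim him hjm), one_mul]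

theorem wallProfile_reflect {m : Fin 3} (hm : m ≠ 0) (y : ℝ) (j : Fin 3) (k : R3) :
    wallProfile y j (reflect m k) = wallProfile y j k := by
  rw [wallProfile, wallProfile, reflect_apply, if_neg hm.symm]

theorem exists_ne_zero_of_ne {i j : Fin 3} (h : i ≠ j) : ∃ m, m ≠ 0 ∧ (i = m ∨ j = m) := by
  by_cases hi : i = 0
  · exact ⟨j, fun hj => h (hi.trans hj.symm), Or.inr rfl⟩
  · exact ⟨i, hi, Or.inl rfl⟩

theorem integral_photonKernel_offDiag (c : Cutoff) (Λ : ℝ) {i j : Fin 3} (hij : i ≠ j)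
    (q : ℝ → ℝ) : ∫ k, (1 : ℝ) * 1 * photonKernel c Λ i j q k = 0 := by
  refine integral_eq_zero_of_reflect i fun k => ?_
  rw [photonKernel_reflect, if_pos ⟨hij, Or.inl rfl⟩]
  ring

/-- Of two distinct indices at least one is tangential to the wall. Reflecting that coordinate
preserves the half space and the profiles, which depend on k₁ only, and changes the sign of k_i k_j.
-/
theorem integral_photonKernel_wall_offDiag (c : Cutoff) (Λ : ℝ) {i j : Fin 3} (hij : i ≠ j)
    (q : ℝ → ℝ) (y : ℝ) :
    ∫ k, wallProfile y i k * wallProfile y j k * photonKernel c Λ i j q k ∂halfMeasure = 0 := by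
  obtain ⟨m, hm, h⟩ := exists_ne_zero_of_ne hij
  rw [← integral_indicator measurableSet_halfSpace]
  refine integral_eq_zero_of_reflect m fun k => ?_
  have h1 : reflect m k 0 = k 0 := by rw [reflect_apply, if_neg hm.symm]
  by_cases h2 : 0 < k 0
  · rw [Set.indicator_of_mem (show k ∈ {k : R3 | 0 < k 0} from h2), Set.indicator_of_mem
      (show reflect m k ∈ {k : R3 | 0 < k 0} by rw [Set.mem_ofPred_eq, h1]; exact h2), photonKernel_reflect,
      if_pos ⟨hij, h⟩, wallProfile_reflect hm, wallProfile_reflect hm]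
    ring
  · rw [Set.indicator_of_notMem (show k ∉ {k : R3 | 0 < k 0} from h2), Set.indicator_of_notMem
      (show reflect m k ∉ {k : R3 | 0 < k 0} from fun h3 => h2 (h1 ▸ (show 0 < reflect m k 0 from h3))), neg_zero]

/-- The oscillatory integral left over after the subtraction of the free contribution. -/
def oscIntegral (c : Cutoff) (Λ y : ℝ) (j : Fin 3) (q : ℝ → ℝ) : ℝ :=
  ∫ k, Real.cos (2 * y * k 0) * photonKernel c Λ j j q k

theorem wallProfile_sq (y : ℝ) (j : Fin 3) (k : R3) : wallProfile y j k * wallProfile y j k =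
    2 * (1 + (if j = 0 then 1 else -1) * Real.cos (2 * y * k 0)) := by
  have h : Real.cos (2 * y * k 0) = 2 * Real.cos (k 0 * y) ^ 2 - 1 := by
    rw [← Real.cos_two_mul]; ring_nf
  rw [wallProfile, h]
  split_ifs
  · ring
  · linear_combination (4 : ℝ) * Real.sin_sq_add_cos_sq (k 0 * y)

/-- The squared profile is 2(1 ± cos(2 y k₁)), and the integrand is even in k₁, so the factor 2
compensates the restriction to half of the space. The constant 1 gives the free contribution. -/
theorem integral_photonKernel_wall_diag (c : Cutoff) {Λ : ℝ} (hΛ : 0 < Λ) (j : Fin 3) {q : ℝ → ℝ}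
    (hq : Measurable q) {M : ℝ} (hM : ∀ r, |q r| ≤ M) (y : ℝ) :
    ∫ k, wallProfile y j k * wallProfile y j k * photonKernel c Λ j j q k ∂halfMeasure =
      (∫ k, (1 : ℝ) * 1 * photonKernel c Λ j j q k) +
        (if j = 0 then 1 else -1) * oscIntegral c Λ y j q := by
  have hw := measurable_wallProfile y j
  rw [integral_halfMeasure, oscIntegral, ← integral_const_mul, ← integral_const_mul,
    ← integral_add]
  · refine integral_congr_ae (Eventually.of_forall fun k => ?_)
    simp only
    rw [wallProfile_sq]
    ring
  · exact integrable_mul_photonKernel c hΛ j j hq hM (m := fun _ => 1 * 1) measurable_const (b := 1)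
      (by simp)
  · exact (integrable_mul_photonKernel c hΛ j j hq hM (m := fun k => Real.cos (2 * y * k 0))
      (by fun_prop) (b := 1) (fun k => Real.abs_cos_le_one _)).const_mul _
  · refine integrable_mul_photonKernel c hΛ j j hq hM
      (m := fun k => wallProfile y j k * wallProfile y j k) (hw.mul hw) (b := 2 * 2) fun k => ?_
    rw [abs_mul]
    exact mul_le_mul (abs_wallProfile_le y j k) (abs_wallProfile_le y j k) (abs_nonneg _)
      zero_le_two
  · intro k
    rw [photonKernel_reflect, if_neg (fun h => h.1 rfl), wallProfile_sq, wallProfile_sq,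
      reflect_apply, if_pos rfl, mul_neg, Real.cos_neg]
    ring

/-- The free contributions cancel both in the coupling norms and in the sharp norms, leaving only
oscillatory integrals. The choice of polarization vectors has disappeared. -/
theorem normDifference_eq (c : Cutoff) {Λ : ℝ} (hΛ : 0 < Λ) (p : Polarization) {α : ℝ}
    (hα : 0 < α) (y : ℝ) : normDifference c hΛ p α y =
      α * ∑ j, (if j = 0 then 1 else -1) *
        (oscIntegral c Λ y j (fun _ => 1) - 4 * oscIntegral c Λ y j (resolvForm α j j)) := by
  have hinf : ∀ j, lambdaInf c hΛ p j =ᵐ[fullMeasure] couplingFun c Λ p (fun _ => 1) j :=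
    fun j => (memLp_couplingFun c hΛ p (w := fun _ => 1) (by fun_prop) (b := 1)
      (by simp) j).coeFn_toLp
  have hwall : ∀ j, lambdaWall c hΛ p y j =ᵐ[halfMeasure] couplingFun c Λ p (wallProfile y j) j :=
    fun j => ((memLp_couplingFun c hΛ p (measurable_wallProfile y j) (abs_wallProfile_le y j)
      j).mono_measure Measure.restrict_le_self).coeFn_toLp
  have hle : halfMeasure ≤ volume := Measure.restrict_le_self
  have hs : ∀ {f : Fin 3 → Fin 3 → ℝ}, (∀ i j, i ≠ j → f i j = 0) →
      ∑ i, ∑ j, f i j = ∑ j, f j j := fun hf => Finset.sum_congr rfl fun i _ =>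
    Finset.sum_eq_single i (fun j _ hj => hf i j hj.symm) (by simp)
  rw [normDifference, norm_sq_eq_integral c p hle hwall,
    norm_sq_eq_integral c p le_rfl (w := fun _ _ => 1) hinf,
    sharpNormSq_eq_integral c hΛ p hα le_rfl (w := fun _ _ => 1) (fun _ => measurable_const)
      (b := 1) (by simp) hinf,
    sharpNormSq_eq_integral c hΛ p hα hle (measurable_wallProfile y) (abs_wallProfile_le y) hwall,
    hs (fun i j hij => integral_photonKernel_offDiag c Λ hij _),
    hs (fun i j hij => integral_photonKernel_wall_offDiag c Λ hij _ y)]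
  simp only [integral_photonKernel_wall_diag c hΛ _ (q := fun _ => 1) measurable_const
      (M := 1) (by simp) y,
    integral_photonKernel_wall_diag c hΛ _ (measurable_resolvForm hα _ _)
      (abs_resolvForm_le hα _ _) y, Finset.sum_add_distrib, mul_sub, Finset.sum_sub_distrib]
  have h4 : ∀ j : Fin 3, (if j = 0 then (1 : ℝ) else -1) *
      (4 * oscIntegral c Λ y j (resolvForm α j j)) =
      4 * ((if j = 0 then (1 : ℝ) else -1) * oscIntegral c Λ y j (resolvForm α j j)) := fun j => by
    ring
  simp only [h4, ← Finset.mul_sum]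
  ring

/-! ## Integrals of functions of `|k|` and `k₁` -/

/-- The decomposition of a momentum into its first coordinate and the transversal part. -/
def splitCoord : R3 ≃ᵐ ℝ × EuclideanSpace ℝ (Fin 2) :=
  ((MeasurableEquiv.toLp 2 (Fin 3 → ℝ)).symm.trans
    (MeasurableEquiv.piFinSuccAbove (fun _ : Fin 3 => ℝ) 0)).trans
    ((MeasurableEquiv.refl ℝ).prodCongr (MeasurableEquiv.toLp 2 (Fin 2 → ℝ)))

theorem measurePreserving_splitCoord : MeasurePreserving splitCoord := by
  have h1 := (EuclideanSpace.volume_preserving_symm_measurableEquiv_toLp (Fin 3)).trans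
    (volume_preserving_piFinSuccAbove (fun _ : Fin 3 => ℝ) 0)
  exact h1.trans ((MeasurePreserving.id (volume : Measure ℝ)).prod
    (EuclideanSpace.volume_preserving_symm_measurableEquiv_toLp (Fin 2)).symm)

theorem splitCoord_fst (k : R3) : (splitCoord k).1 = k 0 := rfl

theorem norm_eq_sqrt_splitCoord (k : R3) :
    ‖k‖ = √((splitCoord k).1 ^ 2 + ‖(splitCoord k).2‖ ^ 2) := by
  have h2 : ∀ i : Fin 2, (splitCoord k).2 i = k i.succ := fun i => rfl
  rw [EuclideanSpace.real_norm_sq_eq, EuclideanSpace.norm_eq, Fin.sum_univ_succ, splitCoord_fst]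
  simp only [h2, Real.norm_eq_abs, sq_abs]

theorem integral_radial_R2 (f : ℝ → ℝ) :
    ∫ x : EuclideanSpace ℝ (Fin 2), f ‖x‖ = 2 * Real.pi * ∫ t in Set.Ioi (0 : ℝ), t * f t := by
  have h := integral_fun_norm_addHaar (volume : Measure (EuclideanSpace ℝ (Fin 2))) f
  have hd : Module.finrank ℝ (EuclideanSpace ℝ (Fin 2)) = 2 := by simp
  have hv : (volume : Measure (EuclideanSpace ℝ (Fin 2))).real (Metric.ball 0 1) = Real.pi := by
    rw [measureReal_def, EuclideanSpace.volume_ball_fin_two]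
    simp [Real.pi_pos.le]
  rw [h, hd, hv]
  simp only [smul_eq_mul, nsmul_eq_mul]
  norm_num
  ring

theorem image_sqrt_add_sq (s : ℝ) :
    (fun t : ℝ => √(s ^ 2 + t ^ 2)) '' Set.Ioi 0 = Set.Ioi |s| := by
  ext r
  constructor
  · rintro ⟨t, ht, rfl⟩
    have ht : 0 < t := ht
    refine Real.lt_sqrt_of_sq_lt ?_
    rw [sq_abs]
    have : 0 < t ^ 2 := by positivity
    linarith
  · intro hr
    have hr : |s| < r := hr
    have h1 : s ^ 2 < r ^ 2 := by
      rw [← sq_abs]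
      exact pow_lt_pow_left₀ hr (abs_nonneg s) two_ne_zero
    refine ⟨√(r ^ 2 - s ^ 2), Real.sqrt_pos.2 (by linarith), ?_⟩
    simp only
    rw [Real.sq_sqrt (by linarith), add_sub_cancel, Real.sqrt_sq ((abs_nonneg s).trans hr.le)]

theorem integral_Ioi_sqrt_add_sq (s : ℝ) (f : ℝ → ℝ) :
    ∫ t in Set.Ioi (0 : ℝ), t * f √(s ^ 2 + t ^ 2) = ∫ r in Set.Ioi |s|, r * f r := by
  have hpos : ∀ t ∈ Set.Ioi (0 : ℝ), 0 < s ^ 2 + t ^ 2 := fun t ht => by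
    have ht : 0 < t := ht
    positivity
  have hd : ∀ t ∈ Set.Ioi (0 : ℝ), HasDerivWithinAt (fun t : ℝ => √(s ^ 2 + t ^ 2))
      (t / √(s ^ 2 + t ^ 2)) (Set.Ioi 0) t := by
    intro t ht
    have h1 : HasDerivAt (fun t : ℝ => s ^ 2 + t ^ 2) (2 * t) t := by
      simpa using (hasDerivAt_pow 2 t).const_add (s ^ 2)
    refine ((h1.sqrt (hpos t ht).ne').congr_deriv ?_).hasDerivWithinAt
    rw [mul_div_mul_left _ _ two_ne_zero]
  have hinj : Set.InjOn (fun t : ℝ => √(s ^ 2 + t ^ 2)) (Set.Ioi 0) := by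
    intro t ht u hu h
    have h1 := (Real.sqrt_inj (hpos t ht).le (hpos u hu).le).1 h
    have h2 : t ^ 2 = u ^ 2 := by linarith
    exact (pow_left_inj₀ (le_of_lt ht) (le_of_lt hu) two_ne_zero).1 h2
  rw [← image_sqrt_add_sq, integral_image_eq_integral_abs_deriv_smul measurableSet_Ioi hd hinj]
  refine setIntegral_congr_fun measurableSet_Ioi fun t ht => ?_
  have h1 : 0 < √(s ^ 2 + t ^ 2) := Real.sqrt_pos.2 (hpos t ht)
  have h2 : (0 : ℝ) < t := ht
  simp only [smul_eq_mul]
  rw [abs_of_pos (div_pos h2 h1)]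
  field_simp

/-- The integral of a function of `|k|` and `k₁` (by Archimedes' theorem on the sphere and the
cylinder). -/
theorem integral_norm_coord {G : ℝ → ℝ → ℝ} (hG : Measurable (Function.uncurry G)) {C R : ℝ}
    (hC : ∀ r s, |s| < r → |r * G r s| ≤ C) (hR : ∀ r s, R < r → G r s = 0)
    (hi : Integrable fun k : R3 => G ‖k‖ (k 0)) :
    ∫ k : R3, G ‖k‖ (k 0) =
      2 * Real.pi * ∫ r in Set.Ioi (0 : ℝ), r * ∫ s in Set.Ioo (-r) r, G r s := by
  set D : Set (ℝ × ℝ) := {z | |z.1| < z.2} with hD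
  have hDm : MeasurableSet D := measurableSet_lt (by fun_prop) (by fun_prop)
  set F : ℝ × ℝ → ℝ := D.indicator fun z => z.2 * G z.2 z.1 with hF
  have hFm : Measurable F := by
    refine Measurable.indicator ?_ hDm
    exact measurable_snd.mul (hG.comp (measurable_snd.prodMk measurable_fst))
  have hC0 : 0 ≤ C := (abs_nonneg _).trans (hC 1 0 (by simp))
  -- The hypotheses bound F by C on the rectangle [-R, R] × [0, R] and make it vanish outside, which
  -- justifies the exchange of the s and r integrals.
  have hFi : Integrable F (volume.prod volume) := by
    have hB : Integrable ((Set.Icc (-R) R ×ˢ Set.Icc 0 R).indicator fun _ : ℝ × ℝ => C)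
        (volume.prod volume) := by
      refine (integrable_indicator_iff (measurableSet_Icc.prod measurableSet_Icc)).2 ?_
      refine integrableOn_const ?_
      rw [Measure.prod_prod]
      exact (ENNReal.mul_lt_top (by simp) (by simp)).ne
    refine hB.mono' hFm.aestronglyMeasurable (Eventually.of_forall fun z => ?_)
    by_cases hz : z ∈ D
    · have hz' : |z.1| < z.2 := hz
      rw [hF, Set.indicator_of_mem hz]
      by_cases hzR : z.2 ≤ R
      · rw [Set.indicator_of_mem]
        · exact hC _ _ hz'
        · have := abs_lt.1 hz'
          have h0 := (abs_nonneg _).trans_lt hz'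
          exact ⟨⟨by linarith, by linarith⟩, h0.le, hzR⟩
      · rw [hR _ _ (not_le.1 hzR), mul_zero, norm_zero, Set.indicator_of_notMem]
        exact fun h => hzR h.2.2
    · rw [hF, Set.indicator_of_notMem hz, norm_zero]
      exact Set.indicator_nonneg (fun _ _ => hC0) z
  set H : ℝ × EuclideanSpace ℝ (Fin 2) → ℝ := fun z => G √(z.1 ^ 2 + ‖z.2‖ ^ 2) z.1 with hH
  have hsplit : (fun k : R3 => G ‖k‖ (k 0)) = H ∘ splitCoord := by
    funext k
    change _ = G √((splitCoord k).1 ^ 2 + ‖(splitCoord k).2‖ ^ 2) (splitCoord k).1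
    rw [← norm_eq_sqrt_splitCoord, splitCoord_fst]
  rw [hsplit] at hi ⊢
  have hi' := (measurePreserving_splitCoord.integrable_comp_emb
    splitCoord.measurableEmbedding).1 hi
  have hint := measurePreserving_splitCoord.integral_comp splitCoord.measurableEmbedding H
  refine hint.trans ?_
  rw [Measure.volume_eq_prod, integral_prod _ hi']
  -- Polar coordinates in the transversal plane, followed by the substitution r² = s² + t² with t dt
  -- = r dr, which turns t > 0 into r > |s|.
  have h1 : ∀ s : ℝ, ∫ v : EuclideanSpace ℝ (Fin 2), H (s, v) =
      2 * Real.pi * ∫ r, F (s, r) := by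
    intro s
    change ∫ v : EuclideanSpace ℝ (Fin 2), G √(s ^ 2 + ‖v‖ ^ 2) s = _
    rw [integral_radial_R2 fun t => G √(s ^ 2 + t ^ 2) s,
      integral_Ioi_sqrt_add_sq s fun r => G r s, ← integral_indicator measurableSet_Ioi]
    rfl
  simp only [h1]
  rw [integral_const_mul, integral_integral_swap (f := fun s r => F (s, r)) hFi, ← integral_indicator measurableSet_Ioi]
  congr 1
  refine integral_congr_ae (Eventually.of_forall fun r => ?_)
  simp only
  by_cases hr : 0 < r
  · rw [Set.indicator_of_mem (show r ∈ Set.Ioi 0 from hr), ← integral_const_mul,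
      ← integral_indicator measurableSet_Ioo]
    refine integral_congr_ae (Eventually.of_forall fun s => ?_)
    simp only [hF, Set.indicator, hD, Set.mem_ofPred_eq, Set.mem_Ioo, abs_lt]
  · rw [Set.indicator_of_notMem (show r ∉ Set.Ioi 0 from hr)]
    refine integral_eq_zero_of_ae (Eventually.of_forall fun s => ?_)
    refine Set.indicator_of_notMem (fun h => hr ?_) _
    exact (abs_nonneg s).trans_lt h

/-! ## Decay of the oscillatory integrals -/

/-- An antiderivative of `r ↦ ∫_{-r}^r (a + b s² / r²) cos (c s) ds`. -/
def oscPrimitive (a b c r : ℝ) : ℝ :=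
  -2 * (a + b) * Real.cos (c * r) / c ^ 2 + 4 * b * Real.sin (c * r) / (c ^ 3 * r)

/-- The function `r ↦ ∫_{-r}^r (a + b s² / r²) cos (c s) ds`. -/
def oscKernel (a b c r : ℝ) : ℝ :=
  2 * (a + b) * Real.sin (c * r) / c + 4 * b * Real.cos (c * r) / (c ^ 2 * r) -
    4 * b * Real.sin (c * r) / (c ^ 3 * r ^ 2)

theorem hasDerivAt_oscPrimitive (a b : ℝ) {c r : ℝ} (hc : c ≠ 0) (hr : r ≠ 0) :
    HasDerivAt (oscPrimitive a b c) (oscKernel a b c r) r := by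
  have h0 : HasDerivAt (fun r : ℝ => c * r) c r := by simpa using (hasDerivAt_id r).const_mul c
  have h1 := (h0.cos.const_mul (-2 * (a + b))).div_const (c ^ 2)
  have h2 := (h0.sin.const_mul (4 * b)).div ((hasDerivAt_id r).const_mul (c ^ 3))
    (mul_ne_zero (pow_ne_zero 3 hc) hr)
  refine (h1.add h2).congr_deriv ?_
  rw [oscKernel]
  simp only [id]
  field_simp
  ring

theorem integral_oscKernel (a b : ℝ) {c r : ℝ} (hc : c ≠ 0) (hr : 0 < r) :
    ∫ s in Set.Ioo (-r) r, (a + b * s ^ 2 / r ^ 2) * Real.cos (c * s) = oscKernel a b c r := by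
  have hd : ∀ s ∈ Set.uIcc (-r) r, HasDerivAt (fun s : ℝ => a * Real.sin (c * s) / c +
      b / r ^ 2 * (s ^ 2 * Real.sin (c * s) / c + 2 * s * Real.cos (c * s) / c ^ 2 -
        2 * Real.sin (c * s) / c ^ 3)) ((a + b * s ^ 2 / r ^ 2) * Real.cos (c * s)) s := by
    intro s _
    have h0 : HasDerivAt (fun r : ℝ => c * r) c s := by simpa using (hasDerivAt_id s).const_mul c
    have h1 := (h0.sin.const_mul a).div_const c
    have h2 := ((hasDerivAt_pow 2 s).mul h0.sin).div_const c
    have h3 := (((hasDerivAt_id s).const_mul 2).mul h0.cos).div_const (c ^ 2)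
    have h4 := (h0.sin.const_mul 2).div_const (c ^ 3)
    refine (h1.add (((h2.add h3).sub h4).const_mul (b / r ^ 2))).congr_deriv ?_
    simp only [id]
    field_simp
    push_cast
    ring
  have hi : IntervalIntegrable (fun s : ℝ => (a + b * s ^ 2 / r ^ 2) * Real.cos (c * s)) volume
      (-r) r := Continuous.intervalIntegrable (by fun_prop) _ _
  rw [← integral_Ioc_eq_integral_Ioo, ← intervalIntegral.integral_of_le (by linarith),
    intervalIntegral.integral_eq_sub_of_hasDerivAt hd hi, oscKernel]
  simp only [mul_neg, Real.sin_neg, Real.cos_neg]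
  field_simp
  ring

/-- The apparent singularity at r = 0 is removed by |sin(cr)| ≤ cr, so the quadratic decay in c is
uniform in r > 0. -/
theorem abs_oscPrimitive_le (a b : ℝ) {c r : ℝ} (hc : 0 < c) (hr : 0 < r) :
    |oscPrimitive a b c r| ≤ (2 * |a + b| + 4 * |b|) / c ^ 2 := by
  have h1 : |-2 * (a + b) * Real.cos (c * r) / c ^ 2| ≤ 2 * |a + b| / c ^ 2 := by
    rw [abs_div, abs_mul, abs_mul, abs_neg, abs_two, abs_of_pos (show 0 < c ^ 2 by positivity)]
    refine div_le_div_of_nonneg_right ?_ (by positivity)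
    exact mul_le_of_le_one_right (by positivity) (Real.abs_cos_le_one _)
  have h2 : |4 * b * Real.sin (c * r) / (c ^ 3 * r)| ≤ 4 * |b| / c ^ 2 := by
    have h3 : |Real.sin (c * r)| ≤ c * r := by
      have := Real.abs_sin_le_abs (x := c * r)
      rwa [abs_of_pos (mul_pos hc hr)] at this
    rw [abs_div, abs_mul, abs_mul, abs_of_pos (show (0 : ℝ) < 4 by norm_num),
      abs_of_pos (show 0 < c ^ 3 * r by positivity)]
    calc 4 * |b| * |Real.sin (c * r)| / (c ^ 3 * r) ≤ 4 * |b| * (c * r) / (c ^ 3 * r) := by gcongr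
      _ = 4 * |b| / c ^ 2 := by field_simp
  rw [oscPrimitive, add_div]
  exact (abs_add_le _ _).trans (add_le_add h1 h2)

/-- Read off from the integral representation, where the integrand is bounded by |a| + |b|; the
closed form hides the cancellation at r = 0. -/
theorem abs_oscKernel_le (a b : ℝ) {c r : ℝ} (hc : c ≠ 0) (hr : 0 < r) :
    |oscKernel a b c r| ≤ (|a| + |b|) * (2 * r) := by
  rw [← integral_oscKernel a b hc hr, ← Real.norm_eq_abs]
  refine (norm_setIntegral_le_of_norm_le_const (C := |a| + |b|) (by simp) fun s hs => ?_).trans_eq ?_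
  · have h1 : |b * s ^ 2 / r ^ 2| ≤ |b| := by
      have h2 : s ^ 2 ≤ r ^ 2 := sq_le_sq' hs.1.le hs.2.le
      rw [mul_div_assoc, abs_mul, abs_of_nonneg (show 0 ≤ s ^ 2 / r ^ 2 by positivity)]
      exact mul_le_of_le_one_right (abs_nonneg b) (div_le_one_of_le₀ h2 (by positivity))
    rw [norm_mul, Real.norm_eq_abs, Real.norm_eq_abs]
    calc |a + b * s ^ 2 / r ^ 2| * |Real.cos (c * s)| ≤ (|a| + |b|) * 1 :=
          mul_le_mul ((abs_add_le _ _).trans (by linarith)) (Real.abs_cos_le_one _) (abs_nonneg _)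
            (by positivity)
      _ = _ := mul_one _
  · rw [measureReal_def, Real.volume_Ioo, ENNReal.toReal_ofReal (by linarith)]
    ring

/-- Integration by parts against an oscillating function `K'` with small antiderivative `K`. -/
theorem abs_integral_mul_deriv_le {δ R : ℝ} (h : δ ≤ R) {p p' q q' K K' : ℝ → ℝ}
    (hp : ∀ r ∈ Set.Icc δ R, HasDerivAt p (p' r) r) (hp' : ContinuousOn p' (Set.Icc δ R))
    (hq : ∀ r ∈ Set.Icc δ R, HasDerivAt q (q' r) r) (hq' : ContinuousOn q' (Set.Icc δ R))
    (hK : ∀ r ∈ Set.Icc δ R, HasDerivAt K (K' r) r) (hK' : ContinuousOn K' (Set.Icc δ R))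
    {P M κ : ℝ} (hp1 : ∀ r ∈ Set.Icc δ R, |p r| ≤ 1) (hpP : ∀ r ∈ Set.Icc δ R, |p' r| ≤ P)
    (hqM : ∀ r ∈ Set.Icc δ R, |q r| ≤ M) (hqn : ∀ r ∈ Set.Icc δ R, q' r ≤ 0)
    (hκ : ∀ r ∈ Set.Icc δ R, |K r| ≤ κ) :
    |∫ r in δ..R, p r * q r * K' r| ≤ κ * (4 * M + P * M * (R - δ)) := by
  have hu : Set.uIcc δ R = Set.Icc δ R := Set.uIcc_of_le h
  have hδ : δ ∈ Set.Icc δ R := ⟨le_rfl, h⟩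
  have hR : R ∈ Set.Icc δ R := ⟨h, le_rfl⟩
  have hκ0 : 0 ≤ κ := (abs_nonneg _).trans (hκ δ hδ)
  have hM0 : 0 ≤ M := (abs_nonneg _).trans (hqM δ hδ)
  have hP0 : 0 ≤ P := (abs_nonneg _).trans (hpP δ hδ)
  have hpc : ContinuousOn p (Set.Icc δ R) := fun r hr => (hp r hr).continuousAt.continuousWithinAt
  have hqc : ContinuousOn q (Set.Icc δ R) := fun r hr => (hq r hr).continuousAt.continuousWithinAt
  have hpq' : ContinuousOn (fun r => p' r * q r + p r * q' r) (Set.Icc δ R) :=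
    (hp'.mul hqc).add (hpc.mul hq')
  have hibp := intervalIntegral.integral_mul_deriv_eq_deriv_mul
    (u := fun r => p r * q r) (v := K) (u' := fun r => p' r * q r + p r * q' r) (v' := K')
    (fun r hr => (hp r (hu ▸ hr)).mul (hq r (hu ▸ hr))) (fun r hr => hK r (hu ▸ hr))
    (ContinuousOn.intervalIntegrable (hu.symm ▸ hpq'))
    (ContinuousOn.intervalIntegrable (hu.symm ▸ hK'))
  have hb : ∀ r ∈ Set.Icc δ R, |p r * q r * K r| ≤ M * κ := fun r hr => by
    rw [abs_mul, abs_mul]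
    calc |p r| * |q r| * |K r| ≤ 1 * M * κ :=
          mul_le_mul (mul_le_mul (hp1 r hr) (hqM r hr) (abs_nonneg _) zero_le_one) (hκ r hr)
            (abs_nonneg _) (by positivity)
      _ = _ := by ring
  have hqi : IntervalIntegrable q' volume δ R :=
    ContinuousOn.intervalIntegrable (hu.symm ▸ hq')
  -- Monotonicity of q replaces |q'| by -q', whose integral is at most 2M. No pointwise bound on q'
  -- is needed, so its possible growth near r = 0 does not matter.
  have hint : |∫ r in δ..R, (p' r * q r + p r * q' r) * K r| ≤
      ∫ r in δ..R, κ * (P * M - q' r) := by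
    rw [← Real.norm_eq_abs]
    refine intervalIntegral.norm_integral_le_of_norm_le h ?_
      ((intervalIntegrable_const.sub hqi).const_mul κ)
    refine Eventually.of_forall fun r hr => ?_
    have hr : r ∈ Set.Icc δ R := ⟨hr.1.le, hr.2⟩
    rw [Real.norm_eq_abs, abs_mul, mul_comm]
    refine mul_le_mul (hκ r hr) ((abs_add_le _ _).trans ?_) (abs_nonneg _) hκ0
    rw [abs_mul, abs_mul, abs_of_nonpos (hqn r hr), sub_eq_add_neg]
    exact add_le_add (mul_le_mul (hpP r hr) (hqM r hr) (abs_nonneg _) hP0)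
      (mul_le_of_le_one_left (neg_nonneg.2 (hqn r hr)) (hp1 r hr))
  have hqs : ∫ r in δ..R, q' r = q R - q δ :=
    intervalIntegral.integral_eq_sub_of_hasDerivAt (fun r hr => hq r (hu ▸ hr)) hqi
  rw [intervalIntegral.integral_const_mul, intervalIntegral.integral_sub intervalIntegrable_const
    hqi, intervalIntegral.integral_const, hqs, smul_eq_mul] at hint
  have h3 := (abs_le.1 (hqM R hR)).1
  have h4 := (abs_le.1 (hqM δ hδ)).2
  rw [hibp]
  calc |p R * q R * K R - p δ * q δ * K δ - ∫ r in δ..R, (p' r * q r + p r * q' r) * K r|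
      ≤ M * κ + M * κ + κ * ((R - δ) * (P * M) - (q R - q δ)) :=
        (abs_sub _ _).trans (add_le_add ((abs_sub _ _).trans (add_le_add (hb R hR) (hb δ hδ))) hint)
    _ ≤ M * κ + M * κ + κ * ((R - δ) * (P * M) + 2 * M) := by
        gcongr
        linarith
    _ = _ := by ring

/-! ### From the oscillatory momentum integrals to one radial variable. -/

theorem couplingFactor_sq (c : Cutoff) (Λ : ℝ) (k : R3) :
    couplingFactor c Λ k ^ 2 = c.χ (‖k‖ / Λ) ^ 2 / (2 * Real.pi ^ 2 * ‖k‖) := by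
  rw [couplingFactor, div_pow, mul_pow, mul_pow, Real.sq_sqrt zero_le_two,
    Real.sq_sqrt (norm_nonneg k)]

/-- The exchange of the second and the third coordinate. -/
def swapCoord : R3 ≃ₗᵢ[ℝ] R3 := LinearIsometryEquiv.piLpCongrLeft 2 ℝ ℝ (Equiv.swap 1 2)

theorem swapCoord_apply (k : R3) (i : Fin 3) : swapCoord k i = k (Equiv.swap 1 2 i) := by
  rw [swapCoord, LinearIsometryEquiv.piLpCongrLeft_apply]
  simp [Equiv.piCongrLeft', Equiv.symm_swap]

theorem oscIntegral_two_eq (c : Cutoff) (Λ y : ℝ) (q : ℝ → ℝ) :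
    oscIntegral c Λ y 2 q = oscIntegral c Λ y 1 q := by
  have h := swapCoord.measurePreserving.integral_comp swapCoord.toHomeomorph.measurableEmbedding
    fun k => Real.cos (2 * y * k 0) * photonKernel c Λ 1 1 q k
  rw [oscIntegral, oscIntegral]
  refine Eq.trans ?_ h
  refine integral_congr_ae (Eventually.of_forall fun k => ?_)
  have h0 : Equiv.swap (1 : Fin 3) 2 0 = 0 := by decide
  simp only [photonKernel, couplingFactor, swapCoord.norm_map, swapCoord_apply,
    Equiv.swap_apply_left, h0, if_true]

/-- The functions of `|k|` and `k₁` whose integrals are the oscillatory integrals. -/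
def oscDensity (c : Cutoff) (Λ y a b : ℝ) (q : ℝ → ℝ) (r s : ℝ) : ℝ :=
  c.χ (r / Λ) ^ 2 / (2 * Real.pi ^ 2 * r) * q r * ((a + b * s ^ 2 / r ^ 2) * Real.cos (2 * y * s))

theorem integrable_oscIntegral (c : Cutoff) {Λ : ℝ} (hΛ : 0 < Λ) (y : ℝ) (j : Fin 3) {q : ℝ → ℝ}
    (hq : Measurable q) {M : ℝ} (hM : ∀ r, |q r| ≤ M) :
    Integrable fun k => Real.cos (2 * y * k 0) * photonKernel c Λ j j q k :=
  integrable_mul_photonKernel c hΛ j j hq hM (m := fun k => Real.cos (2 * y * k 0))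
      (by fun_prop) (b := 1) (fun k => Real.abs_cos_le_one _)

/-- Normal to the wall the projection is 1 - k₁²/|k|², so (a, b) = (1, -1). The two tangential
integrals agree by exchanging the coordinates, so each equals their average, with weight (1 +
k₁²/|k|²)/2. The first bound on a, b serves the kernel near r = 0, the second its antiderivative. -/
theorem oscIntegral_eq_integral (c : Cutoff) {Λ : ℝ} (hΛ : 0 < Λ) (y : ℝ) (j : Fin 3)
    {q : ℝ → ℝ} (hq : Measurable q) {M : ℝ} (hM : ∀ r, |q r| ≤ M) :
    ∃ a b : ℝ, |a| + |b| ≤ 2 ∧ 2 * |a + b| + 4 * |b| ≤ 4 ∧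
      Integrable (fun k : R3 => oscDensity c Λ y a b q ‖k‖ (k 0)) ∧
      oscIntegral c Λ y j q = ∫ k : R3, oscDensity c Λ y a b q ‖k‖ (k 0) := by
  have hint := fun j => integrable_oscIntegral c hΛ y j hq hM
  by_cases hj : j = 0
  · subst hj
    have he : ∀ k : R3, Real.cos (2 * y * k 0) * photonKernel c Λ 0 0 q k =
        oscDensity c Λ y 1 (-1) q ‖k‖ (k 0) := fun k => by
      rw [photonKernel, couplingFactor_sq, oscDensity, if_pos rfl]
      ring
    refine ⟨1, -1, by norm_num, by norm_num, ?_, ?_⟩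
    · simpa only [he] using hint 0
    · rw [oscIntegral]
      simp only [he]
  · have he : (fun k : R3 => 1 / 2 * (Real.cos (2 * y * k 0) * photonKernel c Λ 1 1 q k +
        Real.cos (2 * y * k 0) * photonKernel c Λ 2 2 q k)) =ᵐ[volume]
        fun k => oscDensity c Λ y (1 / 2) (1 / 2) q ‖k‖ (k 0) := by
      filter_upwards [ae_ne_zero] with k hk
      have h1 := norm_sq_eq_sum k
      rw [Fin.sum_univ_three] at h1
      have h2 : ‖k‖ ^ 2 ≠ 0 := pow_ne_zero 2 (norm_ne_zero_iff.2 hk)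
      have h3 : (1 - k 1 * k 1 / ‖k‖ ^ 2) + (1 - k 2 * k 2 / ‖k‖ ^ 2) =
          1 + k 0 ^ 2 / ‖k‖ ^ 2 := by
        field_simp
        linarith
      rw [photonKernel, photonKernel, couplingFactor_sq, oscDensity, if_pos rfl, if_pos rfl]
      linear_combination (1 / 2 * Real.cos (2 * y * k 0) *
        (c.χ (‖k‖ / Λ) ^ 2 / (2 * Real.pi ^ 2 * ‖k‖)) * q ‖k‖) * h3
    have hi := ((hint 1).add (hint 2)).const_mul (1 / 2)
    refine ⟨1 / 2, 1 / 2, by norm_num, ?_, hi.congr he, ?_⟩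
    · rw [abs_of_pos (by norm_num : (0 : ℝ) < 1 / 2 + 1 / 2),
        abs_of_pos (by norm_num : (0 : ℝ) < 1 / 2)]
      norm_num
    · rw [← integral_congr_ae he, integral_const_mul, integral_add (hint 1) (hint 2)]
      change _ = 1 / 2 * (oscIntegral c Λ y 1 q + oscIntegral c Λ y 2 q)
      rw [oscIntegral_two_eq]
      have h12 : j = 1 ∨ j = 2 := by
        fin_cases j
        · exact absurd rfl hj
        · exact Or.inl rfl
        · exact Or.inr rfl
      rcases h12 with rfl | rfl
      · ring
      · rw [oscIntegral_two_eq]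
        ring

/-- The factor r from integrating over the sphere cancels the 1/r of the squared coupling, so no
singularity remains. The prefactor is 2π/(2π²). -/
theorem integral_oscDensity (c : Cutoff) {Λ : ℝ} (hΛ : 0 < Λ) {y : ℝ} (hy : y ≠ 0) {a b : ℝ}
    {q : ℝ → ℝ} (hq : Measurable q) {M : ℝ} (hM : ∀ r, |q r| ≤ M)
    (hi : Integrable (fun k : R3 => oscDensity c Λ y a b q ‖k‖ (k 0))) :
    ∫ k : R3, oscDensity c Λ y a b q ‖k‖ (k 0) =
      1 / Real.pi * ∫ r in (0 : ℝ)..Λ, c.χ (r / Λ) ^ 2 * q r * oscKernel a b (2 * y) r := by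
  have hχ := c.smooth.continuous.measurable
  have hM0 : 0 ≤ M := (abs_nonneg _).trans (hM 0)
  have hz : ∀ r, Λ < r → c.χ (r / Λ) = 0 := fun r hr =>
    c.eq_zero _ ((one_lt_div hΛ).2 hr)
  have h := integral_norm_coord (G := oscDensity c Λ y a b q) (C := M * (|a| + |b|)) (R := Λ)
    (by unfold oscDensity Function.uncurry; fun_prop) ?_ ?_ hi
  · rw [h]
    have h1 : ∀ r ∈ Set.Ioi (0 : ℝ), r * ∫ s in Set.Ioo (-r) r, oscDensity c Λ y a b q r s =
        1 / (2 * Real.pi ^ 2) * (c.χ (r / Λ) ^ 2 * q r * oscKernel a b (2 * y) r) := by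
      intro r hr
      have hr : 0 < r := hr
      simp only [oscDensity]
      rw [integral_const_mul, integral_oscKernel a b (mul_ne_zero two_ne_zero hy) hr]
      have := Real.pi_ne_zero
      field_simp
    rw [setIntegral_congr_fun measurableSet_Ioi h1, integral_const_mul,
      intervalIntegral.integral_of_le hΛ.le]
    have h2 : ∫ r in Set.Ioi (0 : ℝ), c.χ (r / Λ) ^ 2 * q r * oscKernel a b (2 * y) r =
        ∫ r in Set.Ioc 0 Λ, c.χ (r / Λ) ^ 2 * q r * oscKernel a b (2 * y) r := by
      refine setIntegral_eq_of_subset_of_forall_sdiff_eq_zero measurableSet_Ioi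
        (fun r hr => hr.1) fun r hr => ?_
      have : Λ < r := not_le.1 fun h => hr.2 ⟨hr.1, h⟩
      rw [hz r this]
      ring
    rw [h2]
    have := Real.pi_ne_zero
    field_simp
  · intro r s hs
    have hr : 0 < r := (abs_nonneg s).trans_lt hs
    have h1 : r * oscDensity c Λ y a b q r s = c.χ (r / Λ) ^ 2 / (2 * Real.pi ^ 2) * q r *
        ((a + b * (s ^ 2 / r ^ 2)) * Real.cos (2 * y * s)) := by
      rw [oscDensity]
      field_simp
    have h2 : s ^ 2 / r ^ 2 ≤ 1 := by
      refine div_le_one_of_le₀ ?_ (by positivity)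
      rw [← sq_abs s]
      exact pow_le_pow_left₀ (abs_nonneg s) hs.le 2
    have h3 : |a + b * (s ^ 2 / r ^ 2)| ≤ |a| + |b| := by
      refine (abs_add_le _ _).trans ?_
      rw [abs_mul, abs_of_nonneg (show 0 ≤ s ^ 2 / r ^ 2 by positivity)]
      gcongr
      exact mul_le_of_le_one_right (abs_nonneg b) h2
    have h4 : |c.χ (r / Λ) ^ 2 / (2 * Real.pi ^ 2)| ≤ 1 := by
      obtain ⟨h5, h6⟩ := c.mem_Icc (r / Λ)
      rw [abs_of_nonneg (by positivity)]
      refine div_le_one_of_le₀ ?_ (by positivity)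
      nlinarith [Real.pi_gt_three]
    rw [h1, abs_mul, abs_mul, abs_mul]
    calc _ ≤ 1 * M * ((|a| + |b|) * 1) := by
          gcongr
          · exact hM r
          · exact Real.abs_cos_le_one _
      _ = _ := by ring
  · intro r s hr
    rw [oscDensity, hz r hr]
    ring

/-- The oscillatory integrals decay quadratically. -/
theorem abs_oscIntegral_le (c : Cutoff) {Λ : ℝ} (hΛ : 0 < Λ) {M : ℝ} (hM0 : 0 ≤ M) :
    ∃ C : ℝ, 0 ≤ C ∧ ∀ y : ℝ, 0 < y → ∀ q q' : ℝ → ℝ, Measurable q → (∀ r, |q r| ≤ M) →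
      (∀ r, 0 < r → HasDerivAt q (q' r) r) → ContinuousOn q' (Set.Ioi 0) →
      (∀ r, 0 < r → q' r ≤ 0) → ∀ j, |oscIntegral c Λ y j q| ≤ C / y ^ 2 := by
  set p : ℝ → ℝ := fun r => c.χ (r / Λ) ^ 2 with hp
  have hpc : ContDiff ℝ ∞ p := (c.smooth.comp (contDiff_id.div_const Λ)).pow 2
  have hp' : Continuous (deriv p) := hpc.continuous_deriv (by simp)
  have hpd : ∀ r, HasDerivAt p (deriv p r) r := fun r =>
    (hpc.differentiable (by simp)).differentiableAt.hasDerivAt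
  have hp1 : ∀ r, |p r| ≤ 1 := fun r => by
    obtain ⟨h5, h6⟩ := c.mem_Icc (r / Λ)
    rw [abs_of_nonneg (by positivity)]
    exact pow_le_one₀ h5 h6
  obtain ⟨P, hP⟩ := (isCompact_Icc (a := 0) (b := Λ)).exists_bound_of_continuousOn hp'.continuousOn
  have hP0 : 0 ≤ P := (norm_nonneg _).trans (hP 0 ⟨le_rfl, hΛ.le⟩)
  refine ⟨4 * M + P * M * Λ, by positivity, ?_⟩
  intro y hy q q' hq hM hqd hqc hqn j
  obtain ⟨a, b, hab, hab', hi, heq⟩ := oscIntegral_eq_integral c hΛ y j hq hM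
  rw [heq, integral_oscDensity c hΛ hy.ne' hq hM hi]
  have hc : 0 < 2 * y := by positivity
  set f : ℝ → ℝ := fun r => p r * q r * oscKernel a b (2 * y) r with hf
  -- This bound does not decay in y; it is used only for integrability and on a vanishingly short
  -- interval at 0.
  have hfb : ∀ r ∈ Set.Ioc 0 Λ, |f r| ≤ 4 * M * Λ := by
    intro r hr
    rw [hf]
    simp only
    rw [abs_mul, abs_mul]
    have h1 := abs_oscKernel_le a b hc.ne' hr.1
    calc |p r| * |q r| * |oscKernel a b (2 * y) r| ≤ 1 * M * (2 * (2 * Λ)) := by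
          refine mul_le_mul (mul_le_mul (hp1 r) (hM r) (abs_nonneg _) zero_le_one) (h1.trans ?_)
            (abs_nonneg _) (by positivity)
          refine mul_le_mul hab ?_ (by linarith [hr.1]) zero_le_two
          linarith [hr.2]
      _ = _ := by ring
  have hfm : Measurable f := by
    have := hpc.continuous.measurable
    unfold f oscKernel
    fun_prop
  have hfi : ∀ u v, 0 ≤ u → u ≤ v → v ≤ Λ → IntervalIntegrable f volume u v := by
    intro u v hu huv hv
    rw [intervalIntegrable_iff_integrableOn_Ioc_of_le huv]
    refine Measure.integrableOn_of_bounded (M := 4 * M * Λ) (by simp) hfm.aestronglyMeasurable ?_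
    refine (ae_restrict_iff' measurableSet_Ioc).2 (Eventually.of_forall fun r hr => ?_)
    exact hfb r ⟨hu.trans_lt hr.1, hr.2.trans hv⟩
  have hmain : |∫ r in (0 : ℝ)..Λ, f r| ≤ 1 / y ^ 2 * (4 * M + P * M * Λ) := by
    refine le_of_forall_pos_le_add fun ε hε => ?_
    -- Differentiability of q is available only for r > 0, so the integration by parts starts at δ
    -- and the piece on [0, δ] costs at most ε. The added 1 keeps the denominator positive when M =
    -- 0.
    set δ := min Λ (ε / (4 * M * Λ + 1)) with hδ
    have hD : 0 < 4 * M * Λ + 1 := by positivity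
    have hδ0 : 0 < δ := lt_min hΛ (by positivity)
    have hδΛ : δ ≤ Λ := min_le_left _ _
    rw [← intervalIntegral.integral_add_adjacent_intervals (hfi 0 δ le_rfl hδ0.le hδΛ)
      (hfi δ Λ hδ0.le hδΛ le_rfl), add_comm]
    refine (abs_add_le _ _).trans (add_le_add ?_ ?_)
    · have hpos : ∀ r ∈ Set.Icc δ Λ, 0 < r := fun r hr => hδ0.trans_le hr.1
      have h := abs_integral_mul_deriv_le hδΛ (p := p) (q := q) (K := oscPrimitive a b (2 * y))
        (K' := oscKernel a b (2 * y)) (κ := 1 / y ^ 2) (P := P) (M := M)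
        (fun r _ => hpd r) hp'.continuousOn (fun r hr => hqd r (hpos r hr))
        (hqc.mono fun r hr => hpos r hr)
        (fun r hr => hasDerivAt_oscPrimitive a b hc.ne' (hpos r hr).ne') ?_ (fun r _ => hp1 r)
        (fun r hr => hP r ⟨(hpos r hr).le, hr.2⟩) (fun r _ => hM r)
        (fun r hr => hqn r (hpos r hr)) ?_
      · refine h.trans ?_
        gcongr
        linarith
      · unfold oscKernel
        refine ContinuousOn.sub (ContinuousOn.add (by fun_prop) ?_) ?_
        · refine ContinuousOn.div (by fun_prop) (by fun_prop) fun r hr => ?_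
          have := hpos r hr
          positivity
        · refine ContinuousOn.div (by fun_prop) (by fun_prop) fun r hr => ?_
          have := hpos r hr
          positivity
      · intro r hr
        refine (abs_oscPrimitive_le a b hc (hpos r hr)).trans ?_
        calc (2 * |a + b| + 4 * |b|) / (2 * y) ^ 2 ≤ 4 / (2 * y) ^ 2 := by gcongr
          _ = 1 / y ^ 2 := by field_simp; norm_num
    · have h := intervalIntegral.norm_integral_le_of_norm_le_const (a := 0) (b := δ) (f := f)
        (C := 4 * M * Λ) (fun r hr => by
          rw [Set.uIoc_of_le hδ0.le] at hr
          exact hfb r ⟨hr.1, hr.2.trans hδΛ⟩)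
      rw [Real.norm_eq_abs, sub_zero, abs_of_pos hδ0] at h
      refine h.trans ?_
      calc 4 * M * Λ * δ ≤ (4 * M * Λ + 1) * (ε / (4 * M * Λ + 1)) :=
            mul_le_mul (by linarith) (min_le_right _ _) hδ0.le hD.le
        _ = ε := by field_simp
  rw [abs_mul, abs_of_pos (by have := Real.pi_pos; positivity)]
  calc 1 / Real.pi * |∫ r in (0 : ℝ)..Λ, f r| ≤ 1 * (1 / y ^ 2 * (4 * M + P * M * Λ)) := by
        refine mul_le_mul ?_ hmain (abs_nonneg _) zero_le_one
        rw [div_le_one Real.pi_pos]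
        linarith [Real.pi_gt_three]
    _ = _ := by ring

/-- The decay estimate is applied with M = 2 to q = 1 and to the diagonal resolvent matrix elements,
whose derivative is -‖(T + r)⁻¹ P_j u_α‖² ≤ 0. Three directions, each with weights 1 and 4, give the
factor 15. -/
theorem exists_abs_normDifference_le (c : Cutoff) {Λ : ℝ} (hΛ : 0 < Λ) (p : Polarization) :
    ∃ C : ℝ, 0 ≤ C ∧ ∀ α y : ℝ, 0 < α → 0 < y →
      |normDifference c hΛ p α y| ≤ C * (α / y ^ 2) := by
  obtain ⟨C, hC0, hC⟩ := abs_oscIntegral_le c hΛ (M := 2) zero_le_two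
  refine ⟨15 * C, by positivity, fun α y hα hy => ?_⟩
  have hT := nonnegSelfAdj_excitation hα.le
  have h1 : ∀ j, |oscIntegral c Λ y j fun _ => 1| ≤ C / y ^ 2 :=
    hC y hy (fun _ => 1) (fun _ => 0) measurable_const (by norm_num)
      (fun r _ => hasDerivAt_const r 1) continuousOn_const (fun _ _ => le_rfl)
  have h2 : ∀ j, |oscIntegral c Λ y j (resolvForm α j j)| ≤ C / y ^ 2 := fun j => by
    refine hC y hy _ (fun r => -‖resolv (excitation α) r (momentumGround α j)‖ ^ 2)
      (measurable_resolvForm hα j j) (abs_resolvForm_le hα j j) (fun r hr => ?_)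
      ((hT.continuousOn_resolv _).norm.pow 2).neg
      (fun r _ => neg_nonpos.2 (sq_nonneg _)) j
    refine (hT.hasDerivAt_inner_resolv hr (momentumGround α j)).congr_of_eventuallyEq ?_
    filter_upwards [lt_mem_nhds hr] with s hs
    exact resolvForm_of_pos α j j hs
  rw [normDifference_eq c hΛ p hα, abs_mul, abs_of_pos hα]
  calc α * |∑ j : Fin 3, (if j = 0 then 1 else -1) *
        (oscIntegral c Λ y j (fun _ => 1) - 4 * oscIntegral c Λ y j (resolvForm α j j))|
      ≤ α * ∑ _j : Fin 3, (C / y ^ 2 + 4 * (C / y ^ 2)) := by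
        gcongr
        refine (Finset.abs_sum_le_sum_abs _ _).trans (Finset.sum_le_sum fun j _ => ?_)
        rw [abs_mul]
        have hs : |(if j = 0 then (1 : ℝ) else -1)| = 1 := by split_ifs <;> simp
        rw [hs, one_mul]
        refine (abs_sub _ _).trans (add_le_add (h1 j) ?_)
        rw [abs_mul, abs_of_pos (show (0 : ℝ) < 4 by norm_num)]
        gcongr
        exact h2 j
    _ = 15 * C * (α / y ^ 2) := by
        simp only [Finset.sum_const, Finset.card_univ, Fintype.card_fin, nsmul_eq_mul]
        push_cast
        ring

end CasimirPolder

end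

/-! ### Conclusion: both quantities are absorbed by the error term. -/

theorem proposition2p8 (c : CasimirPolder.Cutoff) (Λ : ℝ) (hΛ : 0 < Λ)
    (p : CasimirPolder.Polarization) :
    ∃ α₀ : ℝ, 0 < α₀ ∧ α₀ < 1 ∧ ∃ C : ℝ, 0 < C ∧
      ∀ α L : ℝ, 0 < α → α ≤ α₀ → 1 < L →
        CasimirPolder.PhiWellDefined α (CasimirPolder.lambdaInf c hΛ p) ∧
        CasimirPolder.PhiWellDefined α (CasimirPolder.lambdaWall c hΛ p (L / α)) ∧
        |CasimirPolder.normDifference c hΛ p α (L / α)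
            - (α ^ 2 / L ^ 3 - CasimirPolder.aleph α L * (α / L ^ 4))|
          ≤ C * (α ^ 3 / L ^ 2 * Real.log α⁻¹ + α ^ 4 * Real.log α⁻¹) := by
  obtain ⟨C, hC0, hC⟩ := CasimirPolder.exists_abs_normDifference_le c hΛ p
  have hlog2 : 0 < Real.log 2 := Real.log_pos one_lt_two
  -- For α ≤ 1/2 one has log(α⁻¹) ≥ log 2, so dividing by log 2 supplies the logarithm in the error;
  -- C comes from 𝓔 and 3 from the leading term.
  refine ⟨1 / 2, by norm_num, by norm_num, (C + 3) / Real.log 2, by positivity, ?_⟩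
  intro α L hα hα2 hL
  have hL0 : 0 < L := one_pos.trans hL
  have hae : ∀ᵐ k : CasimirPolder.R3, k ≠ 0 := CasimirPolder.ae_ne_zero
  refine ⟨CasimirPolder.phiWellDefined hα hae _,
    CasimirPolder.phiWellDefined hα (ae_restrict_of_ae hae) _, ?_⟩
  have h1 := hC α (L / α) hα (by positivity)
  have h2 := CasimirPolder.leading_term_bound hα hL0
  have hlog : Real.log 2 ≤ Real.log α⁻¹ := by
    refine Real.log_le_log two_pos ?_
    rw [le_inv_comm₀ two_pos hα]
    linarith
  calc |CasimirPolder.normDifference c hΛ p α (L / α)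
        - (α ^ 2 / L ^ 3 - CasimirPolder.aleph α L * (α / L ^ 4))|
      ≤ C * (α / (L / α) ^ 2) + 3 * (α ^ 3 / L ^ 2) := (abs_sub _ _).trans (add_le_add h1 h2)
    -- With y = L/α the bound α/y² is α³/L². The summand 0 is the place that the nonnegative α⁴ term
    -- takes next.
    _ = (C + 3) / Real.log 2 * (α ^ 3 / L ^ 2 * Real.log 2 + 0) := by
        field_simp
        ring
    _ ≤ (C + 3) / Real.log 2 * (α ^ 3 / L ^ 2 * Real.log α⁻¹ + α ^ 4 * Real.log α⁻¹) := by
        have : 0 ≤ α ^ 4 * Real.log α⁻¹ := mul_nonneg (by positivity) (hlog2.le.trans hlog)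
        gcongr
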